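/- Conventions. Rings are commutative with unit, and $\mathbb{R}^+$ is the multiplicative group of positive real numbers. A Banach ring is a ring $A$ with a nonarchimedean norm $|\cdot|$ (so $|x+y|\le\max\{|x|,|y|\}$, $|-x|=|x|$, $|xy|\le|x||y|$, and $|x|=0$ if and only if $x=0$) for which $A$ is complete. For $r>0$, let $A^{\circ,r}$ (resp. $A^{\circ\circ,r}$) be the group of those $a\in A$ for which the sequence $r^{-n}|a^n|$ is bounded (resp. converges to $0$), and let $\operatorname{Gr}A=\bigoplus_{r>0}A^{\circ,r}/A^{\circ\circ,r}$, a graded ring. An affinoid Banach ring is a pair $(A^{\rhd},A^{\mathrm{Gr}})$ consisting of a Banach ring $A^{\rhd}$ and a graded subring $A^{\mathrm{Gr}}$ of $\operatorname{Gr}A^{\rhd}$ which is integrally closed in $\operatorname{Gr}A^{\rhd}$; write $A^{+,r}$ for the set of elements of $A^{\rhd,\circ,r}$ whose class in degree $r$ lies in $A^{\mathrm{Gr}}$. A morphism $(A^{\rhd},A^{\mathrm{Gr}})\to(B^{\rhd},B^{\mathrm{Gr}})$ is a ring homomorphism $f:A^{\rhd}\to B^{\rhd}$ such that $|f(a)|\le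 c|a|$ for some $c>0$ and all $a$, and which induces a map $A^{\mathrm{Gr}}\to B^{\mathrm{Gr}}$. A reified semivaluation on a ring $A$ is a semivaluation $v:A\to\Gamma\cup\{0\}$, with $\Gamma$ a totally ordered abelian group (written multiplicatively), together with a strictly increasing homomorphism $\mathbb{R}^+\to\Gamma$. Let $\Gamma_v$ be the subgroup of $\Gamma$ generated by $\mathbb{R}^+$ and the nonzero values of $v$; two reified semivaluations are equivalent if there is an isomorphism between the groups $\Gamma_v$, compatible with the orderings, with the maps from $\mathbb{R}^+$, and with the semivaluations. The reified adic spectrum $X=\operatorname{Spra}(A^{\rhd},A^{\mathrm{Gr}})$ is the set of equivalence classes of reified semivaluations $v$ on $A^{\rhd}$ such that $v(a)\le r$ for all $r>0$ and all $a\in A^{\rhd,\circ\circ,r}\cup A^{+,r}$, and such that every $\gamma\in\Gamma_v$ satisfies $\gamma\ge r$ for some $r\in\mathbb{R}^+$. Its topology is generated by the sets $\{v: v(a)\le q\,v(b)\ne0\}$ with $a,b\in A^{\rhd}$ and $q\in\mathbb{R}^+$. A rational subspace of $X$ is a subset of the form $\{v: v(f_i)\le q_i\,v(f_0)\neq 0\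 (i=1,\dots,n)\}$, where $f_0,\dots,f_n\in A^{\rhd}$, the elements $f_1,\dots,f_n$ generate the unit ideal, and $q_1,\dots,q_n>0$. A morphism $(A^{\rhd},A^{\mathrm{Gr}})\to(B^{\rhd},B^{\mathrm{Gr}})$ of affinoid Banach rings represents a rational subspace $V$ of $X$ if it is initial among the morphisms from $(A^{\rhd},A^{\mathrm{Gr}})$ to affinoid Banach rings $(C^{\rhd},C^{\mathrm{Gr}})$ for which the image of $\operatorname{Spra}(C^{\rhd},C^{\mathrm{Gr}})$ in $X$ is contained in $V$. The structure presheaf $\mathcal{O}$ on $X$ assigns to each open subset $U$ the ring $\varprojlim B^{\rhd}$, where the inverse limit runs over all morphisms $(A^{\rhd},A^{\mathrm{Gr}})\to(B^{\rhd},B^{\mathrm{Gr}})$ representing rational subspaces of $X$ contained in $U$. The pair $(A^{\rhd},A^{\mathrm{Gr}})$ is sheafy if $\mathcal{O}$ is a sheaf of rings. For $n\ge0$ and $r_1,\dots,r_n>0$, the weighted Tate algebra $A^{\rhd}\{T_1/r_1,\dots,T_n/r_n\}$ is the completion of $A^{\rhd}[T_1,\dots,T_n]$ for the norm $\sum_I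 a_I T^I\mapsto\max_I|a_I|r_1^{i_1}\cdots r_n^{i_n}$. Theorem. Let $(A^{\rhd},A^{\mathrm{Gr}})$ be an affinoid Banach ring which is really strongly noetherian; that is, $A^{\rhd}\{T_1/r_1,\dots,T_n/r_n\}$ is noetherian for all $n\ge0$ and all $r_1,\dots,r_n>0$. Then $(A^{\rhd},A^{\mathrm{Gr}})$ is sheafy. -/

import Mathlib

open Filter Topology
open scoped DirectSum

universe u

namespace Readic

noncomputable section

/-- The multiplicative group of positive real numbers. -/
abbrev PosReal : Type := {x : ℝ // 0 < x}

section Graded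

variable {A : Type u} [NormedCommRing A]

/-- `a ∈ A^{∘,r}`: the sequence `r⁻ⁿ |aⁿ|` is bounded. -/
def IsPowBounded (r : PosReal) (a : A) : Prop :=
  ∃ C : ℝ, ∀ n : ℕ, ((r : ℝ) ^ n)⁻¹ * ‖a ^ n‖ ≤ C

/-- `a ∈ A^{∘∘,r}`: the sequence `r⁻ⁿ |aⁿ|` converges to `0`. -/
def IsTopNilpotent (r : PosReal) (a : A) : Prop :=
  Tendsto (fun n : ℕ => ((r : ℝ) ^ n)⁻¹ * ‖a ^ n‖) atTop (𝓝 0)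

theorem scaledNorm_nonneg (r : PosReal) (a : A) (n : ℕ) : 0 ≤ ((r : ℝ) ^ n)⁻¹ * ‖a ^ n‖ :=
  mul_nonneg (inv_nonneg.2 (pow_nonneg r.2.le n)) (norm_nonneg _)

theorem scaledNorm_mul_le (r s : PosReal) (a b : A) (n : ℕ) :
    (((r * s : PosReal) : ℝ) ^ n)⁻¹ * ‖(a * b) ^ n‖ ≤
      (((r : ℝ) ^ n)⁻¹ * ‖a ^ n‖) * (((s : ℝ) ^ n)⁻¹ * ‖b ^ n‖) := by
  have h : 0 ≤ (((r : ℝ) ^ n)⁻¹ * ((s : ℝ) ^ n)⁻¹) :=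
    mul_nonneg (inv_nonneg.2 (pow_nonneg r.2.le n)) (inv_nonneg.2 (pow_nonneg s.2.le n))
  calc (((r * s : PosReal) : ℝ) ^ n)⁻¹ * ‖(a * b) ^ n‖
      = (((r : ℝ) ^ n)⁻¹ * ((s : ℝ) ^ n)⁻¹) * ‖a ^ n * b ^ n‖ := by
        rw [Positive.val_mul, mul_pow, mul_pow, mul_inv]
    _ ≤ (((r : ℝ) ^ n)⁻¹ * ((s : ℝ) ^ n)⁻¹) * (‖a ^ n‖ * ‖b ^ n‖) :=
        mul_le_mul_of_nonneg_left (norm_mul_le _ _) h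
    _ = _ := by ring

theorem IsTopNilpotent.isPowBounded {r : PosReal} {a : A} (h : IsTopNilpotent r a) :
    IsPowBounded r a := by
  obtain ⟨C, hC⟩ := h.bddAbove_range
  exact ⟨C, fun n => hC ⟨n, rfl⟩⟩

theorem IsPowBounded.mul {r s : PosReal} {a b : A} (ha : IsPowBounded r a)
    (hb : IsPowBounded s b) : IsPowBounded (r * s) (a * b) := by
  obtain ⟨C, hC⟩ := ha
  obtain ⟨D, hD⟩ := hb
  refine ⟨C * D, fun n => (scaledNorm_mul_le r s a b n).trans ?_⟩
  exact mul_le_mul (hC n) (hD n) (scaledNorm_nonneg _ _ _) ((scaledNorm_nonneg _ _ _).trans (hC n))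

theorem IsPowBounded.mul_isTopNilpotent {r s : PosReal} {a b : A} (ha : IsPowBounded r a)
    (hb : IsTopNilpotent s b) : IsTopNilpotent (r * s) (a * b) := by
  obtain ⟨C, hC⟩ := ha
  have h0 : Tendsto (fun n : ℕ => C * (((s : ℝ) ^ n)⁻¹ * ‖b ^ n‖)) atTop (𝓝 0) := by
    simpa using Tendsto.const_mul C hb
  refine squeeze_zero (fun n => scaledNorm_nonneg _ _ _) (fun n => ?_) h0
  exact (scaledNorm_mul_le r s a b n).trans
    (mul_le_mul_of_nonneg_right (hC n) (scaledNorm_nonneg _ _ _))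

theorem isPowBounded_one : IsPowBounded (1 : PosReal) (1 : A) :=
  ⟨‖(1 : A)‖, fun n => by simp⟩

theorem isTopNilpotent_zero (r : PosReal) : IsTopNilpotent r (0 : A) := by
  refine tendsto_const_nhds.congr' ?_
  filter_upwards [eventually_ge_atTop 1] with n hn
  simp [zero_pow (by omega : n ≠ 0)]

theorem IsPowBounded.neg {r : PosReal} {a : A} (h : IsPowBounded r a) : IsPowBounded r (-a) := by
  obtain ⟨C, hC⟩ := h
  refine ⟨C, fun n => ?_⟩
  rcases neg_one_pow_eq_or A n with hn | hn <;> simpa [neg_pow a n, hn] using hC n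

theorem IsTopNilpotent.neg {r : PosReal} {a : A} (h : IsTopNilpotent r a) :
    IsTopNilpotent r (-a) := by
  refine Tendsto.congr (fun n => ?_) h
  rcases neg_one_pow_eq_or A n with hn | hn <;> simp [neg_pow a n, hn]

variable [IsUltrametricDist A]

theorem norm_nsmul_le_self (n : ℕ) (a : A) : ‖n • a‖ ≤ ‖a‖ := by
  induction n with
  | zero => simp
  | succ n ih =>
    rw [succ_nsmul]
    exact (IsUltrametricDist.norm_add_le_max _ _).trans (max_le ih le_rfl)

theorem scaledNorm_add_le (r : PosReal) (a b : A) (n : ℕ) :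
    ∃ p ∈ Finset.HasAntidiagonal.antidiagonal n, ((r : ℝ) ^ n)⁻¹ * ‖(a + b) ^ n‖ ≤
      (((r : ℝ) ^ p.1)⁻¹ * ‖a ^ p.1‖) * (((r : ℝ) ^ p.2)⁻¹ * ‖b ^ p.2‖) := by
  have hne : (Finset.HasAntidiagonal.antidiagonal n).Nonempty := ⟨(0, n), by simp⟩
  obtain ⟨p, hp, hle⟩ := IsUltrametricDist.exists_norm_finsetSum_le_of_nonempty hne
    (fun m : ℕ × ℕ => n.choose m.1 • (a ^ m.1 * b ^ m.2))
  refine ⟨p, hp, ?_⟩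
  rw [← (Commute.all a b).add_pow'] at hle
  have hpn : p.1 + p.2 = n := Finset.HasAntidiagonal.mem_antidiagonal.1 hp
  have hr : ((r : ℝ) ^ n)⁻¹ = ((r : ℝ) ^ p.1)⁻¹ * ((r : ℝ) ^ p.2)⁻¹ := by
    rw [← hpn, pow_add, mul_inv]
  have h0 : 0 ≤ ((r : ℝ) ^ n)⁻¹ := inv_nonneg.2 (pow_nonneg r.2.le n)
  calc ((r : ℝ) ^ n)⁻¹ * ‖(a + b) ^ n‖
      ≤ ((r : ℝ) ^ n)⁻¹ * (‖a ^ p.1‖ * ‖b ^ p.2‖) :=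
        mul_le_mul_of_nonneg_left
          (hle.trans ((norm_nsmul_le_self _ _).trans (norm_mul_le _ _))) h0
    _ = _ := by rw [hr]; ring

theorem IsPowBounded.add {r : PosReal} {a b : A} (ha : IsPowBounded r a)
    (hb : IsPowBounded r b) : IsPowBounded r (a + b) := by
  obtain ⟨C, hC⟩ := ha
  obtain ⟨D, hD⟩ := hb
  refine ⟨C * D, fun n => ?_⟩
  obtain ⟨p, -, hle⟩ := scaledNorm_add_le r a b n
  exact hle.trans (mul_le_mul (hC _) (hD _) (scaledNorm_nonneg _ _ _)
    ((scaledNorm_nonneg _ _ _).trans (hC p.1)))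

theorem IsTopNilpotent.add {r : PosReal} {a b : A} (ha : IsTopNilpotent r a)
    (hb : IsTopNilpotent r b) : IsTopNilpotent r (a + b) := by
  unfold IsTopNilpotent at ha hb ⊢
  rw [← Nat.cofinite_eq_atTop] at ha hb ⊢
  have h := Finset.HasAntidiagonal.tendsto_sup'_antidiagonal_cofinite (tendsto_mul_cofinite_nhds_zero ha hb)
  refine squeeze_zero (fun n => scaledNorm_nonneg _ _ _) (fun n => ?_) h
  obtain ⟨p, hp, hle⟩ := scaledNorm_add_le r a b n
  exact hle.trans (Finset.le_sup' (fun i : ℕ × ℕ => (((r : ℝ) ^ i.1)⁻¹ * ‖a ^ i.1‖) *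
    (((r : ℝ) ^ i.2)⁻¹ * ‖b ^ i.2‖)) hp)

variable (A)

/-- The additive group `A^{∘,r}`. -/
def powBounded (r : PosReal) : AddSubgroup A where
  carrier := {a | IsPowBounded r a}
  zero_mem' := (isTopNilpotent_zero r).isPowBounded
  add_mem' := IsPowBounded.add
  neg_mem' := IsPowBounded.neg

/-- The additive group `A^{∘∘,r}`. -/
def topNilpotent (r : PosReal) : AddSubgroup A where
  carrier := {a | IsTopNilpotent r a}
  zero_mem' := isTopNilpotent_zero r
  add_mem' := IsTopNilpotent.add
  neg_mem' := IsTopNilpotent.neg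

/-- The graded piece `Gr^r A = A^{∘,r} / A^{∘∘,r}`. The index is written additively, because
Mathlib's graded rings have additive index monoids; the grading is by the multiplicative group of
positive reals. -/
abbrev GrPiece (r : Additive PosReal) : Type u :=
  powBounded A r.toMul ⧸ (topNilpotent A r.toMul).addSubgroupOf (powBounded A r.toMul)

variable {A}

/-- The class in `Gr^r A` of an element of `A^{∘,r}`. -/
def grMk {r : Additive PosReal} (a : powBounded A r.toMul) : GrPiece A r :=
  QuotientAddGroup.mk a

theorem grMk_eq_iff {r : Additive PosReal} {a b : powBounded A r.toMul} :
    grMk a = grMk b ↔ IsTopNilpotent r.toMul ((b : A) - a) := by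
  unfold grMk
  rw [QuotientAddGroup.eq, AddSubgroup.mem_addSubgroupOf]
  have h : ((-a + b : powBounded A r.toMul) : A) = (b : A) - a := by
    push_cast; ring
  rw [h]
  rfl

theorem grMk_sigma_ext {r s : Additive PosReal} (h : r = s) {a : powBounded A r.toMul}
    {b : powBounded A s.toMul} (hab : (a : A) = b) :
    GradedMonoid.mk (A := GrPiece A) r (grMk a) = GradedMonoid.mk s (grMk b) := by
  subst h
  rw [Subtype.ext hab]

/-- The product `Gr^r A × Gr^s A → Gr^{rs} A` induced by the product of `A`. -/
def grMul {r s : Additive PosReal} (x : GrPiece A r) (y : GrPiece A s) : GrPiece A (r + s) :=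
  Quotient.liftOn₂' x y
    (fun a b => grMk (r := r + s) ⟨(a : A) * b, IsPowBounded.mul a.2 b.2⟩)
    (fun a₁ b₁ a₂ b₂ ha hb => by
      have ha' : IsTopNilpotent r.toMul ((a₂ : A) - a₁) := grMk_eq_iff.1 (Quotient.sound' ha)
      have hb' : IsTopNilpotent s.toMul ((b₂ : A) - b₁) := grMk_eq_iff.1 (Quotient.sound' hb)
      rw [grMk_eq_iff]
      have e : (a₂ : A) * b₂ - (a₁ : A) * b₁ =
          a₂ * ((b₂ : A) - b₁) + b₁ * ((a₂ : A) - a₁) := by ring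
      change IsTopNilpotent (r.toMul * s.toMul) ((a₂ : A) * b₂ - (a₁ : A) * b₁)
      rw [e]
      refine IsTopNilpotent.add (IsPowBounded.mul_isTopNilpotent a₂.2 hb') ?_
      rw [mul_comm r.toMul s.toMul]
      exact IsPowBounded.mul_isTopNilpotent b₁.2 ha')

theorem grMul_mk {r s : Additive PosReal} (a : powBounded A r.toMul) (b : powBounded A s.toMul) :
    grMul (grMk a) (grMk b) =
      grMk (r := r + s) ⟨(a : A) * b, IsPowBounded.mul a.2 b.2⟩ := rfl

theorem grMk_surjective {r : Additive PosReal} (x : GrPiece A r) : ∃ a, grMk a = x :=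
  QuotientAddGroup.mk_surjective x

theorem grMk_add {r : Additive PosReal} (a b : powBounded A r.toMul) :
    grMk a + grMk b = grMk (a + b) := rfl

instance instGOneGrPiece : GradedMonoid.GOne (GrPiece A) where
  one := grMk (r := 0) ⟨1, isPowBounded_one⟩

instance instGMulGrPiece : GradedMonoid.GMul (GrPiece A) where
  mul := grMul

/-- `Gr A` is a graded commutative ring. -/
instance instGCommRingGrPiece : DirectSum.GCommRing (GrPiece A) where
  mul_zero := fun {r s} x => by
    obtain ⟨a, rfl⟩ := grMk_surjective x
    exact congrArg grMk (Subtype.ext (mul_zero (a : A)))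
  zero_mul := fun {r s} x => by
    obtain ⟨a, rfl⟩ := grMk_surjective x
    exact congrArg grMk (Subtype.ext (zero_mul (a : A)))
  mul_add := fun {r s} x y z => by
    obtain ⟨a, rfl⟩ := grMk_surjective x
    obtain ⟨b, rfl⟩ := grMk_surjective y
    obtain ⟨c, rfl⟩ := grMk_surjective z
    exact congrArg grMk (Subtype.ext (mul_add (a : A) b c))
  add_mul := fun {r s} x y z => by
    obtain ⟨a, rfl⟩ := grMk_surjective x
    obtain ⟨b, rfl⟩ := grMk_surjective y
    obtain ⟨c, rfl⟩ := grMk_surjective z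
    exact congrArg grMk (Subtype.ext (add_mul (a : A) b c))
  one_mul := fun ⟨r, x⟩ => by
    obtain ⟨a, rfl⟩ := grMk_surjective x
    exact grMk_sigma_ext (zero_add r) (one_mul (a : A))
  mul_one := fun ⟨r, x⟩ => by
    obtain ⟨a, rfl⟩ := grMk_surjective x
    exact grMk_sigma_ext (add_zero r) (mul_one (a : A))
  mul_assoc := fun ⟨r, x⟩ ⟨s, y⟩ ⟨t, z⟩ => by
    obtain ⟨a, rfl⟩ := grMk_surjective x
    obtain ⟨b, rfl⟩ := grMk_surjective y
    obtain ⟨c, rfl⟩ := grMk_surjective z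
    exact grMk_sigma_ext (add_assoc r s t) (mul_assoc (a : A) b c)
  mul_comm := fun ⟨r, x⟩ ⟨s, y⟩ => by
    obtain ⟨a, rfl⟩ := grMk_surjective x
    obtain ⟨b, rfl⟩ := grMk_surjective y
    exact grMk_sigma_ext (add_comm r s) (mul_comm (a : A) b)
  natCast := fun n => n • grMk (r := 0) ⟨1, isPowBounded_one⟩
  natCast_zero := zero_nsmul _
  natCast_succ := fun n => succ_nsmul _ n
  intCast := fun n => n • grMk (r := 0) ⟨1, isPowBounded_one⟩
  intCast_ofNat := fun n => natCast_zsmul _ n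
  intCast_negSucc_ofNat := fun n => negSucc_zsmul _ n

variable (A)

/-- The graded ring `Gr A = ⨁_{r > 0} Gr^r A`. -/
abbrev Gr : Type u := ⨁ r : Additive PosReal, GrPiece A r

variable {A}

/-- The element of `Gr A` given by the class in degree `r` of an element of `A^{∘,r}`. -/
def grOf (r : PosReal) (a : powBounded A r) : Gr A :=
  DirectSum.of (GrPiece A) (Additive.ofMul r) (grMk (r := Additive.ofMul r) a)

end Graded

section TateAlgebra

variable (A : Type u) [NormedCommRing A] {n : ℕ}

theorem hasGaussNorm_coe (r : Fin n → PosReal) (p : MvPolynomial (Fin n) A) :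
    MvPowerSeries.HasGaussNorm (norm : A → ℝ) (fun i => (r i : ℝ))
      (p : MvPowerSeries (Fin n) A) := by
  refine Set.Finite.bddAbove ((p.support.finite_toSet.image (fun t : Fin n →₀ ℕ =>
    ‖MvPowerSeries.coeff t (p : MvPowerSeries (Fin n) A)‖ *
      t.prod (fun i k => (r i : ℝ) ^ k))).insert 0 |>.subset ?_)
  rintro _ ⟨t, rfl⟩
  by_cases ht : t ∈ p.support
  · exact Or.inr ⟨t, ht, rfl⟩
  · left
    have h : MvPowerSeries.coeff t (p : MvPowerSeries (Fin n) A) = 0 := by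
      simpa [MvPolynomial.coeff_coe] using ht
    simp [h]

variable [IsUltrametricDist A]

/-- The weighted Gauss norm `∑ a_I T^I ↦ max |a_I| r^I` on `A[T₁, …, Tₙ]`. -/
def weightedGaussNorm (r : Fin n → PosReal) : RingNorm (MvPolynomial (Fin n) A) where
  toFun p := MvPowerSeries.gaussNorm (norm : A → ℝ) (fun i => (r i : ℝ))
    (p : MvPowerSeries (Fin n) A)
  map_zero' := by simp
  add_le' p q := by
    rw [MvPolynomial.coe_add]
    refine (MvPowerSeries.gaussNorm_add_le_max _ _ _ _ (fun i => (r i).2.le)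
      (fun a => norm_nonneg a) (fun a b => IsUltrametricDist.norm_add_le_max a b)
      (hasGaussNorm_coe A r p) (hasGaussNorm_coe A r q)).trans ?_
    exact max_le_add_of_nonneg
      (MvPowerSeries.gaussNorm_nonneg _ _ _ (fun a => norm_nonneg a))
      (MvPowerSeries.gaussNorm_nonneg _ _ _ (fun a => norm_nonneg a))
  neg' p := by
    have h : ((-p : MvPolynomial (Fin n) A) : MvPowerSeries (Fin n) A) =
        -(p : MvPowerSeries (Fin n) A) :=
      map_neg (MvPolynomial.coeToMvPowerSeries.ringHom (σ := Fin n) (R := A)) p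
    rw [h]
    exact MvPowerSeries.gaussNorm_neg _ _ (fun a => norm_neg a) _
  mul_le' p q := by
    rw [MvPolynomial.coe_mul]
    exact MvPowerSeries.gaussNorm_mul_le _ _ _ _ (fun i => (r i).2.le)
      (fun a => norm_nonneg a) norm_mul_le
      (fun a b => IsUltrametricDist.norm_add_le_max a b) norm_zero
      (hasGaussNorm_coe A r p) (hasGaussNorm_coe A r q)
  eq_zero_of_map_eq_zero' p hp := by
    have h := (MvPowerSeries.gaussNorm_eq_zero_iff (norm : A → ℝ) (fun i => (r i : ℝ))
      (p : MvPowerSeries (Fin n) A) norm_zero (fun a => norm_nonneg a)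
      (fun a ha => norm_eq_zero.1 ha) (fun i => (r i).2) (hasGaussNorm_coe A r p)).1 hp
    exact MvPolynomial.coe_injective _ _ (by simpa using h)

/-- The polynomial ring `A[T₁, …, Tₙ]`, regarded as a normed ring for the weighted Gauss norm. -/
def GaussPolynomial (_r : Fin n → PosReal) : Type u := MvPolynomial (Fin n) A

instance instNormedCommRingGaussPolynomial (r : Fin n → PosReal) :
    NormedCommRing (GaussPolynomial A r) :=
  { @RingNorm.toNormedRing (MvPolynomial (Fin n) A) _ (weightedGaussNorm A r) with
    mul_comm := fun p q => mul_comm (G := MvPolynomial (Fin n) A) p q }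

/-- The weighted Tate algebra `A{T₁/r₁, …, Tₙ/rₙ}`: the completion of `A[T₁, …, Tₙ]` for the
weighted Gauss norm. -/
abbrev WeightedTateAlgebra (r : Fin n → PosReal) : Type u :=
  UniformSpace.Completion (GaussPolynomial A r)

/-- All weighted Tate algebras over `A` are noetherian. -/
def IsReallyStronglyNoetherian : Prop :=
  ∀ (n : ℕ) (r : Fin n → PosReal), IsNoetherianRing (WeightedTateAlgebra A r)

end TateAlgebra

section Valuations

/-- A reified semivaluation on a ring `A`: a semivaluation with values in `Γ ∪ {0}`, where `Γ` is a
totally ordered abelian group (written multiplicatively) equipped with an order-preserving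
embedding of the group of positive reals. -/
structure ReifiedValuation (A : Type u) [CommRing A] where
  /-- the value group -/
  Γ : Type u
  [commGroup : CommGroup Γ]
  [linearOrder : LinearOrder Γ]
  [isOrderedMonoid : IsOrderedMonoid Γ]
  /-- the semivaluation -/
  val : Valuation A (WithZero Γ)
  /-- the reification -/
  reif : PosReal →* Γ
  reif_strictMono : StrictMono reif

attribute [instance] ReifiedValuation.commGroup ReifiedValuation.linearOrder
  ReifiedValuation.isOrderedMonoid

namespace ReifiedValuation

variable {A : Type u} [CommRing A]

/-- The relation `v(a) ≤ q v(b)`. -/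
def Le (v : ReifiedValuation A) (a : A) (q : PosReal) (b : A) : Prop :=
  v.val a ≤ (v.reif q : WithZero v.Γ) * v.val b

/-- The group `Γ_v`, generated by the positive reals and the nonzero values of `v`. -/
def valueGroup (v : ReifiedValuation A) : Subgroup v.Γ :=
  Subgroup.closure (Set.range v.reif ∪ {γ | ∃ a, v.val a = (γ : WithZero v.Γ)})

theorem reif_mem_valueGroup (v : ReifiedValuation A) (q : PosReal) : v.reif q ∈ v.valueGroup :=
  Subgroup.subset_closure (Or.inl ⟨q, rfl⟩)

theorem mem_valueGroup_of_val_eq (v : ReifiedValuation A) {a : A} {γ : v.Γ}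
    (h : v.val a = (γ : WithZero v.Γ)) : γ ∈ v.valueGroup :=
  Subgroup.subset_closure (Or.inr ⟨a, h⟩)

/-- An isomorphism of reified value groups `Γ_v ≃ Γ_w` carrying `v` to `w`. -/
structure Equivalence (v w : ReifiedValuation A) where
  /-- the isomorphism of ordered groups -/
  iso : v.valueGroup ≃*o w.valueGroup
  map_reif : ∀ q : PosReal,
    iso ⟨v.reif q, v.reif_mem_valueGroup q⟩ = ⟨w.reif q, w.reif_mem_valueGroup q⟩
  map_val : ∀ (a : A) (γ : v.valueGroup),
    v.val a = ((γ : v.Γ) : WithZero v.Γ) ↔ w.val a = ((iso γ : w.Γ) : WithZero w.Γ)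

/-- Equivalence of reified semivaluations. -/
def IsEquiv (v w : ReifiedValuation A) : Prop := Nonempty (Equivalence v w)

theorem IsEquiv.refl (v : ReifiedValuation A) : IsEquiv v v :=
  ⟨⟨OrderMonoidIso.refl _, fun _ => rfl, fun _ _ => Iff.rfl⟩⟩

/-- The inverse of an equivalence. -/
def Equivalence.symm {v w : ReifiedValuation A} (e : Equivalence v w) : Equivalence w v where
  iso := e.iso.symm
  map_reif := fun q => by
    rw [← e.map_reif q]
    exact e.iso.toEquiv.symm_apply_apply _
  map_val := fun a γ => by
    have h := e.map_val a (e.iso.symm γ)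
    have h' : e.iso (e.iso.symm γ) = γ := e.iso.toEquiv.apply_symm_apply γ
    rw [h'] at h
    exact h.symm

theorem IsEquiv.symm {v w : ReifiedValuation A} : IsEquiv v w → IsEquiv w v :=
  fun ⟨e⟩ => ⟨e.symm⟩

theorem IsEquiv.trans {u v w : ReifiedValuation A} : IsEquiv u v → IsEquiv v w → IsEquiv u w := by
  rintro ⟨e⟩ ⟨f⟩
  refine ⟨⟨e.iso.trans f.iso, fun q => ?_, fun a γ => ?_⟩⟩
  · change f.iso (e.iso _) = _
    rw [e.map_reif q, f.map_reif q]
  · exact (e.map_val a γ).trans (f.map_val a (e.iso γ))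

theorem Equivalence.val_eq_zero_iff {v w : ReifiedValuation A} (e : Equivalence v w) (a : A) :
    v.val a = 0 ↔ w.val a = 0 := by
  constructor
  · intro h
    by_contra hw
    obtain ⟨δ, hδ⟩ := WithZero.ne_zero_iff_exists.1 hw
    let γ : v.valueGroup := e.iso.symm ⟨δ, w.mem_valueGroup_of_val_eq hδ.symm⟩
    have hγ : e.iso γ = ⟨δ, w.mem_valueGroup_of_val_eq hδ.symm⟩ :=
      e.iso.toEquiv.apply_symm_apply _
    have h2 : v.val a = ((γ : v.Γ) : WithZero v.Γ) := (e.map_val a γ).2 (by rw [hγ, hδ])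
    rw [h] at h2
    exact WithZero.zero_ne_coe h2
  · intro h
    by_contra hv
    obtain ⟨δ, hδ⟩ := WithZero.ne_zero_iff_exists.1 hv
    have h2 := (e.map_val a ⟨δ, v.mem_valueGroup_of_val_eq hδ.symm⟩).1 hδ.symm
    rw [h] at h2
    exact WithZero.zero_ne_coe h2

theorem Equivalence.le_of_le {v w : ReifiedValuation A} (e : Equivalence v w) {a b : A}
    {q : PosReal} (h : v.Le a q b) : w.Le a q b := by
  unfold Le at h ⊢
  by_cases ha : v.val a = 0
  · rw [(e.val_eq_zero_iff a).1 ha]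
    exact zero_le
  by_cases hb : v.val b = 0
  · rw [hb, mul_zero] at h
    exact absurd (le_antisymm h zero_le) ha
  obtain ⟨α, hα⟩ := WithZero.ne_zero_iff_exists.1 ha
  obtain ⟨β, hβ⟩ := WithZero.ne_zero_iff_exists.1 hb
  have hα' := (e.map_val a ⟨α, v.mem_valueGroup_of_val_eq hα.symm⟩).1 hα.symm
  have hβ' := (e.map_val b ⟨β, v.mem_valueGroup_of_val_eq hβ.symm⟩).1 hβ.symm
  rw [← hα, ← hβ, ← WithZero.coe_mul, WithZero.coe_le_coe] at h
  rw [hα', hβ', ← WithZero.coe_mul, WithZero.coe_le_coe]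
  have h1 : (⟨α, v.mem_valueGroup_of_val_eq hα.symm⟩ : v.valueGroup) ≤
      ⟨v.reif q, v.reif_mem_valueGroup q⟩ * ⟨β, v.mem_valueGroup_of_val_eq hβ.symm⟩ := h
  have h2 := (map_le_map_iff e.iso).2 h1
  rw [map_mul, e.map_reif] at h2
  exact h2

theorem IsEquiv.le_iff {v w : ReifiedValuation A} (h : IsEquiv v w) (a b : A) (q : PosReal) :
    v.Le a q b ↔ w.Le a q b := by
  refine ⟨fun hv => ?_, fun hw => ?_⟩
  · obtain ⟨e⟩ := h
    exact e.le_of_le hv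
  · obtain ⟨e⟩ := h.symm
    exact e.le_of_le hw

theorem IsEquiv.val_eq_zero_iff {v w : ReifiedValuation A} (h : IsEquiv v w) (a : A) :
    v.val a = 0 ↔ w.val a = 0 := by
  obtain ⟨e⟩ := h
  exact e.val_eq_zero_iff a

/-- Equivalence of reified semivaluations as a setoid. -/
instance setoid (A : Type u) [CommRing A] : Setoid (ReifiedValuation A) :=
  ⟨IsEquiv, IsEquiv.refl, IsEquiv.symm, IsEquiv.trans⟩

/-- Every element of `Γ_v` is bounded below by a positive real. -/
def IsCoinitial (v : ReifiedValuation A) : Prop :=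
  ∀ γ ∈ v.valueGroup, ∃ r : PosReal, v.reif r ≤ γ

theorem IsEquiv.isCoinitial {v w : ReifiedValuation A} (h : IsEquiv v w) (hv : v.IsCoinitial) :
    w.IsCoinitial := by
  obtain ⟨e⟩ := h
  intro γ hγ
  obtain ⟨r, hr⟩ := hv _ (e.iso.symm ⟨γ, hγ⟩).2
  refine ⟨r, ?_⟩
  have h1 : (⟨v.reif r, v.reif_mem_valueGroup r⟩ : v.valueGroup) ≤ e.iso.symm ⟨γ, hγ⟩ := hr
  have h2 := (map_le_map_iff e.iso).2 h1
  rw [e.map_reif] at h2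
  have h3 : e.iso (e.iso.symm ⟨γ, hγ⟩) = ⟨γ, hγ⟩ := e.iso.toEquiv.apply_symm_apply _
  rw [h3] at h2
  exact h2

/-- Restriction of a reified semivaluation along a ring homomorphism. -/
def comap {B : Type u} [CommRing B] (f : A →+* B) (v : ReifiedValuation B) :
    ReifiedValuation A where
  Γ := v.Γ
  val := v.val.comap f
  reif := v.reif
  reif_strictMono := v.reif_strictMono

theorem valueGroup_comap_le {B : Type u} [CommRing B] (f : A →+* B) (v : ReifiedValuation B) :
    (v.comap f).valueGroup ≤ v.valueGroup := by
  refine (Subgroup.closure_le (G := v.Γ) _).2 ?_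
  rintro γ (⟨q, rfl⟩ | ⟨a, ha⟩)
  · exact v.reif_mem_valueGroup q
  · exact v.mem_valueGroup_of_val_eq (a := f a) ha

theorem Equivalence.mem_comap {B : Type u} [CommRing B] (f : A →+* B) {v w : ReifiedValuation B}
    (e : Equivalence v w) (γ : v.valueGroup) (hγ : (γ : v.Γ) ∈ (v.comap f).valueGroup) :
    ((e.iso γ : w.valueGroup) : w.Γ) ∈ (w.comap f).valueGroup := by
  let K : Subgroup v.Γ := (((w.comap f).valueGroup.subgroupOf w.valueGroup).comap
    (e.iso.toMulEquiv.toMonoidHom)).map v.valueGroup.subtype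
  have hK : (v.comap f).valueGroup ≤ K := by
    refine (Subgroup.closure_le (G := v.Γ) _).2 ?_
    rintro δ (⟨q, rfl⟩ | ⟨a, ha⟩)
    · refine ⟨⟨v.reif q, v.reif_mem_valueGroup q⟩, ?_, rfl⟩
      change ((e.iso ⟨v.reif q, v.reif_mem_valueGroup q⟩ : w.valueGroup) : w.Γ) ∈
        (w.comap f).valueGroup
      rw [e.map_reif]
      exact (w.comap f).reif_mem_valueGroup q
    · have ha' : v.val (f a) = (δ : WithZero v.Γ) := ha
      refine ⟨⟨δ, v.mem_valueGroup_of_val_eq ha'⟩, ?_, rfl⟩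
      exact (w.comap f).mem_valueGroup_of_val_eq (a := a) ((e.map_val (f a) _).1 ha')
  obtain ⟨δ, hδ, hδγ⟩ := hK hγ
  have : δ = γ := Subtype.ext hδγ
  subst this
  exact hδ

theorem IsEquiv.comap {B : Type u} [CommRing B] (f : A →+* B) {v w : ReifiedValuation B}
    (h : IsEquiv v w) : IsEquiv (v.comap f) (w.comap f) := by
  obtain ⟨e⟩ := h
  have hmem : ∀ γ : (w.comap f).valueGroup,
      ((e.iso.symm ⟨γ.1, w.valueGroup_comap_le f γ.2⟩ : v.valueGroup) : v.Γ) ∈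
        (v.comap f).valueGroup := by
    intro γ
    exact e.symm.mem_comap f ⟨γ.1, w.valueGroup_comap_le f γ.2⟩ γ.2
  refine ⟨⟨{
    toFun := fun γ => ⟨(e.iso ⟨γ.1, v.valueGroup_comap_le f γ.2⟩).1, e.mem_comap f _ γ.2⟩
    invFun := fun γ => ⟨(e.iso.symm ⟨γ.1, w.valueGroup_comap_le f γ.2⟩).1, hmem γ⟩
    left_inv := fun γ => Subtype.ext (by
      have h := e.iso.toEquiv.symm_apply_apply ⟨γ.1, v.valueGroup_comap_le f γ.2⟩
      exact congrArg (fun z : v.valueGroup => z.1) h)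
    right_inv := fun γ => Subtype.ext (by
      have h := e.iso.toEquiv.apply_symm_apply ⟨γ.1, w.valueGroup_comap_le f γ.2⟩
      exact congrArg (fun z : w.valueGroup => z.1) h)
    map_mul' := fun γ δ => Subtype.ext (by
      have h := map_mul e.iso ⟨γ.1, v.valueGroup_comap_le f γ.2⟩
        ⟨δ.1, v.valueGroup_comap_le f δ.2⟩
      exact congrArg (fun z : w.valueGroup => z.1) h)
    map_le_map_iff' := fun {γ δ} => map_le_map_iff e.iso
      (a := ⟨γ.1, v.valueGroup_comap_le f γ.2⟩) (b := ⟨δ.1, v.valueGroup_comap_le f δ.2⟩) },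
    fun q => ?_, fun a γ => ?_⟩⟩
  · refine Subtype.ext ?_
    have h := e.map_reif q
    exact congrArg (fun z : w.valueGroup => z.1) h
  · exact e.map_val (f a) ⟨γ.1, v.valueGroup_comap_le f γ.2⟩

end ReifiedValuation

/-- The reified valuative spectrum `Sprv(A)`: the set of equivalence classes of reified
semivaluations on `A`. -/
def Sprv (A : Type u) [CommRing A] : Type (u + 1) :=
  Quotient (ReifiedValuation.setoid A)

namespace Sprv

variable {A : Type u} [CommRing A]

/-- The relation `v(a) ≤ q v(b)` on a point of `Sprv(A)`. -/
def Le (x : Sprv A) (a : A) (q : PosReal) (b : A) : Prop :=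
  Quotient.liftOn x (fun v => v.Le a q b) (fun _ _ h => propext (h.le_iff a b q))

/-- The relation `v(b) = 0` on a point of `Sprv(A)`. -/
def EqZero (x : Sprv A) (b : A) : Prop :=
  Quotient.liftOn x (fun v => v.val b = 0) (fun _ _ h => propext (h.val_eq_zero_iff b))

/-- Every element of `Γ_v` is bounded below by a positive real. -/
def IsCoinitial (x : Sprv A) : Prop :=
  Quotient.liftOn x (fun v => v.IsCoinitial)
    (fun _ _ h => propext ⟨h.isCoinitial, h.symm.isCoinitial⟩)

/-- The topology generated by the sets `{v : v(a) ≤ q v(b) ≠ 0}`. -/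
instance : TopologicalSpace (Sprv A) :=
  TopologicalSpace.generateFrom
    {S | ∃ (a b : A) (q : PosReal), S = {x | x.Le a q b ∧ ¬ x.EqZero b}}

/-- Restriction along a ring homomorphism. -/
def comap {B : Type u} [CommRing B] (f : A →+* B) : Sprv B → Sprv A :=
  Quotient.map (fun v => v.comap f) (fun _ _ h => h.comap f)

theorem comap_le {B : Type u} [CommRing B] (f : A →+* B) (x : Sprv B) (a b : A) (q : PosReal) :
    (x.comap f).Le a q b ↔ x.Le (f a) q (f b) := by
  induction x using Quotient.inductionOn
  exact Iff.rfl

theorem IsCoinitial.comap {B : Type u} [CommRing B] (f : A →+* B) {x : Sprv B}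
    (h : x.IsCoinitial) : (x.comap f).IsCoinitial := by
  induction x using Quotient.inductionOn with
  | h v => exact fun γ hγ => h γ (v.valueGroup_comap_le f hγ)

end Sprv

end Valuations

/-- An affinoid Banach ring `(A^▷, A^Gr)`: a commutative nonarchimedean ring `A^▷`, separated and
complete for its norm, and an integrally closed graded subring `A^Gr` of `Gr A^▷`. -/
structure AffinoidBanachRing where
  /-- the Banach ring `A^▷` -/
  carrier : Type u
  [normedCommRing : NormedCommRing carrier]
  [isUltrametricDist : IsUltrametricDist carrier]
  [completeSpace : CompleteSpace carrier]
  /-- the graded subring `A^Gr` -/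
  gr : Subring (Gr carrier)
  gr_graded : ∀ x ∈ gr, ∀ r : Additive PosReal, DirectSum.of (GrPiece carrier) r (x r) ∈ gr
  gr_integrallyClosed : ∀ x : Gr carrier, IsIntegral gr x → x ∈ gr

attribute [instance] AffinoidBanachRing.normedCommRing AffinoidBanachRing.isUltrametricDist
  AffinoidBanachRing.completeSpace

namespace AffinoidBanachRing

/-- `A^{+,r}`: the set of elements of `A^{∘,r}` whose class in `Gr^r A^▷` belongs to `A^Gr`. -/
def plus (A : AffinoidBanachRing.{u}) (r : PosReal) : Set A.carrier :=
  {a | ∃ h : a ∈ powBounded A.carrier r, grOf r ⟨a, h⟩ ∈ A.gr}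

/-- A morphism of affinoid Banach rings: a bounded ring homomorphism which induces a map
`A^Gr → B^Gr`. As `A^Gr` is generated by its homogeneous elements, this means that the homomorphism
carries `A^{+,r}` into `B^{+,r}` for all `r`. -/
@[ext]
structure Hom (A B : AffinoidBanachRing.{u}) where
  /-- the ring homomorphism -/
  toRingHom : A.carrier →+* B.carrier
  bounded : ∃ c : ℝ, 0 < c ∧ ∀ a, ‖toRingHom a‖ ≤ c * ‖a‖
  map_plus : ∀ (r : PosReal), ∀ a ∈ A.plus r, toRingHom a ∈ B.plus r

namespace Hom

variable {A B C : AffinoidBanachRing.{u}}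

/-- The identity morphism. -/
def id (A : AffinoidBanachRing.{u}) : Hom A A where
  toRingHom := RingHom.id _
  bounded := ⟨1, one_pos, fun a => by simp⟩
  map_plus := fun _ _ h => h

/-- Composition of morphisms. -/
def comp (g : Hom B C) (f : Hom A B) : Hom A C where
  toRingHom := g.toRingHom.comp f.toRingHom
  bounded := by
    obtain ⟨c, hc, hf⟩ := f.bounded
    obtain ⟨d, hd, hg⟩ := g.bounded
    refine ⟨d * c, mul_pos hd hc, fun a => ?_⟩
    calc ‖g.toRingHom (f.toRingHom a)‖ ≤ d * ‖f.toRingHom a‖ := hg _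
      _ ≤ d * (c * ‖a‖) := mul_le_mul_of_nonneg_left (hf a) hd.le
      _ = d * c * ‖a‖ := by ring
  map_plus := fun r a ha => g.map_plus r _ (f.map_plus r a ha)

theorem isTopNilpotent (f : Hom A B) {r : PosReal} {a : A.carrier} (ha : IsTopNilpotent r a) :
    IsTopNilpotent r (f.toRingHom a) := by
  obtain ⟨c, -, hf⟩ := f.bounded
  have h0 : Tendsto (fun n : ℕ => c * (((r : ℝ) ^ n)⁻¹ * ‖a ^ n‖)) atTop (𝓝 0) := by
    simpa using Tendsto.const_mul c ha
  refine squeeze_zero (fun n => scaledNorm_nonneg _ _ _) (fun n => ?_) h0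
  rw [← map_pow]
  calc ((r : ℝ) ^ n)⁻¹ * ‖f.toRingHom (a ^ n)‖ ≤ ((r : ℝ) ^ n)⁻¹ * (c * ‖a ^ n‖) :=
        mul_le_mul_of_nonneg_left (hf _) (inv_nonneg.2 (pow_nonneg r.2.le n))
    _ = _ := by ring

end Hom

/-- The conditions on a point `v` of `Sprv(A^▷)` to belong to `Spra(A^▷, A^Gr)`: it is bounded
(`v(a) ≤ r` for `a ∈ A^{∘∘,r}`) and commensurable (moreover every element of `Γ_v` is bounded below
by a positive real), and `v(a) ≤ r` for `a ∈ A^{+,r}`. -/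
structure IsReadicPoint (A : AffinoidBanachRing.{u}) (x : Sprv A.carrier) : Prop where
  isBounded : ∀ (r : PosReal) (a : A.carrier), IsTopNilpotent r a → x.Le a r 1
  isCoinitial : x.IsCoinitial
  le_of_mem_plus : ∀ (r : PosReal), ∀ a ∈ A.plus r, x.Le a r 1

/-- The reified adic spectrum `Spra(A^▷, A^Gr)`, with the subspace topology from `Sprv(A^▷)`. -/
abbrev Spra (A : AffinoidBanachRing.{u}) : Type (u + 1) := {x : Sprv A.carrier // A.IsReadicPoint x}

/-- The map `f^* : Spra(B^▷, B^Gr) → Spra(A^▷, A^Gr)` given by restriction. -/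
def Hom.spra {A B : AffinoidBanachRing.{u}} (f : Hom A B) (x : Spra B) : Spra A :=
  ⟨x.1.comap f.toRingHom,
    { isBounded := fun r a ha => by
        rw [Sprv.comap_le, map_one]
        exact x.2.isBounded r _ (f.isTopNilpotent ha)
      isCoinitial := x.2.isCoinitial.comap f.toRingHom
      le_of_mem_plus := fun r a ha => by
        rw [Sprv.comap_le, map_one]
        exact x.2.le_of_mem_plus r _ (f.map_plus r a ha) }⟩

/-- The rational subspaces `{v : v(fᵢ) ≤ qᵢ v(f₀) ≠ 0 (i = 1, …, n)}` of `Spra(A^▷, A^Gr)`, where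
`f₁, …, fₙ` generate the unit ideal. -/
def IsRational {A : AffinoidBanachRing.{u}} (V : Set (Spra A)) : Prop :=
  ∃ (n : ℕ) (f₀ : A.carrier) (f : Fin n → A.carrier) (q : Fin n → PosReal),
    Ideal.span (Set.range f) = ⊤ ∧
      V = {x | ∀ i, x.1.Le (f i) (q i) f₀ ∧ ¬ x.1.EqZero f₀}

/-- A morphism `φ : (A^▷, A^Gr) → (B^▷, B^Gr)` represents the subspace `V` of `Spra(A^▷, A^Gr)`: it
is initial among the morphisms `(A^▷, A^Gr) → (C^▷, C^Gr)`, with `C^▷` complete, for which the image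
of `Spra(C^▷, C^Gr)` is contained in `V`. -/
structure Represents {A B : AffinoidBanachRing.{u}} (φ : Hom A B) (V : Set (Spra A)) : Prop where
  range_subset : Set.range φ.spra ⊆ V
  existsUnique : ∀ (C : AffinoidBanachRing.{u}) (ψ : Hom A C), Set.range ψ.spra ⊆ V →
    ∃! g : Hom B C, g.comp φ = ψ

/-- The rational localizations of `(A^▷, A^Gr)` which represent rational subspaces of
`Spra(A^▷, A^Gr)` contained in `U`. -/
structure RationalLocalization (A : AffinoidBanachRing.{u}) (U : Set (Spra A)) where
  /-- the target of the localization -/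
  B : AffinoidBanachRing.{u}
  /-- the localization morphism -/
  φ : Hom A B
  exists_represents : ∃ V : Set (Spra A), IsRational V ∧ V ⊆ U ∧ Represents φ V

/-- A rational localization inside `U` is one inside any larger set. -/
def RationalLocalization.ofSubset {A : AffinoidBanachRing.{u}} {U U' : Set (Spra A)} (h : U ⊆ U')
    (L : RationalLocalization A U) : RationalLocalization A U' where
  B := L.B
  φ := L.φ
  exists_represents := by
    obtain ⟨V, h1, h2, h3⟩ := L.exists_represents
    exact ⟨V, h1, h2.trans h, h3⟩

/-- The ring `𝒪(U)`: the inverse limit of the rings `B^▷` over all rational localizations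
`(A^▷, A^Gr) → (B^▷, B^Gr)` representing rational subspaces contained in `U`, the transition maps
being given by the morphisms under `(A^▷, A^Gr)`. -/
def sections (A : AffinoidBanachRing.{u}) (U : Set (Spra A)) :
    Subring (∀ L : RationalLocalization A U, L.B.carrier) where
  carrier := {s | ∀ (L L' : RationalLocalization A U) (g : Hom L.B L'.B), g.comp L.φ = L'.φ →
    g.toRingHom (s L) = s L'}
  zero_mem' := fun _ _ g _ => map_zero g.toRingHom
  one_mem' := fun _ _ g _ => map_one g.toRingHom
  add_mem' := fun {s t} hs ht L L' g hg => by
    simp only [Pi.add_apply, map_add, hs L L' g hg, ht L L' g hg]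
  mul_mem' := fun {s t} hs ht L L' g hg => by
    simp only [Pi.mul_apply, map_mul, hs L L' g hg, ht L L' g hg]
  neg_mem' := fun {s} hs L L' g hg => by
    simp only [Pi.neg_apply, map_neg, hs L L' g hg]

/-- The restriction map `𝒪(U') → 𝒪(U)` for `U ⊆ U'`. -/
def restriction (A : AffinoidBanachRing.{u}) {U U' : Set (Spra A)} (h : U ⊆ U') :
    A.sections U' →+* A.sections U where
  toFun s := ⟨fun L => s.1 (L.ofSubset h),
    fun L L' g hg => s.2 (L.ofSubset h) (L'.ofSubset h) g hg⟩
  map_zero' := rfl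
  map_one' := rfl
  map_add' _ _ := rfl
  map_mul' _ _ := rfl

/-- The structure presheaf `𝒪` on `Spra(A^▷, A^Gr)`. -/
def structurePresheaf (A : AffinoidBanachRing.{u}) :
    TopCat.Presheaf CommRingCat.{u + 1} (TopCat.of (Spra A)) where
  obj U := CommRingCat.of (A.sections (U.unop : Set (Spra A)))
  map i := CommRingCat.ofHom (A.restriction (fun _ hx => i.unop.le hx))
  map_id _ := rfl
  map_comp _ _ := rfl

/-- `(A^▷, A^Gr)` is sheafy if its structure presheaf is a sheaf. -/
def IsSheafy (A : AffinoidBanachRing.{u}) : Prop :=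
  A.structurePresheaf.IsSheaf

end AffinoidBanachRing

end

end Readic

/-!
Tate's acyclicity argument, in the reified setting and without a base field.

*The spectrum.* The graded ring `Gr A` is a quotient of a subring of the monoid algebra `A[ℝ⁺]`,
normed so that the element `[r]` has norm `r⁻¹`, and a reified semivaluation on `A` is the same as an
ordinary valuation on `A[ℝ⁺]` with prescribed behaviour on the elements `[r]`. Existence of valuation
rings and an ultrafilter argument, applied to `A[ℝ⁺]`, show that `Spra(A)` detects the elements of
`A^{+,r}` (`AffinoidBanachRing.mem_plus_of_forall_le`) and the units of `A`
(`AffinoidBanachRing.isUnit_of_forall_ne_zero`), and that it is compact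
(`AffinoidBanachRing.compactSpace_spra`).

*Representability.* By the first two facts, a rational subspace is represented by an iterated
completed quotient of polynomial algebras `A[T]` by ideals `(b T - a)`, in which `A^Gr` is defined by
the points of the subspace (`AffinoidBanachRing.represents_toFraction`). These quotients are again
really strongly noetherian, since the completion of `A[G]` is noetherian for every finitely generated
commutative monoid `G` (`IsReallyStronglyNoetherian.of_approx`).

*Laurent coverings.* In the completion of `A[T, T⁻¹, S, S⁻¹]` the unit `S` of norm `2` takes the place
of a scalar, so that the open mapping theorem holds and ideals are closed. Multiplication by `T - f`
is injective there: a convergent series it annihilates has coefficients `hₙ` with `f hₙ = hₙ₋₁`, and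
the ascending chain condition for the ideals `(hₙ)` makes them vanish
(`IsReallyStronglyNoetherian.eq_zero_of_shift`). Hence it is bounded below
(`IsReallyStronglyNoetherian.exists_norm_le_mul_T_sub`), which gives exactness of
`0 → A → A⟨v(f) ≤ q⟩ × A⟨v(f) ≥ q⟩ → A⟨v(f) = q⟩`
(`AffinoidBanachRing.exists_laurent_annulus`).

*General coverings.* Unique gluing of a compatible family of sections, required after every further
base change, is a property of morphisms `A → B` which descends along simple Laurent coverings, and it
holds where the morphism factors through a member of the covering. Comparing the functions which
define a finite rational covering with each other, one by one, reduces it to Laurent coverings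
(`AffinoidBanachRing.IsLaurentLocal.of_cover`), so the property holds for all rational localizations
inside the union (`AffinoidBanachRing.RationalLocalization.gluesOver`).
-/

set_option linter.unusedSectionVars false

namespace Readic

noncomputable section

/-! ### Monoid algebras with weighted Gauss norms -/

section GaussAlgebra

open scoped NNReal

variable (A : Type u) [NormedCommRing A] {G : Type} [CommMonoid G]

/-- The monoid algebra `A[G]`, regarded as a normed ring for the Gauss norm `max_g |a_g| w(g)`
attached to a weight `w : G → ℝ⁺`. The type depends on `w` so as to carry that norm. -/
def GaussAlgebra (_w : G →* PosReal) : Type u := MonoidAlgebra A G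

namespace GaussAlgebra

variable (w : G →* PosReal)

instance instCommRing : CommRing (GaussAlgebra A w) := inferInstanceAs (CommRing (MonoidAlgebra A G))

variable {A w}

/-- The coefficient of `p` at `g`. -/
def coeff (g : G) : GaussAlgebra A w →+ A where
  toFun p := MonoidAlgebra.coeff (R := A) (M := G) p g
  map_zero' := rfl
  map_add' _ _ := rfl

/-- The (finite) support of an element of `A[G]`. -/
def support (p : GaussAlgebra A w) : Finset G := (MonoidAlgebra.coeff (R := A) (M := G) p).support

theorem mem_support {p : GaussAlgebra A w} {g : G} : g ∈ p.support ↔ coeff g p ≠ 0 :=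
  Finsupp.mem_support_iff

variable (A w) in
/-- The element `a g` of `A[G]`. -/
def single (g : G) : A →+ GaussAlgebra A w where
  toFun a := MonoidAlgebra.single g a
  map_zero' := MonoidAlgebra.single_zero g
  map_add' := MonoidAlgebra.single_add g

open Classical in
theorem coeff_single (g h : G) (a : A) :
    coeff h (single A w g a) = if g = h then a else 0 := by
  change (MonoidAlgebra.single g a).coeff h = _
  rw [MonoidAlgebra.coeff_single, Finsupp.single_apply]

@[simp]
theorem coeff_single_same (g : G) (a : A) : coeff g (single A w g a) = a := by
  rw [coeff_single, if_pos rfl]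

theorem single_mul_single (g h : G) (a b : A) :
    single A w g a * single A w h b = single A w (g * h) (a * b) :=
  MonoidAlgebra.single_mul_single g h a b

theorem one_def : (1 : GaussAlgebra A w) = single A w 1 1 := rfl

@[ext]
theorem ext {p q : GaussAlgebra A w} (h : ∀ g, coeff g p = coeff g q) : p = q :=
  MonoidAlgebra.coeff_injective (Finsupp.ext h)

theorem sum_single (p : GaussAlgebra A w) : ∑ g ∈ p.support, single A w g (coeff g p) = p :=
  MonoidAlgebra.sum_coeff_single (R := A) (M := G) p

variable (A w) in
/-- The embedding `A → A[G]`. -/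
def C : A →+* GaussAlgebra A w where
  toFun a := single A w 1 a
  map_zero' := map_zero _
  map_one' := rfl
  map_add' := map_add _
  map_mul' a b := by rw [single_mul_single, one_mul]

variable (A w) in
/-- The embedding `G → A[G]`. -/
def T : G →* GaussAlgebra A w where
  toFun g := single A w g 1
  map_one' := rfl
  map_mul' a b := by rw [single_mul_single, one_mul]

theorem C_apply (a : A) : C A w a = single A w 1 a := rfl

theorem T_apply (g : G) : T A w g = single A w g 1 := rfl

theorem C_mul_T (g : G) (a : A) : C A w a * T A w g = single A w g a := by
  rw [C_apply, T_apply, single_mul_single, one_mul, mul_one]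

/-- The ring homomorphism out of `A[G]` given by a ring homomorphism on `A` and a monoid
homomorphism on `G`. -/
def lift {B : Type*} [CommRing B] (f : A →+* B) (m : G →* B) : GaussAlgebra A w →+* B :=
  MonoidAlgebra.liftNCRingHom f m (fun _ _ => Commute.all _ _)

theorem lift_single {B : Type*} [CommRing B] (f : A →+* B) (m : G →* B) (g : G) (a : A) :
    lift f m (single A w g a) = f a * m g :=
  MonoidAlgebra.liftNC_single (f : A →+ B) m g a

theorem lift_eq_sum {B : Type*} [CommRing B] (f : A →+* B) (m : G →* B) (p : GaussAlgebra A w) :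
    lift f m p = ∑ g ∈ p.support, f (coeff g p) * m g := by
  conv_lhs => rw [← sum_single p]
  rw [map_sum]
  exact Finset.sum_congr rfl fun g _ => lift_single f m g _

@[simp]
theorem lift_C {B : Type*} [CommRing B] (f : A →+* B) (m : G →* B) (a : A) :
    lift f m (C A w a) = f a := by
  rw [C_apply, lift_single, map_one, mul_one]

@[simp]
theorem lift_T {B : Type*} [CommRing B] (f : A →+* B) (m : G →* B) (g : G) :
    lift f m (T A w g) = m g := by
  rw [T_apply, lift_single, map_one, one_mul]

theorem ringHom_ext {B : Type*} [CommRing B] {f g : GaussAlgebra A w →+* B}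
    (h1 : ∀ a, f (C A w a) = g (C A w a)) (h2 : ∀ x, f (T A w x) = g (T A w x)) : f = g := by
  ext p
  rw [← sum_single p, map_sum, map_sum]
  refine Finset.sum_congr rfl fun x _ => ?_
  rw [← C_mul_T, map_mul, map_mul, h1, h2]

theorem coeff_single_mul {G : Type} [CommGroup G] {w : G →* PosReal} (g h : G) (a : A)
    (p : GaussAlgebra A w) : coeff h (single A w g a * p) = a * coeff (g⁻¹ * h) p :=
  MonoidAlgebra.coeff_single_mul_apply (R := A) (G := G) p a g h

theorem coeff_C_mul (h : G) (a : A) (p : GaussAlgebra A w) :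
    coeff h (C A w a * p) = a * coeff h p :=
  MonoidAlgebra.coeff_single_one_mul (R := A) (M := G) p a h

variable (A w) in
/-- The Gauss norm as a function. -/
def gaussNorm (p : GaussAlgebra A w) : ℝ :=
  ((p.support.sup fun g => ‖coeff g p‖₊ * Real.toNNReal (w g : ℝ) : ℝ≥0) : ℝ)

theorem gaussNorm_le_iff {p : GaussAlgebra A w} {c : ℝ} (hc : 0 ≤ c) :
    gaussNorm A w p ≤ c ↔ ∀ g, ‖coeff g p‖ * (w g : ℝ) ≤ c := by
  have h0 : gaussNorm A w p ≤ c ↔ (p.support.sup fun g =>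
      ‖coeff g p‖₊ * Real.toNNReal (w g : ℝ) : ℝ≥0) ≤ Real.toNNReal c := by
    rw [gaussNorm, Real.le_toNNReal_iff_coe_le hc]
  rw [h0, Finset.sup_le_iff]
  refine forall_congr' fun g => ?_
  have h1 : ‖coeff g p‖₊ * Real.toNNReal (w g : ℝ) ≤ Real.toNNReal c ↔
      ‖coeff g p‖ * (w g : ℝ) ≤ c := by
    rw [Real.le_toNNReal_iff_coe_le hc, NNReal.coe_mul, coe_nnnorm, Real.coe_toNNReal _ (w g).2.le]
  rw [h1, mem_support]
  refine ⟨fun h => ?_, fun h _ => h⟩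
  by_cases hg : coeff g p = 0
  · simpa [hg] using hc
  · exact h hg

theorem gaussNorm_nonneg (p : GaussAlgebra A w) : 0 ≤ gaussNorm A w p := NNReal.coe_nonneg _

theorem coeff_le_gaussNorm (p : GaussAlgebra A w) (g : G) :
    ‖coeff g p‖ * (w g : ℝ) ≤ gaussNorm A w p :=
  (gaussNorm_le_iff (gaussNorm_nonneg p)).1 le_rfl g

variable [IsUltrametricDist A]

theorem gaussNorm_add_le (p q : GaussAlgebra A w) :
    gaussNorm A w (p + q) ≤ max (gaussNorm A w p) (gaussNorm A w q) := by
  refine (gaussNorm_le_iff (le_max_of_le_left (gaussNorm_nonneg p))).2 fun g => ?_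
  rw [map_add]
  rcases le_max_iff.1 (IsUltrametricDist.norm_add_le_max (coeff g p) (coeff g q)) with h | h
  · exact (mul_le_mul_of_nonneg_right h (w g).2.le).trans
      ((coeff_le_gaussNorm p g).trans (le_max_left _ _))
  · exact (mul_le_mul_of_nonneg_right h (w g).2.le).trans
      ((coeff_le_gaussNorm q g).trans (le_max_right _ _))

theorem gaussNorm_zero : gaussNorm A w 0 = 0 :=
  le_antisymm ((gaussNorm_le_iff le_rfl).2 fun g => by simp) (gaussNorm_nonneg _)

theorem gaussNorm_sum_le {ι : Type*} (s : Finset ι) (f : ι → GaussAlgebra A w) {c : ℝ} (hc : 0 ≤ c)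
    (h : ∀ i ∈ s, gaussNorm A w (f i) ≤ c) : gaussNorm A w (∑ i ∈ s, f i) ≤ c := by
  classical
  induction s using Finset.induction_on with
  | empty => simpa [gaussNorm_zero] using hc
  | insert i s hi ih =>
    rw [Finset.sum_insert hi]
    exact (gaussNorm_add_le _ _).trans (max_le (h i (Finset.mem_insert_self i s))
      (ih fun j hj => h j (Finset.mem_insert_of_mem hj)))

theorem gaussNorm_single (g : G) (a : A) : gaussNorm A w (single A w g a) = ‖a‖ * (w g : ℝ) := by
  refine le_antisymm ((gaussNorm_le_iff (mul_nonneg (norm_nonneg _) (w g).2.le)).2 fun h => ?_) ?_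
  · classical
    rw [coeff_single]
    split_ifs with hg
    · rw [hg]
    · simpa using mul_nonneg (norm_nonneg _) (w g).2.le
  · simpa using coeff_le_gaussNorm (single A w g a) g

theorem gaussNorm_mul_le (p q : GaussAlgebra A w) :
    gaussNorm A w (p * q) ≤ gaussNorm A w p * gaussNorm A w q := by
  have hc := mul_nonneg (gaussNorm_nonneg p) (gaussNorm_nonneg q)
  conv_lhs => rw [← sum_single p, ← sum_single q, Finset.sum_mul_sum]
  refine gaussNorm_sum_le _ _ hc fun g _ => gaussNorm_sum_le _ _ hc fun h _ => ?_
  rw [single_mul_single, gaussNorm_single, map_mul, Positive.val_mul]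
  calc ‖coeff g p * coeff h q‖ * ((w g : ℝ) * (w h : ℝ))
      ≤ (‖coeff g p‖ * ‖coeff h q‖) * ((w g : ℝ) * (w h : ℝ)) :=
        mul_le_mul_of_nonneg_right (norm_mul_le _ _) (mul_pos (w g).2 (w h).2).le
    _ = (‖coeff g p‖ * (w g : ℝ)) * (‖coeff h q‖ * (w h : ℝ)) := by ring
    _ ≤ _ := mul_le_mul (coeff_le_gaussNorm p g) (coeff_le_gaussNorm q h)
        (mul_nonneg (norm_nonneg _) (w h).2.le) (gaussNorm_nonneg p)

theorem gaussNorm_neg (p : GaussAlgebra A w) : gaussNorm A w (-p) = gaussNorm A w p := by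
  have h : ∀ q : GaussAlgebra A w, gaussNorm A w (-q) ≤ gaussNorm A w q := fun q =>
    (gaussNorm_le_iff (gaussNorm_nonneg q)).2 fun g => by
      rw [map_neg, norm_neg]; exact coeff_le_gaussNorm q g
  exact le_antisymm (h p) (by simpa using h (-p))

variable (A w) in
/-- The Gauss norm as a ring norm. -/
def gaussRingNorm : RingNorm (GaussAlgebra A w) where
  toFun := gaussNorm A w
  map_zero' := gaussNorm_zero
  add_le' p q := (gaussNorm_add_le p q).trans
    (max_le_add_of_nonneg (gaussNorm_nonneg p) (gaussNorm_nonneg q))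
  neg' := gaussNorm_neg
  mul_le' := gaussNorm_mul_le
  eq_zero_of_map_eq_zero' p hp := by
    ext g
    have h := coeff_le_gaussNorm p g
    rw [show gaussNorm A w p = 0 from hp] at h
    have h2 : ‖coeff g p‖ ≤ 0 := by
      by_contra hcon
      exact absurd h (not_le.2 (mul_pos (not_le.1 hcon) (w g).2))
    rw [map_zero]
    exact norm_le_zero_iff.1 h2

instance instNormedCommRing : NormedCommRing (GaussAlgebra A w) :=
  { @RingNorm.toNormedRing (GaussAlgebra A w) _ (gaussRingNorm A w) with
    mul_comm := fun p q => mul_comm p q }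

theorem norm_le_iff {p : GaussAlgebra A w} {c : ℝ} (hc : 0 ≤ c) :
    ‖p‖ ≤ c ↔ ∀ g, ‖coeff g p‖ * (w g : ℝ) ≤ c := gaussNorm_le_iff hc

theorem norm_coeff_le (p : GaussAlgebra A w) (g : G) : ‖coeff g p‖ * (w g : ℝ) ≤ ‖p‖ :=
  coeff_le_gaussNorm p g

@[simp]
theorem norm_single (g : G) (a : A) : ‖single A w g a‖ = ‖a‖ * (w g : ℝ) := gaussNorm_single g a

@[simp]
theorem norm_C (a : A) : ‖C A w a‖ = ‖a‖ := by
  rw [C_apply, norm_single, map_one]; simp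

instance instIsUltrametricDist : IsUltrametricDist (GaussAlgebra A w) :=
  IsUltrametricDist.isUltrametricDist_of_forall_norm_add_le_max_norm gaussNorm_add_le

/-- Boundedness of the homomorphism out of `A[G]`. -/
theorem norm_lift_le {B : Type*} [NormedCommRing B] [IsUltrametricDist B] (f : A →+* B) (m : G →* B)
    {c K : ℝ} (hc : 0 ≤ c) (hK : 0 ≤ K) (hf : ∀ a, ‖f a‖ ≤ c * ‖a‖)
    (hm : ∀ g, ‖m g‖ ≤ K * (w g : ℝ)) (p : GaussAlgebra A w) :
    ‖lift f m p‖ ≤ c * K * ‖p‖ := by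
  rw [lift_eq_sum]
  refine IsUltrametricDist.norm_sum_le_of_forall_le_of_nonneg
    (mul_nonneg (mul_nonneg hc hK) (norm_nonneg _)) fun g _ => ?_
  calc ‖f (coeff g p) * m g‖ ≤ ‖f (coeff g p)‖ * ‖m g‖ := norm_mul_le _ _
    _ ≤ (c * ‖coeff g p‖) * (K * (w g : ℝ)) := mul_le_mul (hf _) (hm g) (norm_nonneg _)
        (mul_nonneg hc (norm_nonneg _))
    _ = c * K * (‖coeff g p‖ * (w g : ℝ)) := by ring
    _ ≤ _ := mul_le_mul_of_nonneg_left (norm_coeff_le p g) (mul_nonneg hc hK)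

end GaussAlgebra

end GaussAlgebra

/-! ### Noetherian completions -/

section Approximation

open UniformSpace

/-- The successive approximation argument behind the open mapping theorem: a continuous
homomorphism from a complete group which hits the elements of `K` up to an error of half their
norm hits them exactly. -/
theorem exists_preimage_of_approx {X Y : Type*} [NormedAddCommGroup X] [CompleteSpace X]
    [NormedAddCommGroup Y] (f : X →+ Y) (hf : Continuous f) (K : AddSubgroup Y) {C : ℝ}
    (h : ∀ y ∈ K, ∃ x, ‖x‖ ≤ C * ‖y‖ ∧ f x ∈ K ∧ ‖y - f x‖ ≤ ‖y‖ / 2) :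
    ∀ y ∈ K, ∃ x, f x = y ∧ ‖x‖ ≤ 2 * C * ‖y‖ := by
  intro y hy
  choose! g hg1 hg2 hg3 using h
  -- the successive remainders `r n`
  let r : ℕ → Y := fun n => Nat.rec y (fun _ z => z - f (g z)) n
  have hr0 : r 0 = y := rfl
  have hrs : ∀ n, r (n + 1) = r n - f (g (r n)) := fun n => rfl
  have hrK : ∀ n, r n ∈ K := by
    intro n
    induction n with
    | zero => exact hy
    | succ n ih => rw [hrs]; exact K.sub_mem ih (hg2 _ ih)
  have hrn : ∀ n, ‖r n‖ ≤ ‖y‖ * (1 / 2) ^ n := by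
    intro n
    induction n with
    | zero => simp [hr0]
    | succ n ih =>
      rw [hrs]
      refine (hg3 _ (hrK n)).trans ?_
      rw [pow_succ]
      linarith
  rcases eq_or_ne y 0 with rfl | hy0
  · exact ⟨0, map_zero f, by simp⟩
  have hypos : 0 < ‖y‖ := norm_pos_iff.2 hy0
  have hC : 0 ≤ C := by
    by_contra hC
    have := hg1 y hy
    have h2 : C * ‖y‖ < 0 := mul_neg_of_neg_of_pos (not_le.1 hC) hypos
    linarith [norm_nonneg (g y)]
  have hxn : ∀ n, ‖g (r n)‖ ≤ C * ‖y‖ * (1 / 2) ^ n := fun n => by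
    refine (hg1 _ (hrK n)).trans ?_
    rw [mul_assoc]
    exact mul_le_mul_of_nonneg_left (hrn n) hC
  have hgeo : HasSum (fun n : ℕ => C * ‖y‖ * (1 / 2 : ℝ) ^ n) (C * ‖y‖ * 2) :=
    hasSum_geometric_two.mul_left _
  have hsum : Summable (fun n => g (r n)) :=
    Summable.of_norm_bounded hgeo.summable hxn
  have hpart : ∀ n, f (∑ i ∈ Finset.range n, g (r i)) = y - r n := by
    intro n
    induction n with
    | zero => simp [hr0]
    | succ n ih => rw [Finset.sum_range_succ, map_add, ih, hrs]; abel
  have hr_lim : Tendsto r atTop (𝓝 0) := by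
    refine squeeze_zero_norm hrn ?_
    have := (tendsto_pow_atTop_nhds_zero_of_lt_one (r := (1 / 2 : ℝ)) (by norm_num)
      (by norm_num)).const_mul ‖y‖
    simpa using this
  refine ⟨∑' n, g (r n), ?_, ?_⟩
  · have h1 : Tendsto (fun n => f (∑ i ∈ Finset.range n, g (r i))) atTop
        (𝓝 (f (∑' n, g (r n)))) := (hf.tendsto _).comp hsum.hasSum.tendsto_sum_nat
    have h2 : Tendsto (fun n => f (∑ i ∈ Finset.range n, g (r i))) atTop (𝓝 (y - 0)) := by
      simp_rw [hpart]
      exact tendsto_const_nhds.sub hr_lim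
    rw [sub_zero] at h2
    exact tendsto_nhds_unique h1 h2
  · refine (tsum_of_norm_bounded hgeo hxn).trans (le_of_eq ?_)
    ring

/-- A continuous homomorphism from a complete group is surjective if it approximates the elements of a
dense subset arbitrarily well by images of elements of controlled norm. -/
theorem surjective_of_approx {X Y : Type*} [NormedAddCommGroup X] [CompleteSpace X]
    [NormedAddCommGroup Y] (f : X →+ Y) (hf : Continuous f) {D : Set Y} (hD : Dense D) {C : ℝ}
    (hC : 0 ≤ C) (h : ∀ d ∈ D, ∀ ε > 0, ∃ x, ‖x‖ ≤ C * ‖d‖ ∧ ‖d - f x‖ ≤ ε) :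
    Function.Surjective f := by
  intro y
  obtain ⟨x, hx, -⟩ := exists_preimage_of_approx f hf ⊤ (C := 2 * C) (fun y _ => by
    rcases eq_or_ne y 0 with rfl | hy0
    · exact ⟨0, by simp, trivial, by simp⟩
    have hypos : 0 < ‖y‖ := norm_pos_iff.2 hy0
    obtain ⟨d, hd, hyd⟩ := Metric.dense_iff.1 hD y (‖y‖ / 4) (by positivity)
    rw [Metric.mem_ball, dist_eq_norm] at hd
    obtain ⟨x, hx1, hx2⟩ := h d hyd (‖y‖ / 4) (by positivity)
    have hd2 : ‖d‖ ≤ 2 * ‖y‖ := by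
      calc ‖d‖ = ‖(d - y) + y‖ := by rw [sub_add_cancel]
        _ ≤ ‖d - y‖ + ‖y‖ := norm_add_le _ _
        _ ≤ 2 * ‖y‖ := by linarith
    refine ⟨x, ?_, trivial, ?_⟩
    · calc ‖x‖ ≤ C * ‖d‖ := hx1
        _ ≤ C * (2 * ‖y‖) := mul_le_mul_of_nonneg_left hd2 hC
        _ = 2 * C * ‖y‖ := by ring
    · calc ‖y - f x‖ = ‖(d - f x) - (d - y)‖ := by congr 1; abel
        _ ≤ ‖d - f x‖ + ‖d - y‖ := norm_sub_le _ _
        _ ≤ ‖y‖ / 2 := by linarith) y trivial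
  exact ⟨x, hx⟩

/-- A bounded ring homomorphism with dense, norm-controlled image induces a surjection of
completions, along which noetherianity descends. -/
theorem isNoetherianRing_completion_of_approx {P S : Type*} [NormedCommRing P] [NormedCommRing S]
    (f : P →+* S) {c C : ℝ} (hf : ∀ p, ‖f p‖ ≤ c * ‖p‖) (hC : 0 ≤ C)
    (h : ∀ s, ∀ ε > 0, ∃ p, ‖p‖ ≤ C * ‖s‖ ∧ ‖s - f p‖ ≤ ε)
    (hP : IsNoetherianRing (Completion P)) : IsNoetherianRing (Completion S) := by
  have hcont : Continuous f := AddMonoidHomClass.continuous_of_bound f c hf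
  let F : Completion P →+* Completion S := Completion.mapRingHom f hcont
  have hF : Continuous F := Completion.continuous_map
  refine isNoetherianRing_of_surjective _ _ F ?_
  refine surjective_of_approx (F : Completion P →+ Completion S) hF
    (Completion.denseRange_coe (α := S)) hC ?_
  rintro _ ⟨s, rfl⟩ ε hε
  obtain ⟨p, hp1, hp2⟩ := h s ε hε
  refine ⟨(p : Completion P), by simpa [Completion.norm_coe] using hp1, ?_⟩
  have : F (p : Completion P) = (f p : Completion S) := Completion.mapRingHom_coe hcont p
  change ‖(s : Completion S) - F p‖ ≤ ε
  rw [this, ← Completion.coe_sub, Completion.norm_coe]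
  exact hp2

end Approximation

section Noetherian

open UniformSpace

variable {A : Type u} [NormedCommRing A] [IsUltrametricDist A]

theorem gaussPolynomial_norm_le_iff {n : ℕ} (r : Fin n → PosReal) (p : GaussPolynomial A r) {c : ℝ}
    (hc : 0 ≤ c) : ‖p‖ ≤ c ↔ ∀ t : Fin n →₀ ℕ,
      ‖MvPolynomial.coeff (R := A) t p‖ * t.prod (fun i k => (r i : ℝ) ^ k) ≤ c := by
  have e : ‖p‖ = MvPowerSeries.gaussNorm (norm : A → ℝ) (fun i => (r i : ℝ))
    (MvPolynomial.toMvPowerSeries (R := A) p) := rfl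
  rw [e]
  constructor
  · intro h t
    refine le_trans ?_ h
    have := MvPowerSeries.le_gaussNorm (norm : A → ℝ) (fun i => (r i : ℝ)) _
      (hasGaussNorm_coe A r p) t
    exact (congrArg (fun z : A => ‖z‖ * t.prod (fun i k => (r i : ℝ) ^ k))
      (MvPolynomial.coeff_coe p t)).symm.trans_le this
  · intro h
    refine ciSup_le fun t => ?_
    exact (congrArg (fun z : A => ‖z‖ * t.prod (fun i k => (r i : ℝ) ^ k))
      (MvPolynomial.coeff_coe p t)).trans_le (h t)

/-- The weight on exponents attached to a tuple of radii. -/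
def monomialWeight {n : ℕ} (r : Fin n → PosReal) : Multiplicative (Fin n →₀ ℕ) →* PosReal where
  toFun t := t.toAdd.prod fun i k => r i ^ k
  map_one' := Finsupp.prod_zero_index
  map_mul' _ _ := Finsupp.prod_add_index' (fun _ => pow_zero _) (fun _ _ _ => pow_add _ _ _)

theorem monomialWeight_coe {n : ℕ} (r : Fin n → PosReal) (t : Fin n →₀ ℕ) :
    ((monomialWeight r (Multiplicative.ofAdd t) : PosReal) : ℝ) =
      t.prod fun i k => (r i : ℝ) ^ k := by
  let F : PosReal →* ℝ := ⟨⟨fun x => (x : ℝ), rfl⟩, fun _ _ => rfl⟩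
  exact map_finsuppProd F t fun i k => r i ^ k

/-- The identification of polynomials with elements of a monoid algebra. -/
def gaussPolynomialEquiv {n : ℕ} (r : Fin n → PosReal) :
    GaussPolynomial A r ≃+* GaussAlgebra A (monomialWeight r) :=
  AddMonoidAlgebra.toMultiplicative A (Fin n →₀ ℕ)

theorem coeff_gaussPolynomialEquiv {n : ℕ} (r : Fin n → PosReal) (p : GaussPolynomial A r)
    (t : Fin n →₀ ℕ) : GaussAlgebra.coeff (Multiplicative.ofAdd t) (gaussPolynomialEquiv r p) =
      MvPolynomial.coeff (R := A) t p := by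
  induction p using AddMonoidAlgebra.induction_linear with
  | zero => rfl
  | add p q hp hq =>
    have e : gaussPolynomialEquiv (A := A) r (p + q) =
      gaussPolynomialEquiv (A := A) r p + gaussPolynomialEquiv (A := A) r q := map_add _ _ _
    have e2 : MvPolynomial.coeff (R := A) t (p + q) = MvPolynomial.coeff t p +
      MvPolynomial.coeff t q := MvPolynomial.coeff_add _ _ _
    exact (congrArg _ e).trans ((map_add _ _ _).trans ((congrArg₂ _ hp hq).trans e2.symm))
  | single s a =>
    classical
    have e : gaussPolynomialEquiv (A := A) r (AddMonoidAlgebra.single s a) =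
      GaussAlgebra.single A _ (Multiplicative.ofAdd s) a :=
        AddMonoidAlgebra.toMultiplicative_single s a
    refine (congrArg _ e).trans ?_
    rw [GaussAlgebra.coeff_single]
    refine Eq.trans ?_ (MvPolynomial.coeff_monomial t s a).symm
    by_cases hst : s = t
    · rw [if_pos hst, if_pos (congrArg _ hst)]
    · rw [if_neg hst, if_neg (fun h => hst (Multiplicative.ofAdd.injective h))]

theorem norm_gaussPolynomialEquiv {n : ℕ} (r : Fin n → PosReal) (p : GaussPolynomial A r) :
    ‖gaussPolynomialEquiv r p‖ = ‖p‖ := by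
  have h : ∀ c : ℝ, 0 ≤ c → (‖gaussPolynomialEquiv r p‖ ≤ c ↔ ‖p‖ ≤ c) := by
    intro c hc
    rw [GaussAlgebra.norm_le_iff hc, gaussPolynomial_norm_le_iff r p hc]
    refine Multiplicative.ofAdd.surjective.forall.trans (forall_congr' fun t => ?_)
    rw [coeff_gaussPolynomialEquiv, monomialWeight_coe]
  exact le_antisymm ((h _ (norm_nonneg _)).2 le_rfl) ((h _ (norm_nonneg _)).1 le_rfl)

/-- If `A` is really strongly noetherian, the completion of `A[G]` is noetherian for every finitely
generated commutative monoid `G` and every weight. -/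
theorem IsReallyStronglyNoetherian.isNoetherianRing (hA : IsReallyStronglyNoetherian A) {G : Type}
    [CommMonoid G] [hG : Monoid.FG G] (w : G →* PosReal) :
    IsNoetherianRing (Completion (GaussAlgebra A w)) := by
  obtain ⟨S, hS⟩ := hG.fg_top
  let x : Fin S.card → G := fun i => (S.equivFin.symm i : G)
  have hx : Set.range x = (S : Set G) := by
    ext g
    constructor
    · rintro ⟨i, rfl⟩
      exact (S.equivFin.symm i).2
    · intro hg
      exact ⟨S.equivFin ⟨g, hg⟩, by simp [x]⟩
  let r : Fin S.card → PosReal := fun i => w (x i)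
  let m : Multiplicative (Fin S.card →₀ ℕ) →* G :=
    { toFun := fun t => t.toAdd.prod fun i k => x i ^ k
      map_one' := Finsupp.prod_zero_index
      map_mul' := fun s t => Finsupp.prod_add_index' (fun i => pow_zero _)
        (fun i k l => pow_add _ _ _) }
  have hwm : ∀ t, w (m t) = monomialWeight r t := by
    intro t
    change w (Finsupp.prod _ _) = Finsupp.prod _ _
    rw [map_finsuppProd]
    simp_rw [map_pow]
    rfl
  have hm : ∀ g, ∃ t, m t = g := by
    intro g
    have hg : g ∈ Submonoid.closure (Set.range x) := by rw [hx, hS]; trivial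
    obtain ⟨t, ht⟩ := Submonoid.exists_finsupp_of_mem_closure_range x g hg
    exact ⟨Multiplicative.ofAdd t, ht.symm⟩
  choose σ hσ using hm
  let f : GaussPolynomial A r →+* GaussAlgebra A w :=
    (GaussAlgebra.lift (GaussAlgebra.C A w) ((GaussAlgebra.T A w).comp m)).comp
      (gaussPolynomialEquiv (A := A) r).toRingHom
  have hf0 : ∀ p, f p = GaussAlgebra.lift (GaussAlgebra.C A w) ((GaussAlgebra.T A w).comp m)
    (gaussPolynomialEquiv r p) := fun p => rfl
  refine isNoetherianRing_completion_of_approx f (c := 1 * ‖(1 : A)‖) (C := 1) (fun p => ?_)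
    zero_le_one (fun s ε hε => ?_) (hA _ r)
  · rw [← norm_gaussPolynomialEquiv]
    refine GaussAlgebra.norm_lift_le _ _ zero_le_one (norm_nonneg _) (fun a => ?_)
      (fun t => ?_) _
    · rw [GaussAlgebra.norm_C, one_mul]
    · rw [MonoidHom.comp_apply, GaussAlgebra.T_apply, GaussAlgebra.norm_single, hwm]
  · refine ⟨(gaussPolynomialEquiv r).symm (∑ g ∈ s.support,
      GaussAlgebra.single A _ (σ g) (GaussAlgebra.coeff g s)), ?_, ?_⟩
    · rw [one_mul, ← norm_gaussPolynomialEquiv, RingEquiv.apply_symm_apply]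
      refine IsUltrametricDist.norm_sum_le_of_forall_le_of_nonneg (norm_nonneg _) fun g _ => ?_
      rw [GaussAlgebra.norm_single, ← hwm, hσ]
      exact GaussAlgebra.norm_coeff_le s g
    · rw [hf0, RingEquiv.apply_symm_apply, map_sum]
      simp_rw [GaussAlgebra.lift_single, MonoidHom.comp_apply, hσ, GaussAlgebra.C_mul_T]
      rw [GaussAlgebra.sum_single, sub_self, norm_zero]
      exact hε.le

/-- Criterion for a Banach ring `B` to be really strongly noetherian: it is topologically of finite
type over a really strongly noetherian ring, in the sense that some bounded homomorphism
`A[G] → B`, with `G` a finitely generated monoid, has norm-controlled dense image. -/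
theorem IsReallyStronglyNoetherian.of_approx (hA : IsReallyStronglyNoetherian A)
    {G : Type} [CommMonoid G] [hG : Monoid.FG G] (w : G →* PosReal) {B : Type u} [NormedCommRing B]
    [IsUltrametricDist B] (θ : GaussAlgebra A w →+* B) {c C : ℝ} (hc : 0 ≤ c)
    (hθ : ∀ p, ‖θ p‖ ≤ c * ‖p‖) (hC : 0 ≤ C)
    (h : ∀ b, ∀ ε > 0, ∃ p, ‖p‖ ≤ C * ‖b‖ ∧ ‖b - θ p‖ ≤ ε) : IsReallyStronglyNoetherian B := by
  intro n r
  let w' : G × Multiplicative (Fin n →₀ ℕ) →* PosReal := w.coprod (monomialWeight r)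
  have hw' : ∀ g t, w' (g, t) = w g * monomialWeight r t := fun g t => rfl
  have : AddMonoid.FG (Fin n →₀ ℕ) := AddMonoid.fg_of_surjective
    (Finsupp.linearEquivFunOnFinite ℕ ℕ (Fin n)).symm.toAddMonoidHom
    (Finsupp.linearEquivFunOnFinite ℕ ℕ (Fin n)).symm.surjective
  have : Monoid.FG (G × Multiplicative (Fin n →₀ ℕ)) := Prod.instMonoidFG
  have hN := hA.isNoetherianRing w'
  let f : GaussAlgebra A w' →+* GaussAlgebra B (monomialWeight r) :=
    GaussAlgebra.lift ((GaussAlgebra.C B _).comp (θ.comp (GaussAlgebra.C A w)))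
      (((GaussAlgebra.C B (monomialWeight r)).toMonoidHom.comp
        (θ.toMonoidHom.comp (GaussAlgebra.T A w))).coprod (GaussAlgebra.T B (monomialWeight r)))
  have hf1 : ∀ g t a, f (GaussAlgebra.single A w' (g, t) a) =
      GaussAlgebra.single B _ t (θ (GaussAlgebra.single A w g a)) := by
    intro g t a
    rw [GaussAlgebra.lift_single]
    change GaussAlgebra.C B (monomialWeight r) (θ (GaussAlgebra.C A w a)) *
      (GaussAlgebra.C B (monomialWeight r) (θ (GaussAlgebra.T A w g)) *
        GaussAlgebra.T B (monomialWeight r) t) = _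
    rw [← mul_assoc, ← map_mul, ← map_mul, GaussAlgebra.C_mul_T, GaussAlgebra.C_mul_T]
  have hfle : ∀ p, ‖f p‖ ≤ c * ‖p‖ := by
    intro p
    conv_lhs => rw [← GaussAlgebra.sum_single p]
    rw [map_sum]
    refine IsUltrametricDist.norm_sum_le_of_forall_le_of_nonneg
      (mul_nonneg hc (norm_nonneg _)) ?_
    rintro ⟨g, t⟩ -
    rw [hf1, GaussAlgebra.norm_single (G := Multiplicative (Fin n →₀ ℕ))]
    calc ‖θ (GaussAlgebra.single A w g (GaussAlgebra.coeff (g, t) p))‖ * (monomialWeight r t : ℝ)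
        ≤ (c * (‖GaussAlgebra.coeff (g, t) p‖ * (w g : ℝ))) * (monomialWeight r t : ℝ) := by
          rw [← GaussAlgebra.norm_single (w := w)]
          exact mul_le_mul_of_nonneg_right (hθ _) (monomialWeight r t).2.le
      _ = c * (‖GaussAlgebra.coeff (g, t) p‖ * (w' (g, t) : ℝ)) := by
          rw [hw', Positive.val_mul]; ring
      _ ≤ c * ‖p‖ := mul_le_mul_of_nonneg_left (GaussAlgebra.norm_coeff_le p _) hc
  -- the section of `f` which places an element of `A[G]` in front of a monomial `t`
  let ι : Multiplicative (Fin n →₀ ℕ) → GaussAlgebra A w → GaussAlgebra A w' := fun t p =>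
    ∑ g ∈ p.support, GaussAlgebra.single A w' (g, t) (GaussAlgebra.coeff g p)
  have hιf : ∀ t p, f (ι t p) = GaussAlgebra.single B _ t (θ p) := by
    intro t p
    rw [map_sum]
    simp_rw [hf1]
    rw [← map_sum, ← map_sum, GaussAlgebra.sum_single]
  have hιn : ∀ t p, ‖ι t p‖ ≤ ‖p‖ * (monomialWeight r t : ℝ) := by
    intro t p
    refine IsUltrametricDist.norm_sum_le_of_forall_le_of_nonneg
      (mul_nonneg (norm_nonneg _) (monomialWeight r t).2.le) fun g _ => ?_
    rw [GaussAlgebra.norm_single, hw', Positive.val_mul, ← mul_assoc]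
    exact mul_le_mul_of_nonneg_right (GaussAlgebra.norm_coeff_le p g) (monomialWeight r t).2.le
  refine isNoetherianRing_completion_of_approx
    ((gaussPolynomialEquiv (A := B) r).symm.toRingHom.comp f) (c := c) (C := C) ?_ hC ?_ hN
  · intro p
    change ‖(gaussPolynomialEquiv r).symm (f p)‖ ≤ _
    rw [← norm_gaussPolynomialEquiv, RingEquiv.apply_symm_apply]
    exact hfle p
  · intro s ε hε
    obtain ⟨s, rfl⟩ := (gaussPolynomialEquiv (A := B) r).symm.surjective s
    choose p hp1 hp2 using fun t => h (GaussAlgebra.coeff t s) (ε / (monomialWeight r t : ℝ))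
      (div_pos hε (monomialWeight r t).2)
    refine ⟨∑ t ∈ s.support, ι t (p t), ?_, ?_⟩
    · rw [← norm_gaussPolynomialEquiv, RingEquiv.apply_symm_apply]
      refine IsUltrametricDist.norm_sum_le_of_forall_le_of_nonneg
        (mul_nonneg hC (norm_nonneg _)) fun t _ => (hιn t _).trans ?_
      calc ‖p t‖ * (monomialWeight r t : ℝ)
          ≤ C * ‖GaussAlgebra.coeff t s‖ * (monomialWeight r t : ℝ) :=
            mul_le_mul_of_nonneg_right (hp1 t) (monomialWeight r t).2.le
        _ = C * (‖GaussAlgebra.coeff t s‖ * (monomialWeight r t : ℝ)) := by ring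
        _ ≤ C * ‖s‖ := mul_le_mul_of_nonneg_left (GaussAlgebra.norm_coeff_le s t) hC
    · change ‖(gaussPolynomialEquiv r).symm s - (gaussPolynomialEquiv r).symm (f _)‖ ≤ ε
      rw [← map_sub, ← norm_gaussPolynomialEquiv, RingEquiv.apply_symm_apply, map_sum]
      simp_rw [hιf]
      nth_rewrite 1 [← GaussAlgebra.sum_single s]
      rw [← Finset.sum_sub_distrib]
      refine IsUltrametricDist.norm_sum_le_of_forall_le_of_nonneg hε.le fun t _ => ?_
      rw [← map_sub, GaussAlgebra.norm_single]
      exact (le_div_iff₀ (monomialWeight r t).2).1 (hp2 t)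

end Noetherian

/-! ### The open mapping theorem for ideals -/

section OpenMapping

variable {R : Type*} [NormedCommRing R]

theorem norm_zpow_mul_of_norm_mul {U : Rˣ} (hU : ∀ x : R, ‖(U : R) * x‖ = 2 * ‖x‖) (k : ℤ) (x : R) :
    ‖((U ^ k : Rˣ) : R) * x‖ = 2 ^ k * ‖x‖ := by
  have hinv : ∀ x : R, ‖((U⁻¹ : Rˣ) : R) * x‖ = 2⁻¹ * ‖x‖ := fun x => by
    have := hU (((U⁻¹ : Rˣ) : R) * x)
    rw [Units.mul_inv_cancel_left] at this
    rw [this]; ring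
  induction k with
  | zero => simp
  | succ n ih =>
    rw [zpow_add_one, mul_comm (U ^ (n : ℤ)) U, Units.val_mul, mul_assoc, hU, ih, zpow_add_one₀ two_ne_zero]
    ring
  | pred n ih =>
    rw [zpow_sub_one, mul_comm (U ^ (-n : ℤ)) U⁻¹, Units.val_mul, mul_assoc, hinv, ih,
      zpow_sub_one₀ two_ne_zero]
    ring

variable [CompleteSpace R]

/-- The open mapping theorem for a finite presentation `Rᵐ → I` of a closed ideal. The unit `U`,
which scales the norm by a factor `2`, replaces the scalars of a nontrivially normed field in the
usual proof by Baire category. -/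
theorem exists_norm_le_of_isClosed_span {U : Rˣ} (hU : ∀ x : R, ‖(U : R) * x‖ = 2 * ‖x‖) {m : ℕ}
    (y : Fin m → R) (hI : IsClosed (Ideal.span (Set.range y) : Set R)) :
    ∃ C : ℝ, 0 ≤ C ∧ ∀ z ∈ Ideal.span (Set.range y), ∃ b : Fin m → R,
      ∑ i, b i * y i = z ∧ ‖b‖ ≤ C * ‖z‖ := by
  set I := Ideal.span (Set.range y) with hIdef
  let φ : (Fin m → R) →+ R :=
    { toFun := fun b => ∑ i, b i * y i
      map_zero' := by simp
      map_add' := fun a b => by simp [add_mul, Finset.sum_add_distrib] }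
  have hφ : ∀ b, φ b = ∑ i, b i * y i := fun b => rfl
  have hφc : Continuous φ := by
    change Continuous fun b : Fin m → R => ∑ i, b i * y i
    fun_prop
  have hφI : ∀ b, φ b ∈ I := fun b => Ideal.sum_mem I (t := Finset.univ) (f := fun i => b i * y i) fun i _ =>
    I.mul_mem_left _ (Ideal.subset_span ⟨i, rfl⟩)
  have hφs : ∀ z ∈ I, ∃ b, φ b = z := fun z hz => by
    obtain ⟨b, hb⟩ := (Ideal.mem_span_range_iff_exists_fun).1 hz
    exact ⟨b, hb⟩
  -- by Baire, the closure `E n` of the image of some ball has an interior point `z₀`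
  have : CompleteSpace I := hI.completeSpace_coe
  let E : ℕ → Set I := fun n => closure {z : I | ∃ b, ‖b‖ ≤ n ∧ φ b = z}
  have hE : ⋃ n, E n = Set.univ := by
    refine Set.eq_univ_of_forall fun z => ?_
    obtain ⟨b, hb⟩ := hφs z z.2
    obtain ⟨n, hn⟩ := exists_nat_ge ‖b‖
    exact Set.mem_iUnion.2 ⟨n, subset_closure ⟨b, hn, hb⟩⟩
  obtain ⟨n, z₀, hz₀⟩ := nonempty_interior_of_iUnion_of_closed (fun n => isClosed_closure) hE
  obtain ⟨δ, hδ, hball⟩ := Metric.isOpen_iff.1 isOpen_interior z₀ hz₀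
  -- differences of points of `E n` near `z₀` approximate all small elements
  have happ : ∀ z ∈ I, ‖z‖ < δ → ∀ ε > 0, ∃ b, ‖b‖ ≤ 2 * n ∧ ‖z - φ b‖ ≤ ε := by
    intro z hz hzδ ε hε
    have h1 : z₀ + ⟨z, hz⟩ ∈ E n := interior_subset (hball (by
      rw [Metric.mem_ball, dist_eq_norm, add_sub_cancel_left]; exact hzδ))
    have h0 : z₀ ∈ E n := interior_subset hz₀
    obtain ⟨y1, ⟨b1, hb1, hy1⟩, hd1⟩ := Metric.mem_closure_iff.1 h1 (ε / 2) (by positivity)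
    obtain ⟨y0, ⟨b0, hb0, hy0⟩, hd0⟩ := Metric.mem_closure_iff.1 h0 (ε / 2) (by positivity)
    refine ⟨b1 - b0, (norm_sub_le _ _).trans (by linarith), ?_⟩
    rw [dist_eq_norm] at hd1 hd0
    have e : z - φ (b1 - b0) = (((z₀ + ⟨z, hz⟩ - y1 : I) : R)) - ((z₀ - y0 : I) : R) := by
      rw [map_sub, hy1, hy0]
      push_cast
      ring
    rw [e]
    refine (norm_sub_le _ _).trans ?_
    exact (add_lt_add hd1 hd0).le.trans (add_halves ε).le
  have key := exists_preimage_of_approx φ hφc I.toAddSubgroup (C := 8 * n / δ) (fun z hz => by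
    rcases eq_or_ne z 0 with rfl | hz0
    · exact ⟨0, by simp, by simp, by simp⟩
    have hzpos : 0 < ‖z‖ := norm_pos_iff.2 hz0
    -- scale `z` by a power of `U` to a norm between `δ / 4` and `δ / 2`
    obtain ⟨k, hk1, hk2⟩ := exists_mem_Ico_zpow (x := δ / (2 * ‖z‖)) (y := (2 : ℝ))
      (by positivity) (by norm_num)
    have h2k : (0 : ℝ) < 2 ^ k := by positivity
    rw [le_div_iff₀ (by positivity)] at hk1
    rw [div_lt_iff₀ (by positivity), zpow_add_one₀ two_ne_zero] at hk2
    obtain ⟨b, hb1, hb2⟩ := happ (((U ^ k : Rˣ) : R) * z) (I.mul_mem_left _ hz)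
      (by rw [norm_zpow_mul_of_norm_mul hU]; linarith) (δ / 8) (by positivity)
    have h2k' : (2 : ℝ) ^ (-k) * 2 ^ k = 1 := by rw [zpow_neg]; field_simp
    refine ⟨fun i => ((U ^ (-k) : Rˣ) : R) * b i, ?_, hφI _, ?_⟩
    · refine (pi_norm_le_iff_of_nonneg (by positivity)).2 fun i => ?_
      rw [norm_zpow_mul_of_norm_mul hU]
      have h3 : ‖b i‖ ≤ 2 * n := (norm_le_pi_norm b i).trans hb1
      have h4 : (2 : ℝ) ^ (-k) ≤ 4 * ‖z‖ / δ := by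
        rw [le_div_iff₀ hδ]
        calc (2 : ℝ) ^ (-k) * δ ≤ 2 ^ (-k) * (2 ^ k * 2 * (2 * ‖z‖)) :=
              mul_le_mul_of_nonneg_left hk2.le (by positivity)
          _ = (2 ^ (-k) * 2 ^ k) * (4 * ‖z‖) := by ring
          _ = 4 * ‖z‖ := by rw [h2k', one_mul]
      calc (2 : ℝ) ^ (-k) * ‖b i‖ ≤ (4 * ‖z‖ / δ) * (2 * n) :=
            mul_le_mul h4 h3 (norm_nonneg _) (by positivity)
        _ = 8 * n / δ * ‖z‖ := by ring
    · have e : z - φ (fun i => ((U ^ (-k) : Rˣ) : R) * b i) =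
          ((U ^ (-k) : Rˣ) : R) * (((U ^ k : Rˣ) : R) * z - φ b) := by
        rw [mul_sub, ← mul_assoc, ← Units.val_mul, ← zpow_add, neg_add_cancel, zpow_zero,
          Units.val_one, one_mul, hφ, hφ, Finset.mul_sum]
        simp_rw [mul_assoc]
      rw [e, norm_zpow_mul_of_norm_mul hU]
      calc (2 : ℝ) ^ (-k) * ‖((U ^ k : Rˣ) : R) * z - φ b‖
          ≤ 2 ^ (-k) * (2 ^ k * 2 * (2 * ‖z‖) / 8) :=
            mul_le_mul_of_nonneg_left (hb2.trans (by linarith)) (by positivity)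
        _ = (2 ^ (-k) * 2 ^ k) * (‖z‖ / 2) := by ring
        _ = ‖z‖ / 2 := by rw [h2k', one_mul])
  refine ⟨2 * (8 * n / δ), by positivity, fun z hz => ?_⟩
  obtain ⟨b, hb1, hb2⟩ := key z hz
  exact ⟨b, hb1, hb2⟩

/-- Every ideal of a noetherian Banach ring with a norm-scaling unit is closed: generators of the
closure can be approximated by elements of the ideal, which then generate the closure as well. -/
theorem isClosed_ideal_of_isNoetherianRing [IsNoetherianRing R] {U : Rˣ}
    (hU : ∀ x : R, ‖(U : R) * x‖ = 2 * ‖x‖) (I : Ideal R) : IsClosed (I : Set R) := by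
  obtain ⟨m, y, hy⟩ := Submodule.fg_iff_exists_fin_generating_family.1
    (IsNoetherian.noetherian I.closure)
  have hy' : Ideal.span (Set.range y) = I.closure := hy
  have hcl : IsClosed (Ideal.span (Set.range y) : Set R) := by
    rw [hy', Ideal.coe_closure]; exact isClosed_closure
  obtain ⟨C, hC, hCz⟩ := exists_norm_le_of_isClosed_span hU y hcl
  -- approximations `y'` in `I` so close that replacing `y` by them costs half of the norm at most
  have hyI : ∀ i, ∃ y' ∈ I, ‖y i - y'‖ ≤ 1 / (2 * (m + 1) * (C + 1)) := fun i => by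
    have h : y i ∈ closure (I : Set R) := by
      rw [← Ideal.coe_closure, ← hy']
      exact Ideal.subset_span ⟨i, rfl⟩
    obtain ⟨y', hy1, hy2⟩ := Metric.mem_closure_iff.1 h (1 / (2 * (m + 1) * (C + 1)))
      (by positivity)
    rw [dist_eq_norm] at hy2
    exact ⟨y', hy1, hy2.le⟩
  choose y' hy'I hy'n using hyI
  let φ : (Fin m → R) →+ R :=
    { toFun := fun b => ∑ i, b i * y' i
      map_zero' := by simp
      map_add' := fun a b => by simp [add_mul, Finset.sum_add_distrib] }
  have hφI : ∀ b, φ b ∈ I := fun b => Ideal.sum_mem I (t := Finset.univ) (f := fun i => b i * y' i) fun i _ =>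
      I.mul_mem_left _ (hy'I i)
  have hφc : Continuous φ := by
    change Continuous fun b : Fin m → R => ∑ i, b i * y' i
    fun_prop
  have hle : I ≤ I.closure := fun x hx => by
    rw [← SetLike.mem_coe, Ideal.coe_closure]; exact subset_closure hx
  have key := exists_preimage_of_approx φ hφc I.closure.toAddSubgroup (C := C) (fun z hz => by
    obtain ⟨b, hb1, hb2⟩ := hCz z (by rw [hy']; exact hz)
    refine ⟨b, hb2, hle (hφI b), ?_⟩
    have e : z - φ b = ∑ i, b i * (y i - y' i) := by
      change z - ∑ i, b i * y' i = _
      rw [← hb1, ← Finset.sum_sub_distrib]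
      simp_rw [mul_sub]
    rw [e]
    calc ‖∑ i, b i * (y i - y' i)‖ ≤ ∑ i : Fin m, C * ‖z‖ * (1 / (2 * (m + 1) * (C + 1))) := by
          refine norm_sum_le_of_le _ fun i _ => (norm_mul_le _ _).trans ?_
          exact mul_le_mul ((norm_le_pi_norm b i).trans hb2) (hy'n i) (norm_nonneg _)
            (mul_nonneg hC (norm_nonneg _))
      _ = (m / (m + 1)) * (C / (C + 1)) * (‖z‖ / 2) := by
          rw [Finset.sum_const, Finset.card_univ, Fintype.card_fin, nsmul_eq_mul]
          field_simp
      _ ≤ 1 * 1 * (‖z‖ / 2) := by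
          gcongr
          · rw [div_le_one (by positivity)]; linarith
          · rw [div_le_one (by positivity)]; linarith
      _ = ‖z‖ / 2 := by ring)
  have : (I : Set R) = closure (I : Set R) := by
    refine Set.Subset.antisymm subset_closure fun z hz => ?_
    obtain ⟨b, hb, -⟩ := key z (by
      rw [Submodule.mem_toAddSubgroup, ← SetLike.mem_coe, Ideal.coe_closure]; exact hz)
    rw [← hb]
    exact hφI b
  rw [this]
  exact isClosed_closure

/-- Division by `x` with bounds: every multiple of `x` has a quotient whose norm is controlled by that
of the multiple. -/
theorem exists_norm_le_of_isNoetherianRing [IsNoetherianRing R] {U : Rˣ}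
    (hU : ∀ x : R, ‖(U : R) * x‖ = 2 * ‖x‖) (x : R) :
    ∃ C : ℝ, 0 ≤ C ∧ ∀ a, ∃ b, b * x = a * x ∧ ‖b‖ ≤ C * ‖a * x‖ := by
  obtain ⟨C, hC, h⟩ := exists_norm_le_of_isClosed_span hU (fun _ : Fin 1 => x)
    (isClosed_ideal_of_isNoetherianRing hU _)
  refine ⟨C, hC, fun a => ?_⟩
  obtain ⟨b, hb1, hb2⟩ := h (a * x) (Ideal.mul_mem_left _ _ (Ideal.subset_span ⟨0, rfl⟩))
  refine ⟨b 0, by simpa using hb1, (norm_le_pi_norm b 0).trans hb2⟩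

end OpenMapping

/-! ### Coefficients of convergent series -/

namespace GaussAlgebra

open UniformSpace

variable {A : Type u} [NormedCommRing A] [IsUltrametricDist A] {G H : Type} [CommMonoid G]
  [CommMonoid H] {w : G →* PosReal} {w' : H →* PosReal}

/-- Change of the monoid of exponents along a homomorphism. -/
def mapExp (w : G →* PosReal) (w' : H →* PosReal) (ι : G →* H) :
    GaussAlgebra A w →+* GaussAlgebra A w' := lift (C A w') ((T A w').comp ι)

theorem mapExp_single (ι : G →* H) (g : G) (a : A) :
    mapExp w w' ι (single A w g a) = single A w' (ι g) a := by
  rw [mapExp, lift_single, MonoidHom.comp_apply, C_mul_T]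

@[simp]
theorem mapExp_C (ι : G →* H) (a : A) : mapExp w w' ι (C A w a) = C A w' a := lift_C _ _ _

@[simp]
theorem mapExp_T (ι : G →* H) (g : G) : mapExp w w' ι (T A w g) = T A w' (ι g) := lift_T _ _ _

theorem coeff_mapExp {ι : G →* H} (hι : Function.Injective ι) (p : GaussAlgebra A w) (g : G) :
    coeff (ι g) (mapExp w w' ι p) = coeff g p := by
  conv_lhs => rw [← sum_single p]
  conv_rhs => rw [← sum_single p]
  rw [map_sum, map_sum, map_sum]
  refine Finset.sum_congr rfl fun h _ => ?_
  rw [mapExp_single]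
  rw [coeff_single, coeff_single]
  by_cases hgh : h = g
  · rw [if_pos hgh, if_pos (congrArg ι hgh)]
  · rw [if_neg hgh, if_neg fun e => hgh (hι e)]

theorem coeff_mapExp_of_notMem {ι : G →* H} (p : GaussAlgebra A w) {h : H} (hh : ∀ g, ι g ≠ h) :
    coeff h (mapExp w w' ι p) = 0 := by
  conv_lhs => rw [← sum_single p]
  rw [map_sum, map_sum]
  refine Finset.sum_eq_zero fun g _ => ?_
  rw [mapExp_single, coeff_single, if_neg (hh g)]

variable [CompleteSpace A]

variable (w) in
/-- The coefficient at `g` of an element of the completion of `A[G]`. -/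
def coeffCompl (g : G) : NormedAddGroupHom (Completion (GaussAlgebra A w)) A :=
  ((coeff g).mkNormedAddGroupHom (w g : ℝ)⁻¹ fun p => by
    rw [inv_mul_eq_div, le_div_iff₀ (w g).2]
    exact norm_coeff_le p g : NormedAddGroupHom (GaussAlgebra A w) A).extension

@[simp]
theorem coeffCompl_coe (g : G) (p : GaussAlgebra A w) :
    coeffCompl w g (p : Completion (GaussAlgebra A w)) = coeff g p :=
  NormedAddGroupHom.extension_coe _ p

theorem norm_coeffCompl_le (g : G) (x : Completion (GaussAlgebra A w)) :
    ‖coeffCompl w g x‖ * (w g : ℝ) ≤ ‖x‖ := by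
  induction x using Completion.induction_on with
  | hp =>
    exact isClosed_le (((coeffCompl w g).continuous.norm).mul continuous_const) continuous_norm
  | ih p =>
    rw [coeffCompl_coe, Completion.norm_coe]
    exact norm_coeff_le p g

theorem exists_coe_norm_sub_lt {P : Type*} [SeminormedCommRing P] (x : Completion P) {ε : ℝ}
    (hε : 0 < ε) : ∃ p : P, ‖x - p‖ < ε := by
  obtain ⟨p, hp⟩ := Completion.denseRange_coe.exists_dist_lt x hε
  exact ⟨p, by rwa [dist_eq_norm] at hp⟩

theorem eq_zero_of_coeffCompl {x : Completion (GaussAlgebra A w)}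
    (h : ∀ g, coeffCompl w g x = 0) : x = 0 := by
  by_contra hx
  have hpos : 0 < ‖x‖ := norm_pos_iff.2 hx
  obtain ⟨p, hp⟩ := exists_coe_norm_sub_lt x (half_pos hpos)
  have hp2 : ‖p‖ ≤ ‖x - p‖ := (norm_le_iff (norm_nonneg _)).2 fun g => by
    have := norm_coeffCompl_le g (x - (p : Completion (GaussAlgebra A w)))
    rwa [map_sub, h, zero_sub, norm_neg, coeffCompl_coe] at this
  have : ‖x‖ ≤ ‖x - p‖ + ‖p‖ := by
    calc ‖x‖ = ‖(x - p) + p‖ := by rw [sub_add_cancel]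
      _ ≤ ‖x - p‖ + ‖(p : Completion (GaussAlgebra A w))‖ := norm_add_le _ _
      _ = _ := by rw [Completion.norm_coe]
  linarith

/-- The terms of the series given by an element of the completion converge to `0`. -/
theorem finite_coeffCompl_ge (x : Completion (GaussAlgebra A w)) {ε : ℝ} (hε : 0 < ε) :
    {g | ε ≤ ‖coeffCompl w g x‖ * (w g : ℝ)}.Finite := by
  obtain ⟨p, hp⟩ := exists_coe_norm_sub_lt x hε
  refine p.support.finite_toSet.subset fun g hg => ?_
  rw [Finset.mem_coe, mem_support]
  intro h0
  have := norm_coeffCompl_le g (x - (p : Completion (GaussAlgebra A w)))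
  rw [map_sub, coeffCompl_coe, h0, sub_zero] at this
  exact absurd hg (not_le.2 (this.trans_lt hp))

theorem coeffCompl_C_mul (g : G) (a : A) (x : Completion (GaussAlgebra A w)) :
    coeffCompl w g ((C A w a : Completion (GaussAlgebra A w)) * x) = a * coeffCompl w g x := by
  induction x using Completion.induction_on with
  | hp =>
    exact isClosed_eq ((coeffCompl w g).continuous.comp (continuous_const.mul continuous_id))
      (continuous_const.mul (coeffCompl w g).continuous)
  | ih p => rw [← Completion.coe_mul, coeffCompl_coe, coeffCompl_coe, coeff_C_mul]

theorem coeffCompl_T_mul {G : Type} [CommGroup G] {w : G →* PosReal} (g h : G)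
    (x : Completion (GaussAlgebra A w)) :
    coeffCompl w h ((T A w g : Completion (GaussAlgebra A w)) * x) = coeffCompl w (g⁻¹ * h) x := by
  induction x using Completion.induction_on with
  | hp =>
    exact isClosed_eq ((coeffCompl w h).continuous.comp (continuous_const.mul continuous_id))
      (coeffCompl w _).continuous
  | ih p =>
    rw [← Completion.coe_mul, coeffCompl_coe, coeffCompl_coe, T_apply, coeff_single_mul, one_mul]

theorem norm_T_mul {G : Type} [CommGroup G] {w : G →* PosReal} (g : G) (p : GaussAlgebra A w) :
    ‖T A w g * p‖ = (w g : ℝ) * ‖p‖ := by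
  have hle : ∀ (g : G) (p : GaussAlgebra A w), ‖T A w g * p‖ ≤ (w g : ℝ) * ‖p‖ := fun g p =>
    (norm_le_iff (mul_nonneg (w g).2.le (norm_nonneg _))).2 fun h => by
      rw [T_apply, coeff_single_mul, one_mul]
      have e : (w h : ℝ) = (w g : ℝ) * (w (g⁻¹ * h) : ℝ) := by
        rw [← Positive.val_mul, ← map_mul, mul_inv_cancel_left]
      rw [e, mul_left_comm]
      exact mul_le_mul_of_nonneg_left (norm_coeff_le p _) (w g).2.le
  refine le_antisymm (hle g p) ?_
  have h := hle g⁻¹ (T A w g * p)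
  rw [← mul_assoc, ← map_mul, inv_mul_cancel, map_one, one_mul, map_inv, Positive.coe_inv] at h
  calc (w g : ℝ) * ‖p‖ ≤ (w g : ℝ) * ((w g : ℝ)⁻¹ * ‖T A w g * p‖) :=
        mul_le_mul_of_nonneg_left h (w g).2.le
    _ = ‖T A w g * p‖ := by rw [mul_inv_cancel_left₀ (w g).2.ne']

theorem norm_T_mul_compl {G : Type} [CommGroup G] {w : G →* PosReal} (g : G)
    (x : Completion (GaussAlgebra A w)) :
    ‖(T A w g : Completion (GaussAlgebra A w)) * x‖ = (w g : ℝ) * ‖x‖ := by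
  induction x using Completion.induction_on with
  | hp =>
    exact isClosed_eq (continuous_const.mul continuous_id).norm (continuous_const.mul continuous_norm)
  | ih p => rw [← Completion.coe_mul, Completion.norm_coe, Completion.norm_coe, norm_T_mul]

end GaussAlgebra

/-! ### Strictness of multiplication by `T - f` -/

section Strictness

open UniformSpace GaussAlgebra

variable {A : Type u} [NormedCommRing A] [IsUltrametricDist A] [CompleteSpace A]

/-- The weight `(m, n) ↦ qᵐ 2ⁿ` on `ℤ × ℤ`. The second variable provides a unit which scales the
norm of the completion of `A[ℤ × ℤ]`. -/
def bivariateWeight (q : PosReal) : Multiplicative ℤ × Multiplicative ℤ →* PosReal :=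
  (zpowersHom PosReal q).coprod (zpowersHom PosReal ⟨2, two_pos⟩)

theorem bivariateWeight_apply (q : PosReal) (m n : Multiplicative ℤ) :
    (bivariateWeight q (m, n) : ℝ) = (q : ℝ) ^ m.toAdd * 2 ^ n.toAdd := rfl

/-- Openness for principal ideals in the completion of `A[ℤ × ℤ]`. -/
theorem IsReallyStronglyNoetherian.exists_norm_le_completion (hA : IsReallyStronglyNoetherian A)
    (q : PosReal) (x : Completion (GaussAlgebra A (bivariateWeight q))) :
    ∃ C : ℝ, 0 ≤ C ∧ ∀ a, ∃ b, b * x = a * x ∧ ‖b‖ ≤ C * ‖a * x‖ := by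
  have : Monoid.FG (Multiplicative ℤ × Multiplicative ℤ) := Prod.instMonoidFG
  have hN := hA.isNoetherianRing (bivariateWeight q)
  let t : (Multiplicative ℤ × Multiplicative ℤ)ˣ := toUnits (1, Multiplicative.ofAdd 1)
  let U : (Completion (GaussAlgebra A (bivariateWeight q)))ˣ :=
    Units.map (Completion.coeRingHom.toMonoidHom.comp (T A (bivariateWeight q))) t
  refine exists_norm_le_of_isNoetherianRing (U := U) (fun y => ?_) x
  refine (norm_T_mul_compl (w := bivariateWeight q) (1, Multiplicative.ofAdd 1) y).trans ?_
  rw [bivariateWeight_apply]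
  simp

/-- Openness for principal ideals in `A`. -/
theorem IsReallyStronglyNoetherian.exists_norm_le (hA : IsReallyStronglyNoetherian A) (x : A) :
    ∃ C : ℝ, 0 ≤ C ∧ ∀ a, ∃ b, b * x = a * x ∧ ‖b‖ ≤ C * ‖a * x‖ := by
  obtain ⟨C₀, hC, h⟩ := hA.exists_norm_le_completion 1
    (C A (bivariateWeight 1) x : Completion (GaussAlgebra A (bivariateWeight 1)))
  refine ⟨C₀, hC, fun a => ?_⟩
  obtain ⟨b, hb1, hb2⟩ := h (C A (bivariateWeight 1) a : Completion (GaussAlgebra A (bivariateWeight 1)))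
  rw [← Completion.coe_mul, ← map_mul] at hb1 hb2
  refine ⟨coeffCompl (bivariateWeight 1) 1 b, ?_, ?_⟩
  · have := congrArg (coeffCompl (bivariateWeight 1) 1) hb1
    rw [mul_comm b, coeffCompl_C_mul, coeffCompl_coe, C_apply, coeff_single_same] at this
    rw [mul_comm, this]
  · have := norm_coeffCompl_le 1 b
    rw [map_one, Positive.val_one, mul_one] at this
    refine this.trans (hb2.trans_eq ?_)
    rw [Completion.norm_coe, norm_C]

/-- A bi-infinite sequence with `f hₙ = hₙ₋₁` whose Laurent series converges vanishes. -/
theorem IsReallyStronglyNoetherian.eq_zero_of_shift (hA : IsReallyStronglyNoetherian A) (f : A)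
    (q : PosReal) (h : ℤ → A) (hf : ∀ n, f * h n = h (n - 1))
    (hlim : ∀ ε > 0, {n : ℤ | ε ≤ ‖h n‖ * (q : ℝ) ^ n}.Finite) (n : ℤ) : h n = 0 := by
  have hq : (0 : ℝ) < q := q.2
  have : IsNoetherianRing A := by
    have hN := hA.isNoetherianRing (G := Multiplicative ℕ) 1
    refine isNoetherianRing_of_surjective _ _ (Completion.extensionHom
      (GaussAlgebra.lift (w := 1) (RingHom.id A) (1 : Multiplicative ℕ →* A))
      (AddMonoidHomClass.continuous_of_bound _ (1 * ‖(1 : A)‖) (norm_lift_le _ _ zero_le_one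
        (norm_nonneg _) (fun a => by simp) fun g => by simp))) fun a => ?_
    refine ⟨(C A 1 a : GaussAlgebra A (1 : Multiplicative ℕ →* PosReal)), ?_⟩
    rw [Completion.extensionHom_coe, lift_C, RingHom.id_apply]
  have hback : ∀ (k : ℕ) (n : ℤ), f ^ k * h n = h (n - k) := by
    intro k n
    induction k with
    | zero => simp
    | succ k ih =>
      rw [pow_succ', mul_assoc, ih, hf]
      congr 1
      push_cast
      ring
  -- the ascending chain of the ideals `(h n)` stabilizes at `N`; from there on, multiplication by a
  -- suitable `c` inverts multiplication by `f`
  let I : ℕ →o Ideal A :=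
    ⟨fun n => Ideal.span {h n}, monotone_nat_of_le_succ fun n => by
      rw [Ideal.span_singleton_le_span_singleton]
      refine ⟨f, ?_⟩
      rw [mul_comm, hf]
      congr 1
      push_cast
      ring⟩
  obtain ⟨N, hN⟩ := monotone_stabilizes_iff_noetherian.2 this I
  have hmem : ∀ k : ℕ, ∃ d, d * h N = h (N + k : ℤ) := by
    intro k
    have h1 : h ((N + k : ℕ) : ℤ) ∈ I N := by
      rw [hN (N + k) (Nat.le_add_right _ _)]
      exact Ideal.mem_span_singleton_self _
    obtain ⟨d, hd⟩ := Ideal.mem_span_singleton'.1 h1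
    exact ⟨d, by rw [hd]; push_cast; rfl⟩
  obtain ⟨c, hc⟩ := hmem 1
  have hfc : f * (c * h N) = h N := by
    rw [hc, hf]
    congr 1
    push_cast
    ring
  have hfwd : ∀ k : ℕ, c ^ k * h N = h (N + k : ℤ) := by
    intro k
    induction k with
    | zero => simp
    | succ k ih =>
      obtain ⟨d, hd⟩ := hmem (k + 1)
      have h1 : h (N + k : ℤ) = d * (f * h N) := by
        have h2 : f * h (N + (k + 1 : ℕ) : ℤ) = h (N + k : ℤ) := by
          rw [hf]
          congr 1
          push_cast
          ring
        rw [← h2, ← hd]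
        ring
      rw [pow_succ', mul_assoc, ih, h1, ← hd]
      calc c * (d * (f * h N)) = d * (f * (c * h N)) := by ring
        _ = d * h N := by rw [hfc]
  obtain ⟨K, hK, hKb⟩ := hA.exists_norm_le (h N)
  -- the product of a term going to `+∞` and a term going to `-∞` controls `h N`
  have hbound : ∀ k : ℕ, ‖h N‖ ≤ K * ‖h (N - k : ℤ)‖ * ‖h (N + k : ℤ)‖ := by
    intro k
    obtain ⟨b, hb1, hb2⟩ := hKb (f ^ k)
    rw [hback] at hb1 hb2
    have e : b * h (N + k : ℤ) = h N := by
      calc b * h (N + k : ℤ) = c ^ k * (b * h N) := by rw [← hfwd]; ring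
        _ = f ^ k * h (N + k : ℤ) := by rw [hb1, ← hback, ← hfwd]; ring
        _ = h N := by rw [hback]; congr 1; ring
    calc ‖h N‖ = ‖b * h (N + k : ℤ)‖ := by rw [e]
      _ ≤ ‖b‖ * ‖h (N + k : ℤ)‖ := norm_mul_le _ _
      _ ≤ _ := mul_le_mul_of_nonneg_right hb2 (norm_nonneg _)
  have hN0 : h N = 0 := by
    by_contra hne
    have hpos : 0 < ‖h N‖ := norm_pos_iff.2 hne
    -- choose `ε` with `K ε² < ‖h N‖ q^{2N}`
    obtain ⟨ε, hε, hεK⟩ : ∃ ε : ℝ, 0 < ε ∧ K * ε * ε < ‖h N‖ * (q : ℝ) ^ (2 * N : ℤ) := by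
      have hX : 0 < ‖h N‖ * (q : ℝ) ^ (2 * N : ℤ) := by positivity
      set X := ‖h N‖ * (q : ℝ) ^ (2 * N : ℤ)
      refine ⟨min 1 (X / (2 * (K + 1))), by positivity, ?_⟩
      have h1 : min 1 (X / (2 * (K + 1))) ≤ 1 := min_le_left _ _
      have h2 : min 1 (X / (2 * (K + 1))) ≤ X / (2 * (K + 1)) := min_le_right _ _
      have h0 : 0 < min 1 (X / (2 * (K + 1))) := by positivity
      calc K * min 1 (X / (2 * (K + 1))) * min 1 (X / (2 * (K + 1)))
          ≤ K * (X / (2 * (K + 1))) * 1 := by gcongr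
        _ = (K / (K + 1)) * (X / 2) := by field_simp
        _ ≤ 1 * (X / 2) := by
          gcongr
          rw [div_le_one (by positivity)]; linarith
        _ < X := by linarith
    have hfin := hlim ε hε
    obtain ⟨M, hM⟩ : ∃ M : ℕ, ∀ n : ℤ, (M : ℤ) ≤ |n| → ‖h n‖ * (q : ℝ) ^ n < ε := by
      obtain ⟨M, hM⟩ := (hfin.image fun n : ℤ => n.natAbs).bddAbove
      refine ⟨M + 1, fun n hn => ?_⟩
      by_contra hcon
      have h3 : n.natAbs ≤ M := hM ⟨n, not_lt.1 hcon, rfl⟩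
      rw [Int.abs_eq_natAbs] at hn
      omega
    have h1 := hM (N + (M + N : ℕ) : ℤ) (by rw [abs_of_nonneg (by positivity)]; push_cast; linarith)
    have h2 := hM (N - (M + N : ℕ) : ℤ) (by
      rw [abs_of_nonpos (by push_cast; linarith)]; push_cast; linarith)
    have h3 := hbound (M + N)
    have h4 : ‖h N‖ * (q : ℝ) ^ (2 * N : ℤ) ≤ K * (‖h (N - (M + N : ℕ) : ℤ)‖ *
        (q : ℝ) ^ (N - (M + N : ℕ) : ℤ)) * (‖h (N + (M + N : ℕ) : ℤ)‖ *
        (q : ℝ) ^ (N + (M + N : ℕ) : ℤ)) := by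
      have e : (q : ℝ) ^ (2 * N : ℤ) = (q : ℝ) ^ (N - (M + N : ℕ) : ℤ) *
          (q : ℝ) ^ (N + (M + N : ℕ) : ℤ) := by
        rw [← zpow_add₀ hq.ne']
        congr 1
        ring
      calc ‖h N‖ * (q : ℝ) ^ (2 * N : ℤ) ≤ (K * ‖h (N - (M + N : ℕ) : ℤ)‖ *
            ‖h (N + (M + N : ℕ) : ℤ)‖) * (q : ℝ) ^ (2 * N : ℤ) :=
            mul_le_mul_of_nonneg_right h3 (by positivity)
        _ = _ := by rw [e]; ring
    have h5 : K * (‖h (N - (M + N : ℕ) : ℤ)‖ * (q : ℝ) ^ (N - (M + N : ℕ) : ℤ)) *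
        (‖h (N + (M + N : ℕ) : ℤ)‖ * (q : ℝ) ^ (N + (M + N : ℕ) : ℤ)) ≤ K * ε * ε := by
      gcongr
    linarith
  -- both directions from `N`
  have hup : ∀ k : ℕ, h (N + k : ℤ) = 0 := fun k => by rw [← hfwd, hN0, mul_zero]
  have hdown : ∀ k : ℕ, h (N - k : ℤ) = 0 := fun k => by rw [← hback, hN0, mul_zero]
  rcases le_total (N : ℤ) n with hn | hn
  · obtain ⟨k, hk⟩ := Int.le.dest hn
    rw [← hk]; exact hup k
  · obtain ⟨k, hk⟩ := Int.le.dest hn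
    rw [show n = N - k by linarith]; exact hdown k

/-- Multiplication by `T - f` on Laurent polynomials is bounded below. This is where the noetherian
hypothesis enters the proof of acyclicity. -/
theorem IsReallyStronglyNoetherian.exists_norm_le_mul_T_sub (hA : IsReallyStronglyNoetherian A)
    (f : A) (q : PosReal) : ∃ K : ℝ, 0 ≤ K ∧ ∀ p : GaussAlgebra A (zpowersHom PosReal q),
      ‖p‖ ≤ K * ‖(T A _ (Multiplicative.ofAdd 1) - C A _ f) * p‖ := by
  set w := zpowersHom PosReal q
  set w₂ := bivariateWeight q
  let t : Multiplicative ℤ × Multiplicative ℤ := (Multiplicative.ofAdd 1, 1)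
  let D : GaussAlgebra A w₂ := T A w₂ t - C A w₂ f
  obtain ⟨K, hK, hKb⟩ := hA.exists_norm_le_completion q (D : Completion (GaussAlgebra A w₂))
  refine ⟨K, hK, fun p => ?_⟩
  let ι : Multiplicative ℤ →* Multiplicative ℤ × Multiplicative ℤ := MonoidHom.inl _ _
  have hι : Function.Injective ι := fun a b hab => (Prod.ext_iff.1 hab).1
  have hwι : ∀ g, w₂ (ι g) = w g := fun g => by
    change w g * zpowersHom PosReal _ 1 = w g
    rw [map_one, mul_one]
  have hnorm : ∀ p : GaussAlgebra A w, ‖mapExp w w₂ ι p‖ = ‖p‖ := by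
    intro p
    refine le_antisymm ((norm_le_iff (norm_nonneg _)).2 fun g => ?_)
      ((norm_le_iff (norm_nonneg _)).2 fun g => ?_)
    · by_cases hg : ∃ g', ι g' = g
      · obtain ⟨g', rfl⟩ := hg
        rw [coeff_mapExp hι, hwι]
        exact norm_coeff_le p g'
      · rw [coeff_mapExp_of_notMem p fun g' h' => hg ⟨g', h'⟩, norm_zero, zero_mul]
        exact norm_nonneg _
    · rw [← coeff_mapExp (w' := w₂) hι, ← hwι]
      exact norm_coeff_le _ _
  -- `D` is regular, since the coefficients of a series it kills satisfy `f hₙ = hₙ₋₁`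
  have hinj : ∀ x : Completion (GaussAlgebra A w₂), x * D = 0 → x = 0 := by
    intro x hx
    refine eq_zero_of_coeffCompl ?_
    rintro ⟨n, m⟩
    refine hA.eq_zero_of_shift f q (fun n => coeffCompl w₂ (Multiplicative.ofAdd n, m) x)
      (fun n => ?_) (fun ε hε => ?_) n.toAdd
    · have h1 : (T A w₂ t : Completion (GaussAlgebra A w₂)) * x =
          (C A w₂ f : Completion (GaussAlgebra A w₂)) * x := by
        rw [← sub_eq_zero, ← sub_mul, ← Completion.coe_sub, mul_comm]
        exact hx
      have h2 := congrArg (coeffCompl w₂ (Multiplicative.ofAdd n, m)) h1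
      rw [coeffCompl_T_mul, coeffCompl_C_mul] at h2
      have e : t⁻¹ * (Multiplicative.ofAdd n, m) = (Multiplicative.ofAdd (n - 1), m) := by
        refine Prod.ext ?_ ?_
        · change (Multiplicative.ofAdd (1 : ℤ))⁻¹ * Multiplicative.ofAdd n =
            Multiplicative.ofAdd (n - 1)
          rw [← ofAdd_neg, ← ofAdd_add, neg_add_eq_sub]
        · change (1 : Multiplicative ℤ)⁻¹ * m = m
          rw [inv_one, one_mul]
      rw [← h2, e]
    · have h2m : (0 : ℝ) < 2 ^ m.toAdd := by positivity
      refine ((finite_coeffCompl_ge x (mul_pos hε h2m)).preimage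
        (f := fun n : ℤ => (Multiplicative.ofAdd n, m)) ?_).subset ?_
      · intro a _ b _ hab
        exact Multiplicative.ofAdd.injective (Prod.ext_iff.1 hab).1
      · intro n hn
        have e : (w₂ (Multiplicative.ofAdd n, m) : ℝ) = (q : ℝ) ^ n * 2 ^ m.toAdd :=
          bivariateWeight_apply q _ _
        have h3 := mul_le_mul_of_nonneg_right 
          (show ε ≤ ‖coeffCompl w₂ (Multiplicative.ofAdd n, m) x‖ * (q : ℝ) ^ n from hn) h2m.le
        rw [mul_assoc, ← e] at h3
        exact h3
  obtain ⟨b, hb1, hb2⟩ := hKb (mapExp w w₂ ι p : GaussAlgebra A w₂)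
  -- the quotient `b` with controlled norm is therefore `p` itself
  have hb : b = (mapExp w w₂ ι p : GaussAlgebra A w₂) := by
    rw [← sub_eq_zero]
    refine hinj _ ?_
    rw [sub_mul, hb1, sub_self]
  have hD : mapExp w w₂ ι (T A w (Multiplicative.ofAdd 1) - C A w f) = D := by
    rw [map_sub, mapExp_T, mapExp_C]
    rfl
  rw [hb, ← Completion.coe_mul, Completion.norm_coe, Completion.norm_coe, hnorm, ← hD, ← map_mul,
    hnorm, mul_comm p] at hb2
  exact hb2

end Strictness

/-! ### Completed quotients of Gauss algebras -/

/-- The completion of the quotient of `A[G]`, with its Gauss norm, by an ideal `I`. -/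
def GaussQuotient (A : Type u) [NormedCommRing A] [IsUltrametricDist A] {G : Type} [CommMonoid G]
    (w : G →* PosReal) (I : Ideal (GaussAlgebra A w)) : Type u :=
  UniformSpace.Completion (GaussAlgebra A w ⧸ I)

namespace GaussQuotient

open UniformSpace GaussAlgebra

variable {A : Type u} [NormedCommRing A] [IsUltrametricDist A] {G : Type} [CommMonoid G]
  {w : G →* PosReal} {I : Ideal (GaussAlgebra A w)}

instance : NormedCommRing (GaussQuotient A w I) :=
  inferInstanceAs (NormedCommRing (Completion (GaussAlgebra A w ⧸ I)))

instance : CompleteSpace (GaussQuotient A w I) :=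
  inferInstanceAs (CompleteSpace (Completion (GaussAlgebra A w ⧸ I)))

variable (I) in
/-- The canonical map `A[G] → Completion (A[G] ⧸ I)`. -/
def of : GaussAlgebra A w →+* GaussQuotient A w I :=
  (Completion.coeRingHom (α := GaussAlgebra A w ⧸ I)).comp (Ideal.Quotient.mk I)

theorem norm_of (p : GaussAlgebra A w) : ‖of I p‖ = ‖Ideal.Quotient.mk I p‖ :=
  Completion.norm_coe (E := GaussAlgebra A w ⧸ I) _

theorem norm_of_le (p : GaussAlgebra A w) : ‖of I p‖ ≤ ‖p‖ :=
  (norm_of p).trans_le (Ideal.Quotient.norm_mk_le I p)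

theorem of_eq_zero {p : GaussAlgebra A w} (hp : p ∈ I) : of I p = 0 := by
  have h : ‖of I p‖ = 0 := by rw [norm_of, Ideal.Quotient.eq_zero_iff_mem.2 hp, norm_zero]
  exact norm_eq_zero.1 h

/-- The quotient norm is approximated by norms of representatives. -/
theorem exists_sub_mem_norm_lt (p : GaussAlgebra A w) {ε : ℝ} (hε : 0 < ε) :
    ∃ p', p' - p ∈ I ∧ ‖p'‖ < ‖of I p‖ + ε := by
  obtain ⟨p', h1, h2⟩ := Ideal.Quotient.norm_mk_lt (Ideal.Quotient.mk I p) hε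
  exact ⟨p', Ideal.Quotient.eq.1 h1, by rwa [norm_of]⟩

/-- Density of `A[G]` in the completed quotient, with control of the norms. -/
theorem exists_norm_sub_of_le (b : GaussQuotient A w I) {ε : ℝ} (hε : 0 < ε) :
    ∃ p, ‖b - of I p‖ ≤ ε ∧ ‖p‖ ≤ ‖b‖ + ε := by
  have hd : DenseRange ((↑) : GaussAlgebra A w ⧸ I → Completion (GaussAlgebra A w ⧸ I)) :=
    Completion.denseRange_coe
  obtain ⟨x, hx⟩ := hd.exists_dist_lt b (half_pos hε)
  obtain ⟨p, rfl, h2⟩ := Ideal.Quotient.norm_mk_lt x (half_pos hε)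
  have h4 : ‖b - of I p‖ < ε / 2 := by
    rw [← dist_eq_norm]
    exact hx
  refine ⟨p, h4.le.trans (half_le_self hε.le), ?_⟩
  have h3 : ‖of I p‖ ≤ ‖b‖ + ‖b - of I p‖ := by
    have := norm_sub_norm_le (of I p) b
    rw [norm_sub_rev] at this
    linarith
  rw [norm_of] at h3
  linarith

theorem denseRange_of : DenseRange (of I) := by
  refine fun b => Metric.mem_closure_iff.2 fun ε hε => ?_
  obtain ⟨p, hp, -⟩ := exists_norm_sub_of_le b (half_pos hε)
  exact ⟨_, ⟨p, rfl⟩, by rw [dist_eq_norm]; linarith⟩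

instance : IsUltrametricDist (GaussQuotient A w I) := by
  refine IsUltrametricDist.isUltrametricDist_of_forall_norm_add_le_max_norm fun a b => ?_
  refine le_of_forall_pos_le_add fun ε hε => ?_
  -- approximation by sums of representatives
  have h1 : ∀ δ > 0, ‖a + b‖ ≤ max ‖a‖ ‖b‖ + 3 * δ := by
    intro δ hδ
    obtain ⟨p, hp, hp'⟩ := exists_norm_sub_of_le a hδ
    obtain ⟨r, hr, hr'⟩ := exists_norm_sub_of_le b hδ
    have e : a + b = (a - of I p) + (b - of I r) + of I (p + r) := by rw [map_add]; ring
    have h2 := (norm_of_le (I := I) (p + r)).trans (IsUltrametricDist.norm_add_le_max p r)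
    have h3 : max ‖p‖ ‖r‖ ≤ max ‖a‖ ‖b‖ + δ :=
      max_le (hp'.trans (by gcongr; exact le_max_left _ _))
        (hr'.trans (by gcongr; exact le_max_right _ _))
    have h4 := norm_add₃_le (a := a - of I p) (b := b - of I r) (c := of I (p + r))
    rw [← e] at h4
    linarith
  have := h1 (ε / 3) (by positivity)
  linarith

/-- Bounded maps on `A[G]` which kill `I` extend to the completed quotient. -/
theorem exists_lift {B : Type*} [NormedCommRing B] [CompleteSpace B] (θ : GaussAlgebra A w →+* B)
    {c : ℝ} (hc : 0 ≤ c) (hθ : ∀ p, ‖θ p‖ ≤ c * ‖p‖) (hI : ∀ p ∈ I, θ p = 0) :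
    ∃ g : GaussQuotient A w I →+* B, (∀ p, g (of I p) = θ p) ∧ ∀ b, ‖g b‖ ≤ c * ‖b‖ := by
  let θ' : GaussAlgebra A w ⧸ I →+* B := Ideal.Quotient.lift I θ hI
  have hθ' : ∀ x, ‖θ' x‖ ≤ c * ‖x‖ := by
    intro x
    refine le_of_forall_pos_le_add fun ε hε => ?_
    obtain ⟨p, rfl, h2⟩ := Ideal.Quotient.norm_mk_lt x (ε := ε / (c + 1)) (by positivity)
    calc ‖θ' (Ideal.Quotient.mk I p)‖ = ‖θ p‖ := by rw [Ideal.Quotient.lift_mk]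
      _ ≤ c * ‖p‖ := hθ p
      _ ≤ c * (‖Ideal.Quotient.mk I p‖ + ε / (c + 1)) := by gcongr
      _ = c * ‖Ideal.Quotient.mk I p‖ + c / (c + 1) * ε := by ring
      _ ≤ c * ‖Ideal.Quotient.mk I p‖ + 1 * ε := by
        gcongr
        rw [div_le_one (by positivity)]; linarith
      _ = _ := by rw [one_mul]
  have hcont : Continuous θ' := AddMonoidHomClass.continuous_of_bound θ' c hθ'
  let g : Completion (GaussAlgebra A w ⧸ I) →+* B := Completion.extensionHom θ' hcont
  have hg : ∀ x : GaussAlgebra A w ⧸ I, g x = θ' x := Completion.extensionHom_coe θ' hcont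
  refine ⟨g, fun p => ?_, fun b => ?_⟩
  · exact (hg _).trans (Ideal.Quotient.lift_mk _ _ _)
  · refine Completion.induction_on (p := fun b => ‖g b‖ ≤ c * ‖b‖) b ?_ fun x => ?_
    · exact isClosed_le (Completion.continuous_extension.norm)
        (continuous_const.mul continuous_norm)
    · rw [hg, Completion.norm_coe]
      exact hθ' x

theorem hom_ext {B : Type*} [NormedCommRing B] {f g : GaussQuotient A w I →+* B}
    (hf : Continuous f) (hg : Continuous g) (hC : ∀ a, f (of I (C A w a)) = g (of I (C A w a)))
    (hT : ∀ x, f (of I (T A w x)) = g (of I (T A w x))) : f = g := by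
  have h : f.comp (of I) = g.comp (of I) := GaussAlgebra.ringHom_ext hC hT
  refine RingHom.ext fun b => ?_
  exact congrFun (denseRange_of.equalizer hf hg (funext fun p => congrArg (fun φ => φ p) h)) b

end GaussQuotient

theorem IsReallyStronglyNoetherian.gaussQuotient {A : Type u} [NormedCommRing A]
    [IsUltrametricDist A] (hA : IsReallyStronglyNoetherian A) {G : Type} [CommMonoid G]
    [Monoid.FG G] (w : G →* PosReal) (I : Ideal (GaussAlgebra A w)) :
    IsReallyStronglyNoetherian (GaussQuotient A w I) := by
  refine hA.of_approx w (GaussQuotient.of I) zero_le_one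
    (fun p => by rw [one_mul]; exact GaussQuotient.norm_of_le p) zero_le_two fun b ε hε => ?_
  rcases eq_or_ne b 0 with rfl | hb
  · exact ⟨0, by simp, by simpa using hε.le⟩
  · obtain ⟨p, hp, hp'⟩ := GaussQuotient.exists_norm_sub_of_le b
      (lt_min hε (norm_pos_iff.2 hb))
    refine ⟨p, hp'.trans ?_, hp.trans (min_le_left _ _)⟩
    have := min_le_right ε ‖b‖
    linarith

/-! ### Exactness for simple Laurent coverings -/

section Laurent

open GaussAlgebra

variable {A : Type u} [NormedCommRing A] [IsUltrametricDist A]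

/-- The inclusion of `A[T]` in `A[T, T⁻¹]`. -/
def posExp : Multiplicative ℕ →* Multiplicative ℤ := (Nat.castAddMonoidHom ℤ).toMultiplicative

/-- The inclusion of `A[T⁻¹]` in `A[T, T⁻¹]`. -/
def negExp : Multiplicative ℕ →* Multiplicative ℤ := (-(Nat.castAddMonoidHom ℤ)).toMultiplicative

theorem posExp_apply (n : ℕ) :
    posExp (Multiplicative.ofAdd n) = Multiplicative.ofAdd (n : ℤ) := rfl

theorem negExp_apply (n : ℕ) :
    negExp (Multiplicative.ofAdd n) = Multiplicative.ofAdd (-(n : ℤ)) := rfl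

theorem posExp_injective : Function.Injective posExp := fun a b h => by
  have h' : ((a.toAdd : ℕ) : ℤ) = b.toAdd := congrArg Multiplicative.toAdd h
  exact Multiplicative.toAdd.injective (by exact_mod_cast h')

theorem negExp_injective : Function.Injective negExp := fun a b h => by
  have h' : -((a.toAdd : ℕ) : ℤ) = -(b.toAdd : ℤ) := congrArg Multiplicative.toAdd h
  exact Multiplicative.toAdd.injective (by exact_mod_cast neg_injective h')

theorem zpowersHom_posExp (q : PosReal) (n : Multiplicative ℕ) :
    zpowersHom PosReal q (posExp n) = powersHom PosReal q n := by
  change q ^ ((n.toAdd : ℕ) : ℤ) = q ^ n.toAdd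
  exact zpow_natCast _ _

theorem zpowersHom_negExp (q : PosReal) (n : Multiplicative ℕ) :
    zpowersHom PosReal q (negExp n) = powersHom PosReal q⁻¹ n := by
  change q ^ (-((n.toAdd : ℕ) : ℤ)) = q⁻¹ ^ n.toAdd
  rw [zpow_neg, zpow_natCast, inv_pow]

/-- Every Laurent polynomial is the sum of a polynomial in `T` and `T⁻¹` times a polynomial in
`T⁻¹`. -/
theorem exists_laurent_decomposition (q : PosReal) (h : GaussAlgebra A (zpowersHom PosReal q)) :
    ∃ (u : GaussAlgebra A (powersHom PosReal q)) (v : GaussAlgebra A (powersHom PosReal q⁻¹)),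
      h = mapExp _ _ posExp u + T A _ (Multiplicative.ofAdd (-1)) * mapExp _ _ negExp v := by
  rw [← sum_single h]
  refine Finset.sum_induction _ (fun h => ∃ u v, h = mapExp _ _ posExp u +
    T A _ (Multiplicative.ofAdd (-1)) * mapExp _ _ negExp v) ?_ ⟨0, 0, by simp⟩ fun g _ => ?_
  · rintro _ _ ⟨u, v, rfl⟩ ⟨u', v', rfl⟩
    exact ⟨u + u', v + v', by rw [map_add, map_add]; ring⟩
  · obtain ⟨n, hn⟩ : ∃ n : ℤ, g = Multiplicative.ofAdd n := ⟨g.toAdd, rfl⟩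
    rcases le_or_gt 0 n with h0 | h0
    · obtain ⟨k, rfl⟩ := Int.eq_ofNat_of_zero_le h0
      refine ⟨single A _ (Multiplicative.ofAdd k) (coeff g h), 0, ?_⟩
      rw [mapExp_single, posExp_apply, hn, map_zero, mul_zero, add_zero]
    · obtain ⟨k, hk⟩ := Int.eq_ofNat_of_zero_le (show 0 ≤ -1 - n by omega)
      refine ⟨0, single A _ (Multiplicative.ofAdd k) (coeff g h), ?_⟩
      rw [mapExp_single, negExp_apply, hn, map_zero, zero_add, T_apply, single_mul_single, one_mul,
        ← ofAdd_add, ← hk, show -1 + -(-1 - n) = n by ring]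

variable (f : A) (q : PosReal)

/-- The ideal generated by `b T - a` in `A[T]`, whose completed quotient is the ring of the locus
`v(a) ≤ q v(b) ≠ 0`. -/
def fractionIdeal (a b : A) : Ideal (GaussAlgebra A (powersHom PosReal q)) :=
  Ideal.span {C A _ b * T A _ (Multiplicative.ofAdd 1) - C A _ a}

/-- The ideal generated by `T - f` in `A[T, T⁻¹]`. -/
def annulusIdeal : Ideal (GaussAlgebra A (zpowersHom PosReal q)) :=
  Ideal.span {T A _ (Multiplicative.ofAdd 1) - C A _ f}

theorem mapExp_posExp_generator : mapExp (powersHom PosReal q) (zpowersHom PosReal q) posExp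
    (C A _ 1 * T A _ (Multiplicative.ofAdd 1) - C A _ f) =
      T A _ (Multiplicative.ofAdd 1) - C A _ f := by
  rw [map_sub, map_mul, mapExp_T, mapExp_C, mapExp_C, map_one, one_mul]
  rfl

theorem T_mul_T_neg : T A (zpowersHom PosReal q) (Multiplicative.ofAdd 1) *
    T A _ (Multiplicative.ofAdd (-1)) = 1 := by
  rw [← map_mul, ← ofAdd_add]
  exact map_one _

theorem mapExp_negExp_generator : mapExp (powersHom PosReal q⁻¹) (zpowersHom PosReal q) negExp
    (C A _ f * T A _ (Multiplicative.ofAdd 1) - C A _ 1) =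
      -((T A _ (Multiplicative.ofAdd 1) - C A _ f) * T A _ (Multiplicative.ofAdd (-1))) := by
  rw [map_sub, map_mul, mapExp_T, mapExp_C, mapExp_C, map_one (C A (zpowersHom PosReal q)), sub_mul,
    T_mul_T_neg]
  change C A (zpowersHom PosReal q) f * T A (zpowersHom PosReal q) (Multiplicative.ofAdd (-1)) -
    1 = _
  ring

theorem norm_mapExp_posExp_le (p : GaussAlgebra A (powersHom PosReal q)) :
    ‖mapExp _ (zpowersHom PosReal q) posExp p‖ ≤ ‖p‖ := by
  refine (norm_le_iff (norm_nonneg _)).2 fun g => ?_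
  by_cases hg : ∃ g', posExp g' = g
  · obtain ⟨g', rfl⟩ := hg
    rw [coeff_mapExp posExp_injective, zpowersHom_posExp]
    exact norm_coeff_le p g'
  · rw [coeff_mapExp_of_notMem p fun g' h' => hg ⟨g', h'⟩, norm_zero, zero_mul]
    exact norm_nonneg _

theorem norm_mapExp_negExp_le (p : GaussAlgebra A (powersHom PosReal q⁻¹)) :
    ‖mapExp _ (zpowersHom PosReal q) negExp p‖ ≤ ‖p‖ := by
  refine (norm_le_iff (norm_nonneg _)).2 fun g => ?_
  by_cases hg : ∃ g', negExp g' = g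
  · obtain ⟨g', rfl⟩ := hg
    rw [coeff_mapExp negExp_injective, zpowersHom_negExp]
    exact norm_coeff_le p g'
  · rw [coeff_mapExp_of_notMem p fun g' h' => hg ⟨g', h'⟩, norm_zero, zero_mul]
    exact norm_nonneg _

theorem coeff_laurent_posExp (u : GaussAlgebra A (powersHom PosReal q))
    (v : GaussAlgebra A (powersHom PosReal q⁻¹)) (k : ℕ) :
    coeff (Multiplicative.ofAdd (k : ℤ)) (mapExp _ (zpowersHom PosReal q) posExp u +
      T A _ (Multiplicative.ofAdd (-1)) * mapExp _ _ negExp v) =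
      coeff (Multiplicative.ofAdd k) u := by
  rw [map_add, ← posExp_apply, coeff_mapExp posExp_injective, T_apply, coeff_single_mul,
    coeff_mapExp_of_notMem, mul_zero, add_zero]
  intro g hg
  have h1 : -((g.toAdd : ℕ) : ℤ) = -(-1) + (k : ℤ) := congrArg Multiplicative.toAdd hg
  omega

/-- The ring `A` is a closed subspace of the product of the two rings of a simple Laurent
covering. -/
theorem IsReallyStronglyNoetherian.exists_norm_le_max [CompleteSpace A]
    (hA : IsReallyStronglyNoetherian A) :
    ∃ K : ℝ, 0 ≤ K ∧ ∀ a : A,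
      ‖a‖ ≤ K * max ‖GaussQuotient.of (fractionIdeal q f 1) (C A _ a)‖
        ‖GaussQuotient.of (fractionIdeal q⁻¹ 1 f) (C A _ a)‖ := by
  obtain ⟨K, hK, hKb⟩ := hA.exists_norm_le_mul_T_sub f q
  set d : GaussAlgebra A (powersHom PosReal q) :=
    C A _ 1 * T A _ (Multiplicative.ofAdd 1) - C A _ f with hd
  refine ⟨max 1 (K * ‖d‖), by positivity, fun a => ?_⟩
  set M := max ‖GaussQuotient.of (fractionIdeal q f 1) (C A _ a)‖
        ‖GaussQuotient.of (fractionIdeal q⁻¹ 1 f) (C A _ a)‖ with hM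
  have key : ∀ δ > 0, ‖a‖ ≤ max 1 (K * ‖d‖) * (M + δ) := by
    intro δ hδ
    -- small representatives `r` and `s` of `a` differ by `(T - f) x` on the annulus, and the lower
    -- bound for multiplication by `T - f` controls `x`, whose part of degree `≥ 0` is `u`
    obtain ⟨r, hr, hr'⟩ :=
      GaussQuotient.exists_sub_mem_norm_lt (I := fractionIdeal q f 1) (C A _ a) hδ
    obtain ⟨s, hs, hs'⟩ :=
      GaussQuotient.exists_sub_mem_norm_lt (I := fractionIdeal q⁻¹ 1 f) (C A _ a) hδ
    obtain ⟨u, hu⟩ := Ideal.mem_span_singleton'.1 hr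
    obtain ⟨v, hv⟩ := Ideal.mem_span_singleton'.1 hs
    have hrM : ‖r‖ ≤ M + δ := hr'.le.trans (by gcongr; exact le_max_left _ _)
    have hsM : ‖s‖ ≤ M + δ := hs'.le.trans (by gcongr; exact le_max_right _ _)
    set x := mapExp _ (zpowersHom PosReal q) posExp u +
      T A _ (Multiplicative.ofAdd (-1)) * mapExp _ _ negExp v with hx
    have e : (T A _ (Multiplicative.ofAdd 1) - C A _ f) * x =
        mapExp _ (zpowersHom PosReal q) posExp r - mapExp _ (zpowersHom PosReal q) negExp s := by
      have h1 := congrArg (mapExp _ (zpowersHom PosReal q) posExp) hu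
      have h2 := congrArg (mapExp _ (zpowersHom PosReal q) negExp) hv
      rw [map_mul, mapExp_posExp_generator, map_sub, mapExp_C] at h1
      rw [map_mul, mapExp_negExp_generator, map_sub, mapExp_C] at h2
      rw [hx]
      linear_combination h1 - h2
    have hxM : ‖x‖ ≤ K * (M + δ) := by
      refine (hKb x).trans (mul_le_mul_of_nonneg_left ?_ hK)
      rw [e, sub_eq_add_neg]
      refine (IsUltrametricDist.norm_add_le_max _ _).trans (max_le ?_ ?_)
      · exact (norm_mapExp_posExp_le q r).trans hrM
      · rw [norm_neg]
        exact (norm_mapExp_negExp_le q s).trans hsM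
    have huM : ‖u‖ ≤ K * (M + δ) := by
      refine ((norm_le_iff (norm_nonneg x)).2 fun g => ?_).trans hxM
      have h1 := norm_coeff_le x (posExp g)
      rw [zpowersHom_posExp] at h1
      have h2 := coeff_laurent_posExp q u v g.toAdd
      rwa [show coeff (posExp g) x = coeff g u from h2] at h1
    have ha : (C A (powersHom PosReal q) a) = r + -(u * d) := by
      rw [hd, hu]; ring
    have hM0 : 0 ≤ M + δ := (norm_nonneg r).trans hrM
    rw [← norm_C (w := powersHom PosReal q) a, ha]
    refine (IsUltrametricDist.norm_add_le_max _ _).trans (max_le ?_ ?_)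
    · calc ‖r‖ ≤ 1 * (M + δ) := by rw [one_mul]; exact hrM
        _ ≤ _ := mul_le_mul_of_nonneg_right (le_max_left _ _) hM0
    · rw [norm_neg]
      calc ‖u * d‖ ≤ ‖u‖ * ‖d‖ := norm_mul_le _ _
        _ ≤ K * (M + δ) * ‖d‖ := by gcongr
        _ = K * ‖d‖ * (M + δ) := by ring
        _ ≤ _ := mul_le_mul_of_nonneg_right (le_max_right _ _) hM0
  refine le_of_forall_pos_le_add fun ε hε => ?_
  have hpos : 0 < max 1 (K * ‖d‖) := lt_max_of_lt_left one_pos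
  calc ‖a‖ ≤ max 1 (K * ‖d‖) * (M + ε / max 1 (K * ‖d‖)) := key _ (by positivity)
    _ = _ := by field_simp

theorem of_annulusIdeal_T {f : A} {q : PosReal}
    {J : Ideal (GaussAlgebra A (zpowersHom PosReal q))} (hJ : J = annulusIdeal f q) :
    GaussQuotient.of J (T A _ (Multiplicative.ofAdd 1)) = GaussQuotient.of J (C A _ f) := by
  subst hJ
  rw [← sub_eq_zero, ← map_sub]
  exact GaussQuotient.of_eq_zero (Ideal.mem_span_singleton_self _)

theorem of_fractionIdeal {a b : A} {q : PosReal}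
    {I : Ideal (GaussAlgebra A (powersHom PosReal q))} (hI : I = fractionIdeal q a b) :
    GaussQuotient.of I (C A _ b) * GaussQuotient.of I (T A _ (Multiplicative.ofAdd 1)) =
      GaussQuotient.of I (C A _ a) := by
  subst hI
  rw [← sub_eq_zero, ← map_mul, ← map_sub]
  exact GaussQuotient.of_eq_zero (Ideal.mem_span_singleton_self _)

theorem ofAdd_one_pow (x : Multiplicative ℕ) : x = Multiplicative.ofAdd 1 ^ x.toAdd := by
  rw [← ofAdd_nsmul, nsmul_one]
  rfl

/-- A map under `A` from the ring of `v(f) ≤ q` to the ring of the annulus is the one induced by the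
inclusion `A[T] ⊆ A[T, T⁻¹]`. -/
theorem comp_of_eq_posExp {f : A} {q : PosReal}
    {I : Ideal (GaussAlgebra A (powersHom PosReal q))}
    {J : Ideal (GaussAlgebra A (zpowersHom PosReal q))}
    (hI : I = fractionIdeal q f 1) (hJ : J = annulusIdeal f q)
    (ρ : GaussQuotient A _ I →+* GaussQuotient A _ J)
    (hC : ∀ a, ρ (GaussQuotient.of _ (C A _ a)) = GaussQuotient.of _ (C A _ a)) :
    ρ.comp (GaussQuotient.of I) = (GaussQuotient.of J).comp (mapExp _ _ posExp) := by
  have hT := of_fractionIdeal hI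
  rw [map_one (C A _), map_one, one_mul] at hT
  refine GaussAlgebra.ringHom_ext (fun a => ?_) fun x => ?_
  · simp only [RingHom.comp_apply, mapExp_C]
    exact hC a
  · rw [ofAdd_one_pow x, map_pow, map_pow, map_pow]
    congr 1
    simp only [RingHom.comp_apply, mapExp_T]
    rw [hT, hC, ← of_annulusIdeal_T hJ]
    rfl

/-- A map under `A` from the ring of `v(f) ≥ q` to the ring of the annulus is the one induced by the
inclusion `A[T⁻¹] ⊆ A[T, T⁻¹]`. -/
theorem comp_of_eq_negExp {f : A} {q : PosReal}
    {I : Ideal (GaussAlgebra A (powersHom PosReal q⁻¹))}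
    {J : Ideal (GaussAlgebra A (zpowersHom PosReal q))}
    (hI : I = fractionIdeal q⁻¹ 1 f) (hJ : J = annulusIdeal f q)
    (ρ : GaussQuotient A _ I →+* GaussQuotient A _ J)
    (hC : ∀ a, ρ (GaussQuotient.of _ (C A _ a)) = GaussQuotient.of _ (C A _ a)) :
    ρ.comp (GaussQuotient.of I) = (GaussQuotient.of J).comp (mapExp _ _ negExp) := by
  have hT := of_fractionIdeal hI
  rw [map_one (C A _), map_one (GaussQuotient.of _)] at hT
  refine GaussAlgebra.ringHom_ext (fun a => ?_) fun x => ?_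
  · simp only [RingHom.comp_apply, mapExp_C]
    exact hC a
  · rw [ofAdd_one_pow x, map_pow, map_pow, map_pow]
    congr 1
    simp only [RingHom.comp_apply, mapExp_T]
    have h1 := congrArg ρ hT
    rw [map_mul, map_one ρ, hC, ← of_annulusIdeal_T hJ] at h1
    have h2 := congrArg (GaussQuotient.of J) (T_mul_T_neg (A := A) q)
    rw [map_mul, map_one (GaussQuotient.of J)] at h2
    change _ = GaussQuotient.of J (T A _ (Multiplicative.ofAdd (-1)))
    exact (left_inv_eq_right_inv ((mul_comm _ _).trans h1) h2)

/-- Elements of the two rings of a simple Laurent covering which agree on the annulus are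
simultaneously approximated by elements of `A`. -/
theorem exists_approx_of_agree {f : A} {q : PosReal}
    {I₁ : Ideal (GaussAlgebra A (powersHom PosReal q))}
    {I₂ : Ideal (GaussAlgebra A (powersHom PosReal q⁻¹))}
    {J : Ideal (GaussAlgebra A (zpowersHom PosReal q))}
    (hI₁ : I₁ = fractionIdeal q f 1) (hI₂ : I₂ = fractionIdeal q⁻¹ 1 f) (hJ : J = annulusIdeal f q)
    (ρ₁ : GaussQuotient A _ I₁ →+* GaussQuotient A _ J)
    (ρ₂ : GaussQuotient A _ I₂ →+* GaussQuotient A _ J)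
    {c : ℝ} (hc : 0 ≤ c) (h₁ : ∀ b, ‖ρ₁ b‖ ≤ c * ‖b‖) (h₂ : ∀ b, ‖ρ₂ b‖ ≤ c * ‖b‖)
    (hC₁ : ∀ a, ρ₁ (GaussQuotient.of _ (C A _ a)) = GaussQuotient.of _ (C A _ a))
    (hC₂ : ∀ a, ρ₂ (GaussQuotient.of _ (C A _ a)) = GaussQuotient.of _ (C A _ a))
    {b₁ : GaussQuotient A _ I₁} {b₂ : GaussQuotient A _ I₂} (hb : ρ₁ b₁ = ρ₂ b₂)
    {ε : ℝ} (hε : 0 < ε) :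
    ∃ a, ‖b₁ - GaussQuotient.of I₁ (C A _ a)‖ ≤ ε ∧ ‖b₂ - GaussQuotient.of I₂ (C A _ a)‖ ≤ ε := by
  have hρ₁ := comp_of_eq_posExp hI₁ hJ ρ₁ hC₁
  have hρ₂ := comp_of_eq_negExp hI₂ hJ ρ₂ hC₂
  set δ := ε / (c + 1)
  have hδ : 0 < δ := by positivity
  have hcδ : c * δ + δ = ε := by
    simp only [δ]; field_simp
  have hδε : δ ≤ ε := by nlinarith
  obtain ⟨p, hp, -⟩ := GaussQuotient.exists_norm_sub_of_le b₁ hδ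
  obtain ⟨r, hr, -⟩ := GaussQuotient.exists_norm_sub_of_le b₂ hδ
  have hz : ‖GaussQuotient.of J (mapExp _ _ posExp p - mapExp _ _ negExp r)‖ ≤ c * δ := by
    have e1 : GaussQuotient.of J (mapExp _ _ posExp p) = ρ₁ (GaussQuotient.of I₁ p) :=
      (congrArg (fun φ => φ p) hρ₁).symm
    have e2 : GaussQuotient.of J (mapExp _ _ negExp r) = ρ₂ (GaussQuotient.of I₂ r) :=
      (congrArg (fun φ => φ r) hρ₂).symm
    have e3 : GaussQuotient.of J (mapExp _ _ posExp p - mapExp _ _ negExp r) =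
        ρ₂ (b₂ - GaussQuotient.of I₂ r) + -ρ₁ (b₁ - GaussQuotient.of I₁ p) := by
      rw [map_sub, e1, e2, map_sub, map_sub, hb]; ring
    rw [e3]
    refine (IsUltrametricDist.norm_add_le_max _ _).trans (max_le ?_ ?_)
    · exact (h₂ _).trans (mul_le_mul_of_nonneg_left hr hc)
    · rw [norm_neg]
      exact (h₁ _).trans (mul_le_mul_of_nonneg_left hp hc)
  -- a small representative `z` of the difference of `p` and `r` on the annulus
  obtain ⟨z, hzI, hzn⟩ := GaussQuotient.exists_sub_mem_norm_lt (I := J)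
    (mapExp _ _ posExp p - mapExp _ _ negExp r) hδ
  have hzε : ‖z‖ ≤ ε := by linarith
  rw [hJ] at hzI
  obtain ⟨h, hh⟩ := Ideal.mem_span_singleton'.1 hzI
  obtain ⟨u, v, huv⟩ := exists_laurent_decomposition q h
  -- change `p` and `r` within their classes so that their difference is `z` itself: then all their
  -- coefficients of nonzero degree are small, and their constant terms are close to each other
  set p' := p + u * (C A _ 1 * T A _ (Multiplicative.ofAdd 1) - C A _ f) with hp'
  set r' := r + v * (C A _ f * T A _ (Multiplicative.ofAdd 1) - C A _ 1) with hr'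
  have hz' : z = mapExp _ _ posExp p' - mapExp _ _ negExp r' := by
    rw [hp', hr', map_add, map_add, map_mul, map_mul, mapExp_posExp_generator,
      mapExp_negExp_generator]
    rw [huv] at hh
    linear_combination -hh
  have hp'I : GaussQuotient.of I₁ p' = GaussQuotient.of I₁ p := by
    rw [hp', map_add, GaussQuotient.of_eq_zero (Ideal.mul_mem_left _ _
      (hI₁ ▸ Ideal.mem_span_singleton_self _)), add_zero]
  have hr'I : GaussQuotient.of I₂ r' = GaussQuotient.of I₂ r := by
    rw [hr', map_add, GaussQuotient.of_eq_zero (Ideal.mul_mem_left _ _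
      (hI₂ ▸ Ideal.mem_span_singleton_self _)), add_zero]
  set a := coeff 1 p' with ha
  have hpos : ∀ k : ℕ, k ≠ 0 → ‖coeff (Multiplicative.ofAdd k) p'‖ * (q : ℝ) ^ k ≤ ε := by
    intro k hk
    have h1 := (norm_coeff_le z (posExp (Multiplicative.ofAdd k))).trans hzε
    rw [hz', map_sub, coeff_mapExp posExp_injective, coeff_mapExp_of_notMem, sub_zero,
      zpowersHom_posExp] at h1
    · exact h1
    · intro g hg
      have h1 : -((g.toAdd : ℕ) : ℤ) = (k : ℤ) := congrArg Multiplicative.toAdd hg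
      omega
  have hneg : ∀ k : ℕ, k ≠ 0 →
      ‖coeff (Multiplicative.ofAdd k) r'‖ * ((q⁻¹ : PosReal) : ℝ) ^ k ≤ ε := by
    intro k hk
    have h1 := (norm_coeff_le z (negExp (Multiplicative.ofAdd k))).trans hzε
    rw [hz', map_sub, coeff_mapExp negExp_injective, coeff_mapExp_of_notMem, zero_sub,
      zpowersHom_negExp, norm_neg] at h1
    · exact h1
    · intro g hg
      have h1 : ((g.toAdd : ℕ) : ℤ) = -(k : ℤ) := congrArg Multiplicative.toAdd hg
      omega
  have hzero : ‖coeff 1 r' - a‖ ≤ ε := by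
    have h1 := (norm_coeff_le z (posExp 1)).trans hzε
    rw [zpowersHom_posExp, map_one (powersHom PosReal q), Positive.val_one, mul_one, hz', map_sub,
      coeff_mapExp posExp_injective, map_one posExp, ← map_one negExp,
      coeff_mapExp negExp_injective, norm_sub_rev] at h1
    exact h1
  refine ⟨a, ?_, ?_⟩
  · have e : b₁ - GaussQuotient.of I₁ (C A _ a) =
        (b₁ - GaussQuotient.of I₁ p) + GaussQuotient.of I₁ (p' - C A _ a) := by
      rw [map_sub, hp'I]; ring
    rw [e]
    refine (IsUltrametricDist.norm_add_le_max _ _).trans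
      (max_le (hp.trans hδε) ((GaussQuotient.norm_of_le _).trans ?_))
    refine (norm_le_iff hε.le).2 fun g => ?_
    obtain ⟨k, hk⟩ : ∃ k : ℕ, g = Multiplicative.ofAdd k := ⟨g.toAdd, rfl⟩
    rw [hk, map_sub, C_apply, coeff_single]
    rcases eq_or_ne k 0 with rfl | hk
    · rw [ofAdd_zero, if_pos rfl, ← ha, sub_self, norm_zero, zero_mul]
      exact hε.le
    · rw [if_neg fun h : 1 = Multiplicative.ofAdd k => hk (Multiplicative.ofAdd.injective h).symm, sub_zero]
      exact hpos k hk
  · have e : b₂ - GaussQuotient.of I₂ (C A _ a) =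
        (b₂ - GaussQuotient.of I₂ r) + GaussQuotient.of I₂ (r' - C A _ a) := by
      rw [map_sub, hr'I]; ring
    rw [e]
    refine (IsUltrametricDist.norm_add_le_max _ _).trans
      (max_le (hr.trans hδε) ((GaussQuotient.norm_of_le _).trans ?_))
    refine (norm_le_iff hε.le).2 fun g => ?_
    obtain ⟨k, hk⟩ : ∃ k : ℕ, g = Multiplicative.ofAdd k := ⟨g.toAdd, rfl⟩
    rw [hk, map_sub, C_apply, coeff_single]
    rcases eq_or_ne k 0 with rfl | hk
    · rw [ofAdd_zero, if_pos rfl, map_one, Positive.val_one, mul_one]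
      exact hzero
    · rw [if_neg fun h : 1 = Multiplicative.ofAdd k => hk (Multiplicative.ofAdd.injective h).symm, sub_zero]
      exact hneg k hk
/-- Elements of the two rings of a simple Laurent covering which agree on the annulus come from
`A`. -/
theorem IsReallyStronglyNoetherian.exists_of_agree [CompleteSpace A]
    (hA : IsReallyStronglyNoetherian A)
    {f : A} {q : PosReal} {I₁ : Ideal (GaussAlgebra A (powersHom PosReal q))}
    {I₂ : Ideal (GaussAlgebra A (powersHom PosReal q⁻¹))}
    {J : Ideal (GaussAlgebra A (zpowersHom PosReal q))}
    (hI₁ : I₁ = fractionIdeal q f 1) (hI₂ : I₂ = fractionIdeal q⁻¹ 1 f) (hJ : J = annulusIdeal f q)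
    (ρ₁ : GaussQuotient A _ I₁ →+* GaussQuotient A _ J)
    (ρ₂ : GaussQuotient A _ I₂ →+* GaussQuotient A _ J)
    {c : ℝ} (hc : 0 ≤ c) (h₁ : ∀ b, ‖ρ₁ b‖ ≤ c * ‖b‖) (h₂ : ∀ b, ‖ρ₂ b‖ ≤ c * ‖b‖)
    (hC₁ : ∀ a, ρ₁ (GaussQuotient.of _ (C A _ a)) = GaussQuotient.of _ (C A _ a))
    (hC₂ : ∀ a, ρ₂ (GaussQuotient.of _ (C A _ a)) = GaussQuotient.of _ (C A _ a))
    {b₁ : GaussQuotient A _ I₁} {b₂ : GaussQuotient A _ I₂} (hb : ρ₁ b₁ = ρ₂ b₂) :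
    ∃ a, GaussQuotient.of _ (C A _ a) = b₁ ∧ GaussQuotient.of _ (C A _ a) = b₂ := by
  -- the approximate solutions converge
  obtain ⟨K, hK, hKb⟩ := hA.exists_norm_le_max f q
  rw [← hI₁, ← hI₂] at hKb
  choose s hs₁ hs₂ using fun n : ℕ => 
    exists_approx_of_agree hI₁ hI₂ hJ ρ₁ ρ₂ hc h₁ h₂ hC₁ hC₂ hb (ε := 1 / 2 ^ n) (by positivity)
  have hlim : Tendsto (fun n : ℕ => (1 : ℝ) / 2 ^ n) atTop (𝓝 0) := by
    simpa using tendsto_pow_atTop_nhds_zero_of_lt_one (r := (1 / 2 : ℝ)) (by norm_num) (by norm_num)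
  have hcauchy : CauchySeq s := by
    refine cauchySeq_of_le_tendsto_0' (fun n => K * (1 / 2 ^ n)) (fun n m hnm => ?_)
      (by simpa using hlim.const_mul K)
    have hmn : (1 : ℝ) / 2 ^ m ≤ 1 / 2 ^ n := by gcongr; norm_num
    rw [dist_eq_norm]
    refine (hKb _).trans (mul_le_mul_of_nonneg_left (max_le ?_ ?_) hK)
    · have e : GaussQuotient.of I₁ (C A _ (s n - s m)) =
          (b₁ - GaussQuotient.of I₁ (C A _ (s m))) +
            -(b₁ - GaussQuotient.of I₁ (C A _ (s n))) := by
        rw [map_sub, map_sub]; ring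
      rw [e]
      refine (IsUltrametricDist.norm_add_le_max _ _).trans (max_le ((hs₁ m).trans hmn) ?_)
      rw [norm_neg]
      exact hs₁ n
    · have e : GaussQuotient.of I₂ (C A _ (s n - s m)) =
          (b₂ - GaussQuotient.of I₂ (C A _ (s m))) +
            -(b₂ - GaussQuotient.of I₂ (C A _ (s n))) := by
        rw [map_sub, map_sub]; ring
      rw [e]
      refine (IsUltrametricDist.norm_add_le_max _ _).trans (max_le ((hs₂ m).trans hmn) ?_)
      rw [norm_neg]
      exact hs₂ n
  obtain ⟨a, ha⟩ := cauchySeq_tendsto_of_complete hcauchy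
  have hcont₁ : Continuous fun a : A => GaussQuotient.of I₁ (C A _ a) :=
    AddMonoidHomClass.continuous_of_bound ((GaussQuotient.of I₁).comp (C A _)) 1 fun a => by
      rw [one_mul, ← norm_C (w := powersHom PosReal q) a]
      exact GaussQuotient.norm_of_le _
  have hcont₂ : Continuous fun a : A => GaussQuotient.of I₂ (C A _ a) :=
    AddMonoidHomClass.continuous_of_bound ((GaussQuotient.of I₂).comp (C A _)) 1 fun a => by
      rw [one_mul, ← norm_C (w := powersHom PosReal q⁻¹) a]
      exact GaussQuotient.norm_of_le _
  refine ⟨a, ?_, ?_⟩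
  · refine tendsto_nhds_unique ((hcont₁.tendsto a).comp ha) ?_
    refine tendsto_iff_norm_sub_tendsto_zero.2 (squeeze_zero (fun _ => norm_nonneg _) (fun n => ?_)
      hlim)
    rw [norm_sub_rev]
    exact hs₁ n
  · refine tendsto_nhds_unique ((hcont₂.tendsto a).comp ha) ?_
    refine tendsto_iff_norm_sub_tendsto_zero.2 (squeeze_zero (fun _ => norm_nonneg _) (fun n => ?_)
      hlim)
    rw [norm_sub_rev]
    exact hs₂ n

end Laurent

/-! ### Gauss extensions of reified semivaluations -/

/-- The algebra `A[ℝ⁺]`, whose element `a [r]` stands for `a` in degree `r`; its norm is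
`∑ aᵣ [r] ↦ max r⁻¹ |aᵣ|`. -/
abbrev DegreeAlgebra (A : Type u) [NormedCommRing A] : Type u :=
  GaussAlgebra A (invMonoidHom : PosReal →* PosReal)

namespace DegreeAlgebra

open GaussAlgebra

variable {A : Type u} [NormedCommRing A]

variable (A) in
/-- The element `a [r]`. -/
abbrev homog (r : PosReal) : A →+ DegreeAlgebra A := single A _ r

theorem homog_mul_homog (r s : PosReal) (a b : A) :
    homog A r a * homog A s b = homog A (r * s) (a * b) :=
  single_mul_single _ _ _ _

theorem homog_pow (r : PosReal) (a : A) (n : ℕ) : homog A r a ^ n = homog A (r ^ n) (a ^ n) := by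
  induction n with
  | zero => rw [pow_zero, pow_zero, pow_zero]; rfl
  | succ n ih => rw [pow_succ, ih, homog_mul_homog, ← pow_succ, ← pow_succ]

theorem coeff_mul (p q : DegreeAlgebra A) (k : PosReal) :
    coeff k (p * q) = ∑ r ∈ p.support, coeff r p * coeff (r⁻¹ * k) q := by
  conv_lhs => rw [← sum_single p, Finset.sum_mul, map_sum]
  exact Finset.sum_congr rfl fun r _ => coeff_single_mul _ _ _ _

end DegreeAlgebra

namespace ReifiedValuation

open GaussAlgebra DegreeAlgebra

variable {A : Type u} [NormedCommRing A] (v : ReifiedValuation A)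

/-- The term of degree `r` in the Gauss extension of `v`. -/
def gaussTerm (p : DegreeAlgebra A) (r : PosReal) : WithZero v.Γ :=
  v.val (coeff r p) * (v.reif r : WithZero v.Γ)⁻¹

theorem reif_ne_zero (r : PosReal) : (v.reif r : WithZero v.Γ) ≠ 0 := WithZero.coe_ne_zero

theorem gaussTerm_of_notMem {p : DegreeAlgebra A} {r : PosReal} (h : r ∉ p.support) :
    v.gaussTerm p r = 0 := by
  rw [mem_support, not_not] at h
  rw [gaussTerm, h, map_zero, zero_mul]

theorem gaussTerm_mul {p q : DegreeAlgebra A} (r k : PosReal) :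
    v.val (coeff r p * coeff (r⁻¹ * k) q) * (v.reif k : WithZero v.Γ)⁻¹ =
      v.gaussTerm p r * v.gaussTerm q (r⁻¹ * k) := by
  have h : v.reif k = v.reif r * v.reif (r⁻¹ * k) := by rw [← map_mul, mul_inv_cancel_left]
  rw [gaussTerm, gaussTerm, map_mul, h, WithZero.coe_mul, mul_inv, mul_mul_mul_comm]

/-- The function `∑ aᵣ [r] ↦ max v(aᵣ) r⁻¹`. -/
def gaussFun (p : DegreeAlgebra A) : WithZero v.Γ := p.support.sup (v.gaussTerm p)

theorem gaussFun_le_iff {p : DegreeAlgebra A} {c : WithZero v.Γ} :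
    v.gaussFun p ≤ c ↔ ∀ r, v.gaussTerm p r ≤ c := by
  rw [gaussFun, Finset.sup_le_iff]
  refine ⟨fun h r => ?_, fun h r _ => h r⟩
  by_cases hr : r ∈ p.support
  · exact h r hr
  · rw [v.gaussTerm_of_notMem hr]
    exact zero_le

theorem gaussTerm_le (p : DegreeAlgebra A) (r : PosReal) : v.gaussTerm p r ≤ v.gaussFun p :=
  v.gaussFun_le_iff.1 le_rfl r

/-- The largest degree in which the Gauss extension is attained. -/
theorem exists_gaussTerm_eq {p : DegreeAlgebra A} (hp : v.gaussFun p ≠ 0) :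
    ∃ r, v.gaussTerm p r = v.gaussFun p ∧ ∀ s, r < s → v.gaussTerm p s < v.gaussFun p := by
  have hne : p.support.Nonempty := by
    by_contra h
    rw [Finset.not_nonempty_iff_eq_empty] at h
    exact hp (by rw [gaussFun, h, Finset.sup_empty]; rfl)
  obtain ⟨r₀, hr₀, h₀⟩ := Finset.exists_mem_eq_sup _ hne (v.gaussTerm p)
  set F := p.support.filter fun r => v.gaussTerm p r = v.gaussFun p
  have hF : F.Nonempty := ⟨r₀, Finset.mem_filter.2 ⟨hr₀, h₀.symm⟩⟩
  refine ⟨F.max' hF, (Finset.mem_filter.1 (F.max'_mem hF)).2, fun s hs => ?_⟩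
  refine lt_of_le_of_ne (v.gaussTerm_le p s) fun h => ?_
  have hmem : s ∈ F := by
    refine Finset.mem_filter.2 ⟨?_, h⟩
    by_contra hsp
    exact hp (by rw [← h, v.gaussTerm_of_notMem hsp])
  exact absurd (F.le_max' s hmem) (not_le.2 hs)

theorem gaussFun_mul_le (p q : DegreeAlgebra A) :
    v.gaussFun (p * q) ≤ v.gaussFun p * v.gaussFun q := by
  rw [gaussFun_le_iff]
  intro k
  rw [gaussTerm, coeff_mul, mul_inv_le_iff₀ (zero_lt_iff.2 (v.reif_ne_zero k))]
  refine Valuation.map_sum_le v.val fun r _ => ?_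
  rw [← mul_inv_le_iff₀ (zero_lt_iff.2 (v.reif_ne_zero k)), gaussTerm_mul]
  exact mul_le_mul' (v.gaussTerm_le p r) (v.gaussTerm_le q _)

/-- Multiplicativity of the Gauss extension, by comparison of the largest degrees in which it is
attained. -/
theorem gaussFun_mul (p q : DegreeAlgebra A) :
    v.gaussFun (p * q) = v.gaussFun p * v.gaussFun q := by
  refine le_antisymm (v.gaussFun_mul_le p q) ?_
  by_cases hp : v.gaussFun p = 0
  · rw [hp, zero_mul]; exact zero_le
  by_cases hq : v.gaussFun q = 0
  · rw [hq, mul_zero]; exact zero_le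
  obtain ⟨r, hr, hr'⟩ := v.exists_gaussTerm_eq hp
  obtain ⟨s, hs, hs'⟩ := v.exists_gaussTerm_eq hq
  -- in degree `r s`, the product of the leading terms dominates all other products
  have hlead : v.val (coeff r p * coeff s q) * (v.reif (r * s) : WithZero v.Γ)⁻¹ =
      v.gaussFun p * v.gaussFun q := by
    have := v.gaussTerm_mul (p := p) (q := q) r (r * s)
    rwa [inv_mul_cancel_left, hr, hs] at this
  have hreif := zero_lt_iff.2 (v.reif_ne_zero (r * s))
  have hrp : r ∈ p.support := by
    by_contra h
    exact hp (by rw [← hr, v.gaussTerm_of_notMem h])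
  have hne : v.val (coeff r p * coeff s q) ≠ 0 := by
    intro h
    rw [h, zero_mul] at hlead
    exact (mul_ne_zero hp hq) hlead.symm
  refine le_trans (le_of_eq ?_) (v.gaussTerm_le (p * q) (r * s))
  rw [gaussTerm, coeff_mul, ← Finset.add_sum_erase _ _ hrp, inv_mul_cancel_left,
    Valuation.map_add_eq_of_lt_left, hlead]
  refine Valuation.map_sum_lt v.val hne fun t ht => ?_
  have htr : t ≠ r := Finset.ne_of_mem_erase ht
  rw [← mul_lt_mul_iff_left₀ (inv_pos.2 hreif), hlead, gaussTerm_mul]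
  rcases lt_or_gt_of_ne htr with h | h
  · refine mul_lt_mul_of_le_of_lt_of_nonneg_of_pos (v.gaussTerm_le p t) (hs' _ ?_) zero_le
      (zero_lt_iff.2 hp)
    rw [lt_inv_mul_iff_mul_lt]
    exact mul_lt_mul_left h s
  · exact mul_lt_mul_of_lt_of_le_of_nonneg_of_pos (hr' _ h) (v.gaussTerm_le q _) zero_le
      (zero_lt_iff.2 hq)

theorem gaussFun_homog (r : PosReal) (a : A) :
    v.gaussFun (homog A r a) = v.val a * (v.reif r : WithZero v.Γ)⁻¹ := by
  refine le_antisymm (v.gaussFun_le_iff.2 fun s => ?_) ?_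
  · rw [gaussTerm, coeff_single]
    split_ifs with h
    · rw [h]
    · rw [map_zero, zero_mul]
      exact zero_le
  · refine le_trans (le_of_eq ?_) (v.gaussTerm_le _ r)
    rw [gaussTerm, coeff_single_same]

/-- The Gauss extension of `v` to `A[ℝ⁺]`, which takes the value `r⁻¹` on `[r]`. -/
def gauss : Valuation (DegreeAlgebra A) (WithZero v.Γ) where
  toFun := v.gaussFun
  map_zero' := by
    rw [← map_zero (homog A 1), gaussFun_homog, map_zero, zero_mul]
  map_one' := by
    rw [one_def, v.gaussFun_homog 1 1, map_one, map_one, WithZero.coe_one, inv_one, one_mul]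
  map_mul' := v.gaussFun_mul
  map_add_le_max' p q := by
    rw [gaussFun_le_iff]
    intro r
    rw [gaussTerm, map_add, mul_inv_le_iff₀ (zero_lt_iff.2 (v.reif_ne_zero r))]
    refine (Valuation.map_add v.val _ _).trans (max_le ?_ ?_)
    · rw [← mul_inv_le_iff₀ (zero_lt_iff.2 (v.reif_ne_zero r))]
      exact (v.gaussTerm_le p r).trans (le_max_left _ _)
    · rw [← mul_inv_le_iff₀ (zero_lt_iff.2 (v.reif_ne_zero r))]
      exact (v.gaussTerm_le q r).trans (le_max_right _ _)

theorem gauss_homog (r : PosReal) (a : A) :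
    v.gauss (homog A r a) = v.val a * (v.reif r : WithZero v.Γ)⁻¹ := v.gaussFun_homog r a

theorem gauss_le_one_iff {p : DegreeAlgebra A} :
    v.gauss p ≤ 1 ↔ ∀ r, v.Le (coeff r p) r 1 := by
  refine v.gaussFun_le_iff.trans (forall_congr' fun r => ?_)
  rw [gaussTerm, mul_inv_le_iff₀ (zero_lt_iff.2 (v.reif_ne_zero r)), one_mul, Le, map_one, mul_one]

theorem gauss_homog_le_iff (q s : PosReal) (a b : A) :
    v.gauss (homog A q a) ≤ v.gauss (homog A s b) ↔ v.Le a (q * s⁻¹) b := by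
  rw [gauss_homog, gauss_homog, mul_inv_le_iff₀ (zero_lt_iff.2 (v.reif_ne_zero q)), Le, map_mul,
    map_inv, WithZero.coe_mul, WithZero.coe_inv, mul_right_comm, mul_comm (v.val b),
    mul_right_comm]

end ReifiedValuation

/-! ### Points of the reified valuative spectrum from valuations on `A[ℝ⁺]` -/

section Specialization

open GaussAlgebra DegreeAlgebra

variable {A : Type u} [NormedCommRing A]

/-- A valuation on `A[ℝ⁺]` which is less than `1` on `[t]` for `t > 1`, and for which all elements
of `A` are bounded by real numbers, induces a reified semivaluation on `A` with values comparable to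
real numbers: the infinitesimal values are replaced by `0`. -/
theorem exists_reifiedValuation {Γ : Type u} [CommGroup Γ] [LinearOrder Γ] [IsOrderedMonoid Γ]
    (W : Valuation (DegreeAlgebra A) (WithZero Γ)) (hlt : ∀ t, 1 < t → W (homog A t 1) < 1)
    (hbd : ∀ a, ∃ r, W (homog A r a) ≤ 1) :
    ∃ v : ReifiedValuation A, v.IsCoinitial ∧ (∀ a q, v.Le a q 1 ↔ W (homog A q a) ≤ 1) ∧
      (∀ a q b, v.Le a q b → v.val b ≠ 0 → W (homog A q a) ≤ W (homog A 1 b) ∧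
        ∃ r, 1 ≤ W (homog A r b)) ∧ ∀ a, W (homog A 1 a) = 0 → v.val a = 0 := by
  let reif : PosReal →* Γ := (WithZero.unitsWithZeroEquiv.toMonoidHom.comp
    ((Units.map W.toMonoidWithZeroHom.toMonoidHom).comp
      (Units.map (T A _)))).comp ((toUnits : PosReal ≃* PosRealˣ).toMonoidHom.comp invMonoidHom)
  have hreif : ∀ q, (reif q : WithZero Γ) = W (homog A q⁻¹ 1) := fun q => by
    change ((WithZero.unitsWithZeroEquiv _ : Γ) : WithZero Γ) = _
    rw [WithZero.coe_unitsWithZeroEquiv_eq_units_val]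
    rfl
  have hhom : ∀ q a, W (homog A q a) = (reif q : WithZero Γ)⁻¹ * W (homog A 1 a) := fun q a => by
    rw [← WithZero.coe_inv, ← map_inv, hreif, inv_inv, ← map_mul, homog_mul_homog, mul_one, one_mul]
  have hpos : ∀ q, (0 : WithZero Γ) < reif q := fun q => WithZero.zero_lt_coe _
  have hmono : StrictMono reif := by
    intro q s hqs
    have h1 := hlt (s * q⁻¹) (by rwa [← div_eq_mul_inv, one_lt_div'])
    have h2 := hreif (q * s⁻¹)
    rw [mul_inv, inv_inv, mul_comm q⁻¹] at h2
    rw [← h2, map_mul, map_inv, ← WithZero.coe_one, WithZero.coe_lt_coe, ← div_eq_mul_inv,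
      div_lt_one'] at h1
    exact h1
  let fin : A → Prop := fun a => ∃ r, (reif r : WithZero Γ) ≤ W (homog A 1 a)
  have hup : ∀ a, ∃ r, W (homog A 1 a) ≤ reif r := fun a => by
    obtain ⟨r, hr⟩ := hbd a
    refine ⟨r, ?_⟩
    rwa [hhom, inv_mul_le_iff₀ (hpos r), mul_one] at hr
  have hmul : ∀ a b, W (homog A 1 (a * b)) = W (homog A 1 a) * W (homog A 1 b) := fun a b => by
    rw [← map_mul, homog_mul_homog, one_mul]
  have hfin_left : ∀ a b, fin (a * b) → fin a := by
    rintro a b ⟨r, hr⟩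
    obtain ⟨s, hs⟩ := hup b
    refine ⟨r * s⁻¹, ?_⟩
    rw [map_mul, map_inv, WithZero.coe_mul, WithZero.coe_inv, mul_inv_le_iff₀ (hpos s)]
    rw [hmul] at hr
    exact hr.trans (mul_le_mul_right hs _)
  have hfin_mul : ∀ a b, fin a → fin b → fin (a * b) := by
    rintro a b ⟨r, hr⟩ ⟨s, hs⟩
    refine ⟨r * s, ?_⟩
    rw [map_mul, WithZero.coe_mul, hmul]
    exact mul_le_mul' hr hs
  have hone : W (homog A 1 1) = 1 := map_one W
  have hfin_one : fin 1 := ⟨1, by rw [hone, map_one, WithZero.coe_one]⟩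
  classical
  let val : Valuation A (WithZero Γ) :=
    { toFun := fun a => if fin a then W (homog A 1 a) else 0
      map_zero' := by
        rw [map_zero, map_zero, ite_self]
      map_one' := by rw [if_pos hfin_one, hone]
      map_mul' := fun a b => by
        by_cases ha : fin a
        · by_cases hb : fin b
          · rw [if_pos ha, if_pos hb, if_pos (hfin_mul a b ha hb), hmul]
          · rw [if_neg hb, mul_zero, if_neg]
            exact fun h => hb (hfin_left b a (mul_comm a b ▸ h))
        · rw [if_neg ha, zero_mul, if_neg]
          exact fun h => ha (hfin_left a b h)
      map_add_le_max' := fun a b => by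
        by_cases hab : fin (a + b)
        · rw [if_pos hab, map_add]
          obtain ⟨r, hr⟩ := hab
          rw [map_add] at hr
          have h1 := Valuation.map_add W (homog A 1 a) (homog A 1 b)
          rcases le_total (W (homog A 1 a)) (W (homog A 1 b)) with h | h
          · rw [max_eq_right h] at h1
            rw [if_pos (show fin b from ⟨r, hr.trans h1⟩)]
            exact h1.trans (le_max_right _ _)
          · rw [max_eq_left h] at h1
            rw [if_pos (show fin a from ⟨r, hr.trans h1⟩)]
            exact h1.trans (le_max_left _ _)
        · rw [if_neg hab]
          exact zero_le }
  have hval : ∀ a, val a = if fin a then W (homog A 1 a) else 0 := fun a => rfl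
  have hval_le : ∀ a, val a ≤ W (homog A 1 a) := fun a => by
    rw [hval]
    split_ifs
    · exact le_rfl
    · exact zero_le
  have hval_ne : ∀ a, val a ≠ 0 → fin a ∧ val a = W (homog A 1 a) := fun a ha => by
    rw [hval] at ha ⊢
    split_ifs at ha ⊢ with h
    · exact ⟨h, rfl⟩
    · exact absurd rfl ha
  refine ⟨{ Γ := Γ, val := val, reif := reif, reif_strictMono := hmono }, ?_, ?_, ?_, ?_⟩
  · -- the elements of `Γ` between two real numbers form a subgroup
    let H : Subgroup Γ :=
      { carrier := {γ | ∃ r s, reif r ≤ γ ∧ γ ≤ reif s}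
        one_mem' := ⟨1, 1, by rw [map_one], by rw [map_one]⟩
        mul_mem' := by
          rintro γ δ ⟨r, s, h1, h2⟩ ⟨r', s', h3, h4⟩
          exact ⟨r * r', s * s', by rw [map_mul]; exact mul_le_mul' h1 h3,
            by rw [map_mul]; exact mul_le_mul' h2 h4⟩
        inv_mem' := by
          rintro γ ⟨r, s, h1, h2⟩
          exact ⟨s⁻¹, r⁻¹, by rw [map_inv]; exact inv_le_inv' h2,
            by rw [map_inv]; exact inv_le_inv' h1⟩ }
    intro γ hγ
    have hH : γ ∈ H := by
      refine (Subgroup.closure_le H).2 ?_ hγ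
      rintro δ (⟨q, rfl⟩ | ⟨a, ha⟩)
      · exact ⟨q, q, le_rfl, le_rfl⟩
      · change val a = (δ : WithZero Γ) at ha
        obtain ⟨⟨r, hr⟩, h2⟩ := hval_ne a (by rw [ha]; exact WithZero.coe_ne_zero)
        obtain ⟨s, hs⟩ := hup a
        rw [← h2, ha, WithZero.coe_le_coe] at hr hs
        exact ⟨r, s, hr, hs⟩
    obtain ⟨r, -, h, -⟩ := hH
    exact ⟨r, h⟩
  · intro a q
    change val a ≤ (reif q : WithZero Γ) * val 1 ↔ _
    rw [map_one, mul_one, hhom, inv_mul_le_iff₀ (hpos q), mul_one]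
    refine ⟨fun h => ?_, fun h => (hval_le a).trans h⟩
    by_cases ha : fin a
    · rwa [hval, if_pos ha] at h
    · exact (not_le.1 fun hc => ha ⟨q, hc⟩).le
  · intro a q b h hb
    change val a ≤ (reif q : WithZero Γ) * val b at h
    obtain ⟨⟨r, hr⟩, hb'⟩ := hval_ne b hb
    refine ⟨?_, r, ?_⟩
    · rw [hhom, inv_mul_le_iff₀ (hpos q)]
      by_cases ha : fin a
      · rwa [hval a, if_pos ha, hb'] at h
      · have h1 : W (homog A 1 a) ≤ reif (q * r) := (not_le.1 fun hc => ha ⟨_, hc⟩).le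
        rw [map_mul, WithZero.coe_mul] at h1
        exact h1.trans (mul_le_mul_right hr _)
    · rw [hhom, le_inv_mul_iff₀ (hpos r), mul_one]
      exact hr
  · intro a ha
    exact le_antisymm ((hval_le a).trans_eq ha) zero_le

/-- The same with an arbitrary value group. -/
theorem exists_sprv {Γ₀ : Type u} [LinearOrderedCommGroupWithZero Γ₀]
    (W : Valuation (DegreeAlgebra A) Γ₀) (hlt : ∀ t, 1 < t → W (homog A t 1) < 1)
    (hbd : ∀ a, ∃ r, W (homog A r a) ≤ 1) :
    ∃ x : Sprv A, x.IsCoinitial ∧ (∀ a q, x.Le a q 1 ↔ W (homog A q a) ≤ 1) ∧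
      (∀ a q b, x.Le a q b → ¬ x.EqZero b → W (homog A q a) ≤ W (homog A 1 b) ∧
        ∃ r, 1 ≤ W (homog A r b)) ∧ ∀ a, W (homog A 1 a) = 0 → x.EqZero a := by
  let e : WithZero Γ₀ˣ ≃*o Γ₀ := OrderMonoidIso.withZeroUnits
  have hmono : Monotone e.symm := fun a b h => (map_le_map_iff e.symm).2 h
  let W' : Valuation (DegreeAlgebra A) (WithZero Γ₀ˣ) :=
    W.map (MonoidWithZeroHom.ofClass e.symm) hmono
  have hle : ∀ p q, W' p ≤ W' q ↔ W p ≤ W q := fun p q => map_le_map_iff e.symm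
  have hle1 : ∀ p, W' p ≤ 1 ↔ W p ≤ 1 := fun p => by
    rw [← map_one W', hle, map_one]
  have hge1 : ∀ p, 1 ≤ W' p ↔ 1 ≤ W p := fun p => by
    rw [← map_one W', hle, map_one]
  obtain ⟨v, h1, h2, h3, h4⟩ := exists_reifiedValuation W'
    (fun t ht => by rw [← not_le, hge1, not_le]; exact hlt t ht)
    (fun a => by simpa only [hle1] using hbd a)
  simp only [hle, hle1, hge1] at h2 h3
  refine ⟨Quotient.mk _ v, h1, h2, h3, fun a ha => h4 a ?_⟩
  have h5 : W' (homog A 1 a) ≤ W' 0 := by rw [hle, ha]; exact zero_le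
  rw [map_zero] at h5
  exact le_antisymm h5 zero_le

end Specialization

/-- If no monic polynomial over a subring `S` takes a value in the ideal `J` at `x`, then some
valuation is at most `1` on `S`, zero on `J` and greater than `1` at `x`. -/
theorem exists_valuation_of_monic_notMem {R : Type u} [CommRing R] (S : Subring R) (J : Ideal R)
    (x : R) (hx : ∀ f : Polynomial S, f.Monic → f.eval₂ S.subtype x ∉ J) :
    ∃ (Γ₀ : Type u) (_ : LinearOrderedCommGroupWithZero Γ₀) (W : Valuation R Γ₀),
      (∀ s ∈ S, W s ≤ 1) ∧ (∀ j ∈ J, W j = 0) ∧ 1 < W x := by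
  let M : Submonoid R :=
    { carrier := {y | ∃ f : Polynomial S, f.Monic ∧ f.eval₂ S.subtype x = y}
      one_mem' := ⟨1, Polynomial.monic_one, Polynomial.eval₂_one _ _⟩
      mul_mem' := by
        rintro _ _ ⟨f, hf, rfl⟩ ⟨g, hg, rfl⟩
        exact ⟨f * g, hf.mul hg, Polynomial.eval₂_mul _ _⟩ }
  obtain ⟨Q, hQ, hJQ, hQM⟩ := Ideal.exists_le_prime_disjoint J M (Set.disjoint_left.2 (by
    rintro _ hj ⟨f, hf, rfl⟩
    exact hx f hf hj))
  let K := FractionRing (R ⧸ Q)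
  let φ : R →+* K := (algebraMap (R ⧸ Q) K).comp (Ideal.Quotient.mk Q)
  have hφ : ∀ y, φ y = 0 → y ∈ Q := fun y hy =>
    Ideal.Quotient.eq_zero_iff_mem.1 ((map_eq_zero_iff _ (IsFractionRing.injective (R ⧸ Q) K)).1 hy)
  have hnot : φ x ∉ (⨅ V : {V : ValuationSubring K // (S.map φ : Set K) ⊆ V.toSubring},
      V.1.toSubring) := by
    rw [iInf_valuationSubring_superset]
    rintro ⟨f, hf, hfx⟩
    -- lift the monic equation to `S`
    let ψ : S →+* Subring.closure (S.map φ : Set K) :=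
      (φ.comp S.subtype).codRestrict _ fun s => Subring.subset_closure ⟨s, s.2, rfl⟩
    have hψ : Function.Surjective ψ := by
      rintro ⟨y, hy⟩
      rw [Subring.closure_eq] at hy
      obtain ⟨s, hs, rfl⟩ := hy
      exact ⟨⟨s, hs⟩, rfl⟩
    have hlift : f ∈ Polynomial.lifts ψ := by
      rw [Polynomial.lifts_iff_coeff_lifts]
      exact fun n => hψ _
    obtain ⟨g, hgf, -, hg⟩ := Polynomial.lifts_and_natDegree_eq_and_monic hlift hf
    have h1 : φ (g.eval₂ S.subtype x) = 0 := by
      rw [Polynomial.hom_eval₂]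
      rw [← hgf, Polynomial.eval₂_map] at hfx
      exact hfx
    exact Set.disjoint_left.1 hQM (hφ _ h1) ⟨g, hg, rfl⟩
  simp only [Subring.mem_iInf, not_forall] at hnot
  obtain ⟨⟨V, hV⟩, hxV⟩ := hnot
  refine ⟨V.ValueGroup, inferInstance, V.valuation.comap φ, fun s hs => ?_, fun j hj => ?_, ?_⟩
  · exact (V.valuation_le_one_iff _).2 (hV ⟨s, hs, rfl⟩)
  · change V.valuation (φ j) = 0
    have : φ j = 0 := by
      change algebraMap _ K (Ideal.Quotient.mk Q j) = 0
      rw [Ideal.Quotient.eq_zero_iff_mem.2 (hJQ hj), map_zero]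
    rw [this, map_zero]
  · rw [← not_le]
    exact fun h => hxV ((V.valuation_le_one_iff _).1 h)

/-! ### Power-bounded elements and integrality -/

section PowerBounded

variable {R : Type*} [NormedCommRing R] [IsUltrametricDist R]

theorem exists_norm_le_of_mem_submonoid_closure (F : Set R) (hF : F.Finite)
    (h : ∀ a ∈ F, ∃ C : ℝ, ∀ n : ℕ, ‖a ^ n‖ ≤ C) :
    ∃ C : ℝ, 0 ≤ C ∧ ∀ m ∈ Submonoid.closure F, ‖m‖ ≤ C := by
  induction F, hF using Set.Finite.induction_on with
  | empty =>
    refine ⟨‖(1 : R)‖, norm_nonneg _, fun m hm => ?_⟩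
    rw [Submonoid.closure_empty, Submonoid.mem_bot] at hm
    rw [hm]
  | @insert a F _ _ ih =>
    obtain ⟨C, hC, hCF⟩ := ih fun b hb => h b (Set.mem_insert_of_mem _ hb)
    obtain ⟨D, hD⟩ := h a (Set.mem_insert _ _)
    have hD0 : 0 ≤ D := (norm_nonneg _).trans (hD 0)
    refine ⟨D * C, mul_nonneg hD0 hC, fun m hm => ?_⟩
    rw [Set.insert_eq, Submonoid.closure_union, Submonoid.mem_sup] at hm
    obtain ⟨y, hy, z, hz, rfl⟩ := hm
    obtain ⟨n, rfl⟩ := Submonoid.mem_closure_singleton.1 hy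
    exact (norm_mul_le _ _).trans (mul_le_mul (hD n) (hCF z hz) (norm_nonneg _) hD0)

/-- Finitely many power-bounded elements generate a bounded subring. -/
theorem exists_norm_le_of_mem_subring_closure (F : Set R) (hF : F.Finite)
    (h : ∀ a ∈ F, ∃ C : ℝ, ∀ n : ℕ, ‖a ^ n‖ ≤ C) :
    ∃ C : ℝ, 0 ≤ C ∧ ∀ m ∈ Subring.closure F, ‖m‖ ≤ C := by
  obtain ⟨C, hC, hCF⟩ := exists_norm_le_of_mem_submonoid_closure F hF h
  refine ⟨C, hC, fun m hm => ?_⟩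
  rw [Subring.mem_closure_iff] at hm
  induction hm using AddSubgroup.closure_induction with
  | mem x hx => exact hCF x hx
  | zero => rw [norm_zero]; exact hC
  | add x y _ _ hx hy => exact (IsUltrametricDist.norm_add_le_max _ _).trans (max_le hx hy)
  | neg x _ hx => rwa [norm_neg]

/-- An element integral over a ring of power-bounded elements is power-bounded. -/
theorem exists_norm_pow_le_of_isIntegral (S : Subring R)
    (hS : ∀ a ∈ S, ∃ C : ℝ, ∀ n : ℕ, ‖a ^ n‖ ≤ C) {x : R} (hx : IsIntegral S x) :
    ∃ C : ℝ, ∀ n : ℕ, ‖x ^ n‖ ≤ C := by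
  -- only finitely many coefficients occur: they generate a bounded subring `E`, over which the powers
  -- of `x` lie in a finitely generated module
  obtain ⟨p, hp, hpx⟩ := hx
  set p' : Polynomial R := p.map S.subtype
  set F : Set R := Set.range fun i : Fin (p'.natDegree + 1) => p'.coeff i with hFdef
  obtain ⟨C, hC, hCF⟩ := exists_norm_le_of_mem_subring_closure F (Set.finite_range _) (by
    rintro _ ⟨i, rfl⟩
    refine hS _ ?_
    simp only [p', Polynomial.coeff_map]
    exact (p.coeff i).2)
  set E := Subring.closure F
  have hcoeff : ∀ n, p'.coeff n ∈ E := fun n => by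
    rcases lt_or_ge n (p'.natDegree + 1) with h | h
    · exact Subring.subset_closure ⟨⟨n, h⟩, rfl⟩
    · rw [Polynomial.coeff_eq_zero_of_natDegree_lt h]
      exact E.zero_mem
  have hsub : (p'.coeffs : Set R) ⊆ E := fun a ha => by
    obtain ⟨n, -, rfl⟩ := Polynomial.mem_coeffs_iff.1 ha
    exact hcoeff n
  have hxE : IsIntegral E x := by
    refine ⟨p'.toSubring E hsub, (Polynomial.monic_toSubring _ _ _).2 (hp.map _), ?_⟩
    have h1 : (p'.toSubring E hsub).map (algebraMap E R) = p' := Polynomial.map_toSubring _ _ _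
    rw [← Polynomial.eval_map, h1, Polynomial.eval_map]
    exact hpx
  obtain ⟨gens, hgens⟩ := hxE.fg_adjoin_singleton
  obtain ⟨D, hD⟩ : ∃ D : ℝ, ∀ g ∈ gens, ‖g‖ ≤ D := by
    obtain ⟨D, hD⟩ := (gens.finite_toSet.image norm).bddAbove
    exact ⟨D, fun g hg => hD ⟨g, hg, rfl⟩⟩
  refine ⟨C * max D 0, fun n => ?_⟩
  have hmem : x ^ n ∈ Submodule.span E (gens : Set R) := by
    rw [hgens]
    exact pow_mem (Algebra.self_mem_adjoin_singleton E x) n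
  obtain ⟨f, -, hf⟩ := Submodule.mem_span_finset.1 hmem
  rw [← hf]
  refine IsUltrametricDist.norm_sum_le_of_forall_le_of_nonneg
    (mul_nonneg hC (le_max_right _ _)) fun g hg => ?_
  calc ‖f g • g‖ = ‖(f g : R) * g‖ := rfl
    _ ≤ ‖(f g : R)‖ * ‖g‖ := norm_mul_le _ _
    _ ≤ C * max D 0 := mul_le_mul (hCF _ (f g).2) ((hD g hg).trans (le_max_left _ _))
      (norm_nonneg _) hC

end PowerBounded

section Nilpotent

variable {A : Type u} [NormedCommRing A]

theorem norm_pow_le_mul_pow (a : A) (n : ℕ) : ‖a ^ n‖ ≤ max 1 ‖(1 : A)‖ * ‖a‖ ^ n := by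
  rcases Nat.eq_zero_or_pos n with rfl | hn
  · simp
  · refine (norm_pow_le' a hn).trans ?_
    exact le_mul_of_one_le_left (by positivity) (le_max_left _ _)

theorem isTopNilpotent_of_norm_lt {r : PosReal} {a : A} (h : ‖a‖ < r) : IsTopNilpotent r a := by
  have hr : (0 : ℝ) < r := r.2
  have h0 : Tendsto (fun n : ℕ => max 1 ‖(1 : A)‖ * (‖a‖ / r) ^ n) atTop (𝓝 0) := by
    simpa using (tendsto_pow_atTop_nhds_zero_of_lt_one (by positivity)
      ((div_lt_one hr).2 h)).const_mul (max 1 ‖(1 : A)‖)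
  refine squeeze_zero (fun n => scaledNorm_nonneg r a n) (fun n => ?_) h0
  calc ((r : ℝ) ^ n)⁻¹ * ‖a ^ n‖ ≤ ((r : ℝ) ^ n)⁻¹ * (max 1 ‖(1 : A)‖ * ‖a‖ ^ n) := by
        gcongr
        exact norm_pow_le_mul_pow a n
    _ = _ := by rw [div_pow]; field_simp

theorem isTopNilpotent_one {t : PosReal} (ht : 1 < t) : IsTopNilpotent t (1 : A) := by
  have ht' : (1 : ℝ) < t := ht
  have h0 : Tendsto (fun n : ℕ => ((t : ℝ)⁻¹) ^ n * ‖(1 : A)‖) atTop (𝓝 0) := by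
    simpa using (tendsto_pow_atTop_nhds_zero_of_lt_one (by positivity)
      (inv_lt_one_of_one_lt₀ ht')).mul_const ‖(1 : A)‖
  refine h0.congr fun n => ?_
  rw [one_pow, inv_pow]

theorem IsPowBounded.isTopNilpotent_of_lt {r s : PosReal} {a : A} (h : IsPowBounded r a)
    (hrs : r < s) : IsTopNilpotent s a := by
  have h1 := h.mul_isTopNilpotent (isTopNilpotent_one (A := A) (t := r⁻¹ * s)
    (by rwa [lt_inv_mul_iff_mul_lt, mul_one]))
  rwa [mul_inv_cancel_left, mul_one] at h1

theorem isUnit_one_add_of_isTopNilpotent [CompleteSpace A] {e : A} (h : IsTopNilpotent 1 e) :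
    IsUnit (1 + e) := by
  have h' : Tendsto (fun n : ℕ => ‖(-e) ^ n‖) atTop (𝓝 0) := by
    refine h.neg.congr fun n => ?_
    simp
  obtain ⟨n, hn⟩ := ((tendsto_order.1 h').2 1 one_pos).exists
  have h1 := one_sub_dvd_one_sub_pow (-e) n
  rw [sub_neg_eq_add] at h1
  exact isUnit_of_dvd_unit h1 (isUnit_one_sub_of_norm_lt_one hn)

end Nilpotent

/-! ### The ring `Gr A` as a quotient of a subring of `A[ℝ⁺]` -/

section ToGr

open GaussAlgebra DegreeAlgebra

variable {A : Type u} [NormedCommRing A] [IsUltrametricDist A]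

theorem grOf_mul (r s : PosReal) (a : powBounded A r) (b : powBounded A s) :
    grOf r a * grOf s b = grOf (r * s) ⟨(a : A) * b, IsPowBounded.mul a.2 b.2⟩ :=
  DirectSum.of_mul_of _ _

theorem grOf_eq_zero {r : PosReal} {a : powBounded A r} (h : IsTopNilpotent r (a : A)) :
    grOf r a = 0 := by
  have h0 : grMk (r := Additive.ofMul r) a = 0 := by
    refine (grMk_eq_iff (r := Additive.ofMul r) (b := 0)).2 ?_
    rw [AddSubgroup.coe_zero, zero_sub]
    exact h.neg
  rw [grOf, h0, map_zero]

theorem grOf_one : grOf (1 : PosReal) ⟨(1 : A), isPowBounded_one⟩ = 1 := rfl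

variable (A) in
/-- The subring of `A[ℝ⁺]` of the elements whose components are power-bounded in their degrees. -/
def boundedSubring : Subring (DegreeAlgebra A) where
  carrier := {p | ∀ r, coeff r p ∈ powBounded A r}
  zero_mem' r := by rw [map_zero]; exact zero_mem _
  one_mem' r := by
    rw [one_def, coeff_single]
    split_ifs with h
    · subst h
      exact isPowBounded_one
    · exact zero_mem _
  add_mem' hp hq r := by rw [map_add]; exact add_mem (hp r) (hq r)
  neg_mem' hp r := by rw [map_neg]; exact neg_mem (hp r)
  mul_mem' {p q} hp hq r := by
    rw [coeff_mul]
    refine sum_mem fun s _ => ?_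
    have := IsPowBounded.mul (hp s) (hq (s⁻¹ * r))
    rwa [mul_inv_cancel_left] at this

theorem homog_mem_boundedSubring {r : PosReal} {a : A} :
    homog A r a ∈ boundedSubring A ↔ IsPowBounded r a := by
  refine ⟨fun h => ?_, fun h s => ?_⟩
  · have := h r
    rwa [coeff_single_same] at this
  · rw [coeff_single]
    split_ifs with hrs
    · subst hrs
      exact h
    · exact zero_mem _

theorem mk_grMk_coeff_apply (p : boundedSubring A) (r : Additive PosReal) :
    (DirectSum.mk (GrPiece A) (p.1.support.map Additive.ofMul.toEmbedding)
      fun r => grMk ⟨coeff r.1.toMul p.1, p.2 _⟩) r = grMk ⟨coeff r.toMul p.1, p.2 r.toMul⟩ := by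
  by_cases hr : r ∈ p.1.support.map Additive.ofMul.toEmbedding
  · rw [DirectSum.mk_apply_of_mem hr]
  · rw [DirectSum.mk_apply_of_notMem hr]
    have h0 : coeff r.toMul p.1 = 0 := by
      by_contra h
      exact hr (Finset.mem_map.2 ⟨r.toMul, mem_support.2 h, rfl⟩)
    refine (congrArg grMk (Subtype.ext (?_ : (0 : A) = _)) : grMk (0 : powBounded A r.toMul) = _)
    exact h0.symm

/-- The underlying additive map of `toGr`. -/
def toGrAux : boundedSubring A →+ Gr A where
  toFun p := DirectSum.mk (GrPiece A) (p.1.support.map Additive.ofMul.toEmbedding)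
    fun r => grMk ⟨coeff r.1.toMul p.1, p.2 _⟩
  map_zero' := by
    refine DFinsupp.ext fun r => ?_
    rw [DirectSum.mk_apply_of_notMem]
    · rfl
    · rw [Finset.mem_map]
      rintro ⟨s, hs, -⟩
      exact mem_support.1 hs (map_zero _)
  map_add' p q := by
    refine DFinsupp.ext fun r => ?_
    rw [DirectSum.add_apply, mk_grMk_coeff_apply, mk_grMk_coeff_apply, mk_grMk_coeff_apply,
      grMk_add]
    exact congrArg grMk (Subtype.ext (map_add _ _ _))

theorem toGrAux_apply (p : boundedSubring A) (r : Additive PosReal) :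
    toGrAux p r = grMk ⟨coeff r.toMul p.1, p.2 r.toMul⟩ := mk_grMk_coeff_apply p r

theorem toGrAux_homog {r : PosReal} {a : A} (h : IsPowBounded r a) :
    toGrAux ⟨homog A r a, homog_mem_boundedSubring.2 h⟩ = grOf r ⟨a, h⟩ := by
  refine DFinsupp.ext fun s => ?_
  rw [toGrAux_apply, grOf]
  by_cases hrs : Additive.ofMul r = s
  · subst hrs
    rw [DirectSum.of_eq_same]
    exact congrArg grMk (Subtype.ext (coeff_single_same r a))
  · rw [DirectSum.of_eq_of_ne _ _ _ (Ne.symm hrs)]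
    refine (congrArg grMk (Subtype.ext ?_) : _ = grMk (0 : powBounded A s.toMul))
    change coeff s.toMul (homog A r a) = 0
    rw [coeff_single, if_neg]
    exact fun h => hrs h

theorem boundedSubring_eq_sum (p : boundedSubring A) :
    p = ∑ r ∈ p.1.support, ⟨homog A r (coeff r p.1), homog_mem_boundedSubring.2 (p.2 r)⟩ := by
  refine Subtype.ext ?_
  rw [AddSubmonoidClass.coe_finsetSum]
  exact (sum_single p.1).symm

/-- The canonical map from the ring of power-bounded elements of `A[ℝ⁺]` onto `Gr A`. -/
def toGr : boundedSubring A →+* Gr A where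
  __ := toGrAux
  map_one' := (toGrAux_homog (isPowBounded_one (A := A))).trans grOf_one
  map_mul' p q := by
    change toGrAux (p * q) = toGrAux p * toGrAux q
    rw [boundedSubring_eq_sum p, Finset.sum_mul, map_sum, map_sum, Finset.sum_mul]
    refine Finset.sum_congr rfl fun r _ => ?_
    rw [boundedSubring_eq_sum q, Finset.mul_sum, map_sum, map_sum, Finset.mul_sum]
    refine Finset.sum_congr rfl fun s _ => ?_
    rw [toGrAux_homog (p.2 r), toGrAux_homog (q.2 s), grOf_mul,
      ← toGrAux_homog (IsPowBounded.mul (p.2 r) (q.2 s))]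
    exact congrArg toGrAux (Subtype.ext (homog_mul_homog _ _ _ _))

theorem toGr_apply (p : boundedSubring A) (r : Additive PosReal) :
    toGr p r = grMk ⟨coeff r.toMul p.1, p.2 r.toMul⟩ := toGrAux_apply p r

theorem toGr_homog {r : PosReal} {a : A} (h : IsPowBounded r a) :
    toGr ⟨homog A r a, homog_mem_boundedSubring.2 h⟩ = grOf r ⟨a, h⟩ := toGrAux_homog h

theorem toGr_eq_sum (p : boundedSubring A) :
    toGr p = ∑ r ∈ p.1.support, grOf r ⟨coeff r p.1, p.2 r⟩ := by
  conv_lhs => rw [boundedSubring_eq_sum p, map_sum]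
  exact Finset.sum_congr rfl fun r _ => toGr_homog (p.2 r)

theorem toGr_surjective : Function.Surjective (toGr (A := A)) := by
  intro z
  induction z using DirectSum.induction_on with
  | zero => exact ⟨0, map_zero _⟩
  | of r x =>
    obtain ⟨a, rfl⟩ := grMk_surjective x
    exact ⟨_, toGr_homog (r := r.toMul) a.2⟩
  | add x y hx hy =>
    obtain ⟨p, rfl⟩ := hx
    obtain ⟨q, rfl⟩ := hy
    exact ⟨p + q, map_add _ _ _⟩

theorem toGr_eq_zero_iff {p : boundedSubring A} :
    toGr p = 0 ↔ ∀ r, IsTopNilpotent r (coeff r p.1) := by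
  refine ⟨fun h r => ?_, fun h => ?_⟩
  · have h1 : ∀ r : Additive PosReal, grMk 0 = grMk ⟨coeff r.toMul p.1, p.2 r.toMul⟩ := by
      intro r
      rw [← toGr_apply p r, h]
      rfl
    replace h1 := h1 (Additive.ofMul r)
    have h2 := grMk_eq_iff.1 h1
    rw [AddSubgroup.coe_zero, sub_zero] at h2
    exact h2
  · rw [toGr_eq_sum]
    exact Finset.sum_eq_zero fun r _ => grOf_eq_zero (h r)

end ToGr

/-! ### The reified adic spectrum: enough points -/

theorem Sprv.le_out {A : Type u} [CommRing A] (x : Sprv A) (a : A) (q : PosReal) (b : A) :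
    (Quotient.out x).Le a q b ↔ x.Le a q b := by
  conv_rhs => rw [← Quotient.out_eq x]
  rfl

theorem Sprv.val_out_eq_zero {A : Type u} [CommRing A] (x : Sprv A) (a : A) :
    (Quotient.out x).val a = 0 ↔ x.EqZero a := by
  conv_rhs => rw [← Quotient.out_eq x]
  rfl

namespace AffinoidBanachRing

open GaussAlgebra DegreeAlgebra

variable (A : AffinoidBanachRing.{u})

/-- The ring of the elements of `A[ℝ⁺]` whose component in each degree `r` belongs to `A^{+,r}`. -/
def plusSubring : Subring (DegreeAlgebra A.carrier) :=
  (A.gr.comap toGr).map (boundedSubring A.carrier).subtype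

variable {A}

theorem mem_plusSubring {p : DegreeAlgebra A.carrier} :
    p ∈ A.plusSubring ↔ ∀ r, coeff r p ∈ A.plus r := by
  constructor
  · rintro ⟨q, hq, rfl⟩ r
    refine ⟨q.2 r, ?_⟩
    have h := A.gr_graded _ hq (Additive.ofMul r)
    rw [toGr_apply] at h
    exact h
  · intro h
    refine ⟨⟨p, fun r => (h r).1⟩, ?_, rfl⟩
    change toGr _ ∈ A.gr
    rw [toGr_eq_sum]
    exact sum_mem fun r _ => (h r).2

theorem plus_of_isTopNilpotent {r : PosReal} {a : A.carrier} (h : IsTopNilpotent r a) :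
    a ∈ A.plus r :=
  ⟨h.isPowBounded, by rw [grOf_eq_zero h]; exact zero_mem _⟩

theorem homog_mem_plusSubring {r : PosReal} {a : A.carrier} (h : a ∈ A.plus r) :
    homog A.carrier r a ∈ A.plusSubring := by
  obtain ⟨h1, h2⟩ := h
  refine ⟨⟨_, homog_mem_boundedSubring.2 h1⟩, ?_, rfl⟩
  change toGr _ ∈ A.gr
  rwa [toGr_homog]

theorem isPowBounded_iff_homog {r : PosReal} {a : A.carrier} :
    IsPowBounded r a ↔ ∃ C : ℝ, ∀ n : ℕ, ‖homog A.carrier r a ^ n‖ ≤ C := by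
  refine exists_congr fun C => forall_congr' fun n => ?_
  rw [homog_pow, norm_single, mul_comm]
  have : (invMonoidHom (r ^ n) : PosReal).1 = ((r : ℝ) ^ n)⁻¹ := rfl
  rw [this]

/-- The ring `⨁ A^{+,r}` is integrally closed in `A[ℝ⁺]`, as far as homogeneous elements are
concerned. -/
theorem mem_plus_of_isIntegral {q : PosReal} {a : A.carrier}
    (h : IsIntegral A.plusSubring (homog A.carrier q a)) : a ∈ A.plus q := by
  have hle : A.plusSubring ≤ boundedSubring A.carrier := by
    rintro _ ⟨p, -, rfl⟩
    exact p.2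
  have hb : IsPowBounded q a := by
    refine isPowBounded_iff_homog.2 (exists_norm_pow_le_of_isIntegral _ (fun p hp => ?_) h)
    have hp' : p ∈ powBounded (DegreeAlgebra A.carrier) 1 := by
      rw [← sum_single p]
      refine sum_mem fun r _ => ?_
      obtain ⟨C, hC⟩ := isPowBounded_iff_homog.1 (mem_plusSubring.1 hp r).1
      exact ⟨C, fun n => by simpa using hC n⟩
    obtain ⟨C, hC⟩ := hp'
    exact ⟨C, fun n => by simpa using hC n⟩
  refine ⟨hb, ?_⟩
  rw [← toGr_homog hb]
  refine A.gr_integrallyClosed _ ?_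
  have hmem : ∀ s : A.plusSubring, toGr (Subring.inclusion hle s) ∈ A.gr := by
    rintro ⟨_, p, hp, rfl⟩
    exact hp
  let ψ : A.plusSubring →+* A.gr := (toGr.comp (Subring.inclusion hle)).codRestrict A.gr hmem
  obtain ⟨f, hf, hfx⟩ := h
  refine ⟨f.map ψ, hf.map ψ, ?_⟩
  rw [Polynomial.eval₂_map]
  have h1 : f.eval₂ (Subring.inclusion hle) ⟨_, homog_mem_boundedSubring.2 hb⟩ = 0 := by
    refine (boundedSubring A.carrier).subtype_injective ?_
    rw [Polynomial.hom_eval₂, map_zero]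
    exact hfx
  have h2 := congrArg toGr h1
  rw [Polynomial.hom_eval₂, map_zero] at h2
  exact h2

theorem gauss_le_one (x : Spra A) {p : DegreeAlgebra A.carrier} (hp : p ∈ A.plusSubring) :
    (Quotient.out x.1).gauss p ≤ 1 := by
  rw [ReifiedValuation.gauss_le_one_iff]
  intro r
  rw [Sprv.le_out]
  exact x.2.le_of_mem_plus r _ (mem_plusSubring.1 hp r)

/-- A valuation on `A[ℝ⁺]` which is at most `1` on `⨁ A^{+,r}` and less than `1` on `[t]` for `t > 1`
specializes to a point of `Spra(A)`. -/
theorem exists_spra {Γ₀ : Type u} [LinearOrderedCommGroupWithZero Γ₀]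
    (W : Valuation (DegreeAlgebra A.carrier) Γ₀) (hW : ∀ p ∈ A.plusSubring, W p ≤ 1)
    (hlt : ∀ t, 1 < t → W (homog A.carrier t 1) < 1) :
    ∃ x : Spra A, (∀ a q, x.1.Le a q 1 ↔ W (homog A.carrier q a) ≤ 1) ∧
      (∀ a q b, x.1.Le a q b → ¬ x.1.EqZero b →
        W (homog A.carrier q a) ≤ W (homog A.carrier 1 b) ∧
        ∃ r, 1 ≤ W (homog A.carrier r b)) ∧ ∀ a, W (homog A.carrier 1 a) = 0 → x.1.EqZero a := by
  obtain ⟨x, h1, h2, h3, h4⟩ := exists_sprv W hlt fun a => by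
    refine ⟨⟨‖a‖ + 1, by positivity⟩, hW _ (homog_mem_plusSubring (plus_of_isTopNilpotent
      (isTopNilpotent_of_norm_lt ?_)))⟩
    exact lt_add_one ‖a‖
  exact ⟨⟨x, fun r a ha => (h2 a r).2 (hW _ (homog_mem_plusSubring (plus_of_isTopNilpotent ha))), h1,
    fun r a ha => (h2 a r).2 (hW _ (homog_mem_plusSubring ha))⟩, h2, h3, h4⟩

/-- A valuation on `A[ℝ⁺]` which is at most `1` on `⨁ A^{+,r}` but not on all homogeneous elements
is nontrivial on the real numbers. -/
theorem valuation_lt_one {Γ₀ : Type u} [LinearOrderedCommGroupWithZero Γ₀]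
    (W : Valuation (DegreeAlgebra A.carrier) Γ₀) (hW : ∀ p ∈ A.plusSubring, W p ≤ 1)
    {q : PosReal} {a : A.carrier} (ha : 1 < W (homog A.carrier q a)) (t : PosReal) (ht : 1 < t) :
    W (homog A.carrier t 1) < 1 := by
  by_contra hcon
  have h1 : W (homog A.carrier t 1) = 1 :=
    le_antisymm (hW _ (homog_mem_plusSubring (plus_of_isTopNilpotent (isTopNilpotent_one ht))))
      (not_lt.1 hcon)
  have ht' : (1 : ℝ) < t := ht
  -- multiplication by a high power of `[t]` makes `a [q]` topologically nilpotent in its degree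
  obtain ⟨n, hn⟩ := pow_unbounded_of_one_lt (‖a‖ / q) ht'
  have h2 : homog A.carrier q a * homog A.carrier t 1 ^ n ∈ A.plusSubring := by
    rw [homog_pow, one_pow, homog_mul_homog, mul_one]
    refine homog_mem_plusSubring (plus_of_isTopNilpotent (isTopNilpotent_of_norm_lt ?_))
    rw [div_lt_iff₀ q.2, mul_comm] at hn
    exact hn
  have h3 := hW _ h2
  rw [map_mul, map_pow, h1, one_pow, mul_one] at h3
  exact absurd ha (not_lt.2 h3)

/-- The elements of `A^{+,q}` are characterized by their values. -/
theorem mem_plus_of_forall_le {q : PosReal} {a : A.carrier} (h : ∀ x : Spra A, x.1.Le a q 1) :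
    a ∈ A.plus q := by
  by_contra hcon
  obtain ⟨Γ₀, _, W, h1, -, h2⟩ := exists_valuation_of_monic_notMem A.plusSubring ⊥
    (homog A.carrier q a) fun f hf hfx => hcon (mem_plus_of_isIntegral ⟨f, hf, hfx⟩)
  obtain ⟨x, hx, -⟩ := exists_spra W h1 (valuation_lt_one W h1 h2)
  exact absurd ((hx a q).1 (h x)) (not_le.2 h2)

/-- The elements of `A[ℝ⁺]` with all coefficients in an ideal form an ideal. -/
theorem exists_coeffIdeal (m : Ideal A.carrier) :
    ∃ J : Ideal (DegreeAlgebra A.carrier), ∀ p, p ∈ J ↔ ∀ r, coeff r p ∈ m :=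
  ⟨{ carrier := {p | ∀ r, coeff r p ∈ m}
     zero_mem' := fun r => by rw [map_zero]; exact zero_mem _
     add_mem' := fun hp hq r => by rw [map_add]; exact add_mem (hp r) (hq r)
     smul_mem' := fun p q hq r => by
      rw [smul_eq_mul, coeff_mul]
      exact sum_mem fun s _ => m.mul_mem_left _ (hq _) }, fun _ => Iff.rfl⟩

/-- An element which vanishes nowhere on the spectrum is a unit. -/
theorem isUnit_of_forall_ne_zero {a : A.carrier} (h : ∀ x : Spra A, ¬ x.1.EqZero a) : IsUnit a := by
  by_contra hcon
  obtain ⟨m, hm, ham⟩ := exists_max_ideal_of_mem_nonunits hcon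
  obtain ⟨J, hJ⟩ := exists_coeffIdeal m
  -- a valuation which vanishes on the maximal ideal `m` and is nontrivial on the real numbers, as
  -- witnessed by its value at `[q]`
  let q : PosReal := ⟨1 / 2, by norm_num⟩
  have hq : q < 1 := by
    change (1 / 2 : ℝ) < 1
    norm_num
  obtain ⟨Γ₀, _, W, h1, h2, h3⟩ := exists_valuation_of_monic_notMem A.plusSubring J
    (homog A.carrier q 1) (by
      intro f hf hfm
      -- the component in degree `qⁿ` is `1 + e` with `e` topologically nilpotent
      have he : f.eval₂ A.plusSubring.subtype (homog A.carrier q 1) =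
          homog A.carrier q 1 ^ f.natDegree + ∑ i ∈ Finset.range f.natDegree,
            (f.coeff i : DegreeAlgebra A.carrier) * homog A.carrier q 1 ^ i := by
        conv_lhs => rw [hf.as_sum]
        simp only [Polynomial.eval₂_add, Polynomial.eval₂_pow, Polynomial.eval₂_X,
          Polynomial.eval₂_finsetSum, Polynomial.eval₂_mul, Polynomial.eval₂_C,
          Subring.subtype_apply]
      have h1 := (hJ _).1 hfm (q ^ f.natDegree)
      rw [he, map_add, homog_pow, one_pow, coeff_single_same, map_sum] at h1
      refine hm.ne_top (Ideal.eq_top_of_isUnit_mem _ h1 (isUnit_one_add_of_isTopNilpotent ?_))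
      refine (topNilpotent A.carrier 1).sum_mem fun i hi => ?_
      rw [mul_comm, homog_pow, one_pow, coeff_single_mul, one_mul]
      refine (mem_plusSubring.1 (f.coeff i).2 _).1.isTopNilpotent_of_lt ?_
      have hi' : i < f.natDegree := Finset.mem_range.1 hi
      rw [inv_mul_lt_iff_lt_mul, mul_one]
      exact pow_lt_pow_right_of_lt_one₀ q.2 hq hi')
  obtain ⟨x, -, -, hx⟩ := exists_spra W h1 (valuation_lt_one W h1 h3)
  refine h x (hx a (h2 _ ((hJ _).2 fun r => ?_)))
  rw [coeff_single]
  split_ifs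
  · exact ham
  · exact zero_mem _

/-! ### Compactness of the reified adic spectrum -/

/-- The valuative relation on `A[ℝ⁺]` given by an ultrafilter of points of the spectrum. -/
theorem exists_ultraRel (U : Ultrafilter (Spra A)) :
    ∃ V : ValuativeRel (DegreeAlgebra A.carrier), ∀ p q, V.vle p q ↔
      ∀ᶠ x : Spra A in (U : Filter (Spra A)),
        (Quotient.out x.1).gauss p ≤ (Quotient.out x.1).gauss q := by
  refine ⟨{
    vle p q := ∀ᶠ x : Spra A in (U : Filter (Spra A)), (Quotient.out x.1).gauss p ≤ (Quotient.out x.1).gauss q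
    vle_total p q := Ultrafilter.eventually_or.1 (Eventually.of_forall fun x => le_total _ _)
    vle_trans h1 h2 := by
      filter_upwards [h1, h2] with x hx1 hx2 using hx1.trans hx2
    vle_add h1 h2 := by
      filter_upwards [h1, h2] with x hx1 hx2 using (Valuation.map_add _ _ _).trans (max_le hx1 hx2)
    mul_vle_mul_left h z := by
      filter_upwards [h] with x hx
      rw [map_mul, map_mul]
      exact mul_le_mul_left hx _
    vle_mul_cancel {p q z} hz h := by
      filter_upwards [Ultrafilter.eventually_not.2 hz, h] with x hx1 hx2
      rw [map_zero, not_le] at hx1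
      rw [map_mul, map_mul] at hx2
      exact (mul_le_mul_iff_left₀ hx1).1 hx2
    not_vle_one_zero h := by
      obtain ⟨x, hx⟩ := h.exists
      rw [map_one, map_zero] at hx
      exact absurd hx (not_le.2 zero_lt_one)
    vle_mul_comm {p q} := Eventually.of_forall fun x => by rw [mul_comm] }, fun _ _ => Iff.rfl⟩

/-- Every ultrafilter on the spectrum converges: its limit is obtained from the valuation given by
`exists_ultraRel`. -/
theorem exists_le_nhds (U : Ultrafilter (Spra A)) : ∃ y : Spra A, (U : Filter (Spra A)) ≤ 𝓝 y := by
  obtain ⟨_, hU⟩ := exists_ultraRel U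
  let W := ValuativeRel.valuation (DegreeAlgebra A.carrier)
  have hle : ∀ p q, W p ≤ W q ↔
      ∀ᶠ x : Spra A in (U : Filter (Spra A)), (Quotient.out x.1).gauss p ≤ (Quotient.out x.1).gauss q := fun p q =>
    (Valuation.Compatible.vle_iff_le (v := W) p q).symm.trans (hU p q)
  have hle1 : ∀ p, W p ≤ 1 ↔ ∀ᶠ x : Spra A in (U : Filter (Spra A)), (Quotient.out x.1).gauss p ≤ 1 := fun p => by
    rw [← map_one W, hle]
    simp only [map_one]
  have hge1 : ∀ p, 1 ≤ W p ↔ ∀ᶠ x : Spra A in (U : Filter (Spra A)), 1 ≤ (Quotient.out x.1).gauss p := fun p => by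
    rw [← map_one W, hle]
    simp only [map_one]
  obtain ⟨y, -, hy, -⟩ := exists_spra W
    (fun p hp => (hle1 p).2 (Eventually.of_forall fun x => gauss_le_one x hp)) (fun t ht => by
      rw [← not_le, hge1]
      intro h
      obtain ⟨x, hx⟩ := h.exists
      rw [ReifiedValuation.gauss_homog, map_one, one_mul, ← WithZero.coe_inv, ← WithZero.coe_one,
        WithZero.coe_le_coe, ← map_inv, ← map_one (Quotient.out x.1).reif,
        (Quotient.out x.1).reif_strictMono.le_iff_le, one_le_inv'] at hx
      exact absurd ht (not_lt.2 hx))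
  refine ⟨y, ?_⟩
  have h := TopologicalSpace.tendsto_nhds_generateFrom_iff (m := fun x : Spra A => x.1)
    (f := (U : Filter (Spra A))) (b := y.1)
    (g := {S | ∃ (a b : A.carrier) (q : PosReal), S = {x | x.Le a q b ∧ ¬ x.EqZero b}})
  have h2 : Tendsto (fun x : Spra A => x.1) (U : Filter (Spra A)) (𝓝 y.1) := by
    refine h.2 ?_
    rintro _ ⟨a, b, q, rfl⟩ ⟨hy1, hy2⟩
    obtain ⟨h3, r, h4⟩ := hy a q b hy1 hy2
    rw [hle] at h3
    rw [hge1] at h4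
    filter_upwards [h3, h4] with x hx3 hx4
    refine ⟨?_, ?_⟩
    · rw [ReifiedValuation.gauss_homog_le_iff, inv_one, mul_one, Sprv.le_out] at hx3
      exact hx3
    · intro hx0
      rw [ReifiedValuation.gauss_homog, (Sprv.val_out_eq_zero x.1 b).2 hx0, zero_mul] at hx4
      exact absurd hx4 (not_le.2 zero_lt_one)
  rw [nhds_induced]
  exact tendsto_iff_comap.1 h2

instance compactSpace_spra : CompactSpace (Spra A) :=
  ⟨isCompact_iff_ultrafilter_le_nhds.2 fun U _ => by
    obtain ⟨y, hy⟩ := exists_le_nhds U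
    exact ⟨y, Set.mem_univ _, hy⟩⟩

end AffinoidBanachRing

/-! ### Computation with values at points -/

namespace Sprv

variable {A : Type u} [CommRing A] (x : Sprv A)

theorem le_refl (a : A) : x.Le a 1 a := by
  induction x using Quotient.inductionOn with
  | h v =>
    change v.val a ≤ (v.reif 1 : WithZero v.Γ) * v.val a
    rw [map_one, WithZero.coe_one, one_mul]

variable {x}

theorem Le.trans {a b c : A} {q s : PosReal} (h1 : x.Le a q b) (h2 : x.Le b s c) :
    x.Le a (q * s) c := by
  induction x using Quotient.inductionOn with
  | h v =>
    change v.val a ≤ (v.reif (q * s) : WithZero v.Γ) * v.val c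
    rw [map_mul, WithZero.coe_mul, mul_assoc]
    exact (show v.val a ≤ (v.reif q : WithZero v.Γ) * v.val b from h1).trans (mul_le_mul_right h2 _)

theorem Le.mul {a b c d : A} {q s : PosReal} (h1 : x.Le a q b) (h2 : x.Le c s d) :
    x.Le (a * c) (q * s) (b * d) := by
  induction x using Quotient.inductionOn with
  | h v =>
    change v.val (a * c) ≤ (v.reif (q * s) : WithZero v.Γ) * v.val (b * d)
    rw [map_mul v.reif, WithZero.coe_mul, map_mul, map_mul, mul_mul_mul_comm]
    exact mul_le_mul' h1 h2

theorem Le.mono {a b : A} {q s : PosReal} (h1 : x.Le a q b) (h : q ≤ s) : x.Le a s b := by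
  induction x using Quotient.inductionOn with
  | h v =>
    refine le_trans (b := (v.reif q : WithZero v.Γ) * v.val b) h1 (mul_le_mul_left ?_ _)
    exact WithZero.coe_le_coe.2 (v.reif_strictMono.monotone h)

theorem Le.add {a b c : A} {q : PosReal} (h1 : x.Le a q c) (h2 : x.Le b q c) :
    x.Le (a + b) q c := by
  induction x using Quotient.inductionOn with
  | h v => exact (Valuation.map_add v.val a b).trans (max_le h1 h2)

theorem zero_le (q : PosReal) (b : A) : x.Le 0 q b := by
  induction x using Quotient.inductionOn with
  | h v =>
    change v.val 0 ≤ _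
    rw [map_zero]
    exact _root_.zero_le

theorem Le.sum {ι : Type*} {s : Finset ι} {f : ι → A} {b : A} {q : PosReal}
    (h : ∀ i ∈ s, x.Le (f i) q b) : x.Le (∑ i ∈ s, f i) q b :=
  Finset.sum_induction _ (fun a => x.Le a q b) (fun _ _ => Le.add) (zero_le q b) h

theorem Le.cancel {a b c : A} {q : PosReal} (hc : ¬ x.EqZero c) (h : x.Le (a * c) q (b * c)) :
    x.Le a q b := by
  induction x using Quotient.inductionOn with
  | h v =>
    change v.val (a * c) ≤ (v.reif q : WithZero v.Γ) * v.val (b * c) at h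
    rw [map_mul, map_mul, ← mul_assoc] at h
    exact (mul_le_mul_iff_left₀ (zero_lt_iff.2 hc)).1 h

theorem not_le_one_zero (q : PosReal) : ¬ x.Le 1 q 0 := by
  induction x using Quotient.inductionOn with
  | h v =>
    change ¬ v.val 1 ≤ (v.reif q : WithZero v.Γ) * v.val 0
    rw [map_one, map_zero, mul_zero, not_le]
    exact zero_lt_one

theorem EqZero.le {a : A} (h : x.EqZero a) (q : PosReal) (b : A) : x.Le a q b := by
  induction x using Quotient.inductionOn with
  | h v =>
    change v.val a ≤ _
    rw [show v.val a = 0 from h]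
    exact _root_.zero_le

theorem Le.eqZero {a b : A} {q : PosReal} (h : x.Le a q b) (hb : x.EqZero b) : x.EqZero a := by
  induction x using Quotient.inductionOn with
  | h v =>
    change v.val a ≤ (v.reif q : WithZero v.Γ) * v.val b at h
    rw [show v.val b = 0 from hb, mul_zero] at h
    exact le_antisymm h _root_.zero_le

theorem not_eqZero_one : ¬ x.EqZero 1 := fun h =>
  x.not_le_one_zero 1 (h.le 1 0)

theorem not_eqZero_of_one_le {b : A} {q : PosReal} (h : x.Le 1 q b) : ¬ x.EqZero b := fun hb =>
  not_eqZero_one (h.eqZero hb)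

theorem eqZero_mul_left {a : A} (ha : x.EqZero a) (b : A) : x.EqZero (b * a) := by
  induction x using Quotient.inductionOn with
  | h v =>
    change v.val (b * a) = 0
    rw [map_mul, show v.val a = 0 from ha, mul_zero]

theorem eqZero_add {a b : A} (ha : x.EqZero a) (hb : x.EqZero b) : x.EqZero (a + b) :=
  ((ha.le 1 0).add (hb.le 1 0)).eqZero (by
    induction x using Quotient.inductionOn with
    | h v => exact map_zero v.val)

theorem one_le_one_iff {q : PosReal} : x.Le 1 q 1 ↔ 1 ≤ q := by
  induction x using Quotient.inductionOn with
  | h v =>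
    change v.val 1 ≤ (v.reif q : WithZero v.Γ) * v.val 1 ↔ _
    rw [map_one, mul_one, ← WithZero.coe_one, WithZero.coe_le_coe, ← map_one v.reif,
      v.reif_strictMono.le_iff_le]

theorem comap_eqZero {B : Type u} [CommRing B] (f : A →+* B) (y : Sprv B) (a : A) :
    (y.comap f).EqZero a ↔ y.EqZero (f a) := by
  induction y using Quotient.inductionOn
  exact Iff.rfl

theorem IsCoinitial.exists_one_le (hx : x.IsCoinitial) {b : A} (hb : ¬ x.EqZero b) :
    ∃ q, x.Le 1 q b := by
  induction x using Quotient.inductionOn with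
  | h v =>
    obtain ⟨γ, hγ⟩ := WithZero.ne_zero_iff_exists.1 (show v.val b ≠ 0 from hb)
    obtain ⟨r, hr⟩ := hx γ (v.mem_valueGroup_of_val_eq hγ.symm)
    refine ⟨r⁻¹, ?_⟩
    change v.val 1 ≤ (v.reif r⁻¹ : WithZero v.Γ) * v.val b
    rw [map_one, ← hγ, ← WithZero.coe_mul, ← WithZero.coe_one, WithZero.coe_le_coe, map_inv,
      le_inv_mul_iff_mul_le, mul_one]
    exact hr

end Sprv

/-! ### Affinoid Banach rings defined by sets of points -/

section OfPoints

open GaussAlgebra DegreeAlgebra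

variable {B : Type u} [NormedCommRing B] [IsUltrametricDist B]

theorem gauss_out_le_one_iff {x : Sprv B} {p : DegreeAlgebra B} :
    (Quotient.out x).gauss p ≤ 1 ↔ ∀ r, x.Le (coeff r p) r 1 := by
  rw [ReifiedValuation.gauss_le_one_iff]
  exact forall_congr' fun r => Sprv.le_out _ _ _ _

/-- The power-bounded elements of `B[ℝ⁺]` all of whose components `bᵣ` satisfy `v(bᵣ) ≤ r` for all
`v` in `X`. -/
def pointsSubring (X : Set (Sprv B)) : Subring (boundedSubring B) where
  carrier := {p | ∀ x ∈ X, (Quotient.out x).gauss p.1 ≤ 1}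
  zero_mem' x _ := by
    change (Quotient.out x).gauss 0 ≤ 1
    rw [map_zero]
    exact zero_le
  one_mem' x _ := (map_one (Quotient.out x).gauss).le
  add_mem' hp hq x hx := (Valuation.map_add _ _ _).trans (max_le (hp x hx) (hq x hx))
  neg_mem' {p} hp x hx := by
    change (Quotient.out x).gauss (-p.1) ≤ 1
    rw [Valuation.map_neg]
    exact hp x hx
  mul_mem' {p q} hp hq x hx := by
    change (Quotient.out x).gauss (p.1 * q.1) ≤ 1
    rw [map_mul]
    exact mul_le_one' (hp x hx) (hq x hx)

theorem toGr_mem_map_pointsSubring {X : Set (Sprv B)}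
    (hX : ∀ x ∈ X, ∀ (r : PosReal) (b : B), IsTopNilpotent r b → x.Le b r 1)
    {p : boundedSubring B} : toGr p ∈ (pointsSubring X).map toGr ↔ p ∈ pointsSubring X := by
  refine ⟨?_, fun h => ⟨p, h, rfl⟩⟩
  rintro ⟨q, hq, hqp⟩
  have h1 : toGr (p - q) = 0 := by rw [map_sub, hqp, sub_self]
  have h2 : p - q ∈ pointsSubring X := fun x hx =>
    gauss_out_le_one_iff.2 fun r => hX x hx r _ (toGr_eq_zero_iff.1 h1 r)
  have h3 := add_mem hq h2
  rwa [add_sub_cancel] at h3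

/-- The image of `pointsSubring X` in `Gr B` is integrally closed, because its preimage is an
intersection of valuation rings. -/
theorem map_pointsSubring_integrallyClosed {X : Set (Sprv B)}
    (hX : ∀ x ∈ X, ∀ (r : PosReal) (b : B), IsTopNilpotent r b → x.Le b r 1) (z : Gr B)
    (hz : IsIntegral ((pointsSubring X).map toGr) z) : z ∈ (pointsSubring X).map toGr := by
  obtain ⟨p, rfl⟩ := toGr_surjective z
  obtain ⟨f, hf, hfz⟩ := hz
  rw [toGr_mem_map_pointsSubring hX]
  -- lift the equation to power-bounded elements
  let ψ : pointsSubring X →+* (pointsSubring X).map toGr :=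
    (toGr.comp (pointsSubring X).subtype).codRestrict _ fun s => ⟨s, s.2, rfl⟩
  have hψ : Function.Surjective ψ := by
    rintro ⟨_, s, hs, rfl⟩
    exact ⟨⟨s, hs⟩, rfl⟩
  have hlift : f ∈ Polynomial.lifts ψ := by
    rw [Polynomial.lifts_iff_coeff_lifts]
    exact fun n => hψ _
  obtain ⟨g, hgf, -, hg⟩ := Polynomial.lifts_and_natDegree_eq_and_monic hlift hf
  have h1 : toGr (g.eval₂ (pointsSubring X).subtype p) = 0 := by
    rw [Polynomial.hom_eval₂]
    rw [← hgf, Polynomial.eval₂_map] at hfz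
    exact hfz
  -- the factor `X` ensures that the polynomial stays monic when the constant `k` is subtracted
  set k := (g * Polynomial.X).eval₂ (pointsSubring X).subtype p with hk
  have h2 : toGr k = 0 := by
    rw [hk, Polynomial.eval₂_mul, map_mul, h1, zero_mul]
  have h3 : k ∈ pointsSubring X := fun x hx =>
    gauss_out_le_one_iff.2 fun r => hX x hx r _ (toGr_eq_zero_iff.1 h2 r)
  have hgX : (g * Polynomial.X - Polynomial.C (⟨k, h3⟩ : pointsSubring X)).Monic := by
    nontriviality pointsSubring X
    refine (hg.mul Polynomial.monic_X).sub_of_left ?_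
    rw [Polynomial.degree_mul_X]
    refine Polynomial.degree_C_le.trans_lt ?_
    rw [Polynomial.degree_eq_natDegree hg.ne_zero]
    exact_mod_cast Nat.succ_pos _
  have hroot : (g * Polynomial.X - Polynomial.C (⟨k, h3⟩ : pointsSubring X)).eval₂ (pointsSubring X).subtype p = 0 := by
    rw [Polynomial.eval₂_sub, Polynomial.eval₂_C, ← hk]
    exact sub_self k
  intro x hx
  let v : Valuation (boundedSubring B) _ := (Quotient.out x).gauss.comap (boundedSubring B).subtype
  let θ : pointsSubring X →+* v.integer := (pointsSubring X).subtype.codRestrict _ fun s => s.2 x hx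
  refine (Valuation.integer.integers v).mem_of_integral
    (⟨_, hgX.map θ, ?_⟩ : IsIntegral v.integer p)
  rw [Polynomial.eval₂_map]
  exact hroot

/-- The affinoid Banach ring with underlying ring `B`, with `B^{+,r}` the set of power-bounded
elements of degree `r` which are bounded by `r` on a given set of points. -/
def AffinoidBanachRing.ofPoints (B : Type u) [NormedCommRing B] [IsUltrametricDist B]
    [CompleteSpace B] (X : Set (Sprv B))
    (hX : ∀ x ∈ X, ∀ (r : PosReal) (b : B), IsTopNilpotent r b → x.Le b r 1) :
    AffinoidBanachRing.{u} where
  carrier := B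
  gr := (pointsSubring X).map toGr
  gr_graded z hz r := by
    obtain ⟨p, hp, rfl⟩ := hz
    rw [toGr_apply]
    have h1 := toGr_homog (r := r.toMul) (p.2 r.toMul)
    refine ⟨_, fun x hx => ?_, h1⟩
    rw [gauss_out_le_one_iff]
    intro s
    rw [coeff_single]
    split_ifs with h
    · rw [← h]
      exact gauss_out_le_one_iff.1 (hp x hx) _
    · exact Sprv.zero_le _ _
  gr_integrallyClosed := map_pointsSubring_integrallyClosed hX

theorem AffinoidBanachRing.mem_plus_ofPoints [CompleteSpace B] {X : Set (Sprv B)}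
    {hX : ∀ x ∈ X, ∀ (r : PosReal) (b : B), IsTopNilpotent r b → x.Le b r 1} {r : PosReal} {b : B} :
    b ∈ (AffinoidBanachRing.ofPoints B X hX).plus r ↔
      IsPowBounded r b ∧ ∀ x ∈ X, x.Le b r 1 := by
  have h1 : ∀ h : IsPowBounded r b,
      grOf r ⟨b, h⟩ ∈ (pointsSubring X).map toGr ↔ ∀ x ∈ X, x.Le b r 1 := by
    intro h
    rw [← toGr_homog h, toGr_mem_map_pointsSubring hX]
    refine forall₂_congr fun x hx => ?_
    rw [gauss_out_le_one_iff]
    refine ⟨fun H => by simpa using H r, fun H s => ?_⟩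
    rw [coeff_single]
    split_ifs with hs
    · rwa [← hs]
    · exact Sprv.zero_le _ _
  exact ⟨fun ⟨h, h'⟩ => ⟨h, (h1 h).1 h'⟩, fun ⟨h, h'⟩ => ⟨h, (h1 h).2 h'⟩⟩

end OfPoints

/-! ### Affinoid Banach rings of relative Laurent series -/

section BoundedMaps

variable {A B : Type u} [NormedCommRing A] [NormedCommRing B]

theorem scaledNorm_map_le {f : A →+* B} {c : ℝ} (hf : ∀ a, ‖f a‖ ≤ c * ‖a‖) (r : PosReal) (a : A)
    (n : ℕ) : ((r : ℝ) ^ n)⁻¹ * ‖f a ^ n‖ ≤ c * (((r : ℝ) ^ n)⁻¹ * ‖a ^ n‖) := by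
  rw [← map_pow]
  calc ((r : ℝ) ^ n)⁻¹ * ‖f (a ^ n)‖ ≤ ((r : ℝ) ^ n)⁻¹ * (c * ‖a ^ n‖) :=
        mul_le_mul_of_nonneg_left (hf _) (inv_nonneg.2 (pow_nonneg r.2.le n))
    _ = _ := by ring

theorem IsPowBounded.map {f : A →+* B} {c : ℝ} (hc : 0 ≤ c) (hf : ∀ a, ‖f a‖ ≤ c * ‖a‖)
    {r : PosReal} {a : A} (h : IsPowBounded r a) : IsPowBounded r (f a) := by
  obtain ⟨C, hC⟩ := h
  exact ⟨c * C, fun n => (scaledNorm_map_le hf r a n).trans (mul_le_mul_of_nonneg_left (hC n) hc)⟩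

theorem IsTopNilpotent.map {f : A →+* B} {c : ℝ} (hf : ∀ a, ‖f a‖ ≤ c * ‖a‖)
    {r : PosReal} {a : A} (h : IsTopNilpotent r a) : IsTopNilpotent r (f a) := by
  have h0 : Tendsto (fun n : ℕ => c * (((r : ℝ) ^ n)⁻¹ * ‖a ^ n‖)) atTop (𝓝 0) := by
    simpa using Tendsto.const_mul c h
  exact squeeze_zero (fun n => scaledNorm_nonneg _ _ _) (fun n => scaledNorm_map_le hf r a n) h0

theorem exists_norm_pow_le_of_isPowBounded {r : PosReal} {a : A} (h : IsPowBounded r a) :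
    ∃ K : ℝ, 0 ≤ K ∧ ∀ n : ℕ, ‖a ^ n‖ ≤ K * (r : ℝ) ^ n := by
  obtain ⟨C, hC⟩ := h
  refine ⟨C, (scaledNorm_nonneg r a 0).trans (hC 0), fun n => ?_⟩
  have := hC n
  rwa [inv_mul_le_iff₀ (pow_pos r.2 n), mul_comm] at this

end BoundedMaps

namespace AffinoidBanachRing

open GaussAlgebra

variable (A : AffinoidBanachRing.{u}) {G : Type} [CommMonoid G] (w : G →* PosReal)
  (I : Ideal (GaussAlgebra A.carrier w))

/-- The points of the reified valuative spectrum of `Completion (A[G] ⧸ I)` which lie over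
`Spra(A)` and satisfy `v(g) ≤ w(g)` for all `g`. -/
def gaussPoints : Set (Sprv (GaussQuotient A.carrier w I)) :=
  {x | (∀ (r : PosReal) b, IsTopNilpotent r b → x.Le b r 1) ∧ x.IsCoinitial ∧
    (∀ r, ∀ a ∈ A.plus r, x.Le (GaussQuotient.of I (C A.carrier w a)) r 1) ∧
    ∀ g, x.Le (GaussQuotient.of I (T A.carrier w g)) (w g) 1}

/-- The completion of `A[G] ⧸ I` as an affinoid Banach ring over `A` in which `g` belongs to the
ring of elements of degree `w g`. -/
def gaussAffinoid : AffinoidBanachRing.{u} :=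
  ofPoints (GaussQuotient A.carrier w I) (A.gaussPoints w I) fun _ hx => hx.1

variable {A w I}

variable (A w I) in
/-- The canonical map `A[G] → Completion (A[G] ⧸ I)`. -/
def gaussMap : GaussAlgebra A.carrier w →+* (A.gaussAffinoid w I).carrier := GaussQuotient.of I

theorem gaussMap_eq_zero {p : GaussAlgebra A.carrier w} (hp : p ∈ I) : A.gaussMap w I p = 0 :=
  GaussQuotient.of_eq_zero hp

theorem norm_gaussMap_le (p : GaussAlgebra A.carrier w) : ‖A.gaussMap w I p‖ ≤ ‖p‖ :=
  GaussQuotient.norm_of_le p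

theorem norm_gaussMap_C_le (a : A.carrier) : ‖A.gaussMap w I (C A.carrier w a)‖ ≤ 1 * ‖a‖ := by
  rw [one_mul, ← norm_C (w := w) a]
  exact norm_gaussMap_le _

theorem mem_plus_gaussAffinoid {r : PosReal} {b : (A.gaussAffinoid w I).carrier} :
    b ∈ (A.gaussAffinoid w I).plus r ↔ IsPowBounded r b ∧ ∀ x ∈ A.gaussPoints w I, x.Le b r 1 :=
  mem_plus_ofPoints (B := GaussQuotient A.carrier w I) (hX := fun _ hx => hx.1)

variable (A w I) in
/-- The structure morphism of the relative algebra `gaussAffinoid`. -/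
def toGauss : Hom A (A.gaussAffinoid w I) where
  toRingHom := (A.gaussMap w I).comp (C A.carrier w)
  bounded := ⟨1, one_pos, fun a => norm_gaussMap_C_le a⟩
  map_plus r a ha := by
    refine mem_plus_gaussAffinoid.2 ⟨?_, fun x hx => hx.2.2.1 r a ha⟩
    exact ha.1.map (f := (A.gaussMap w I).comp (C A.carrier w)) zero_le_one norm_gaussMap_C_le

theorem gaussMap_T_mem_plus (g : G) : A.gaussMap w I (T A.carrier w g) ∈
    (A.gaussAffinoid w I).plus (w g) := by
  refine mem_plus_gaussAffinoid.2 ⟨⟨‖(1 : A.carrier)‖, fun n => ?_⟩, fun x hx => hx.2.2.2 g⟩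
  rw [← map_pow, ← map_pow, inv_mul_le_iff₀ (pow_pos (w g).2 n), mul_comm]
  refine (norm_gaussMap_le _).trans ?_
  rw [T_apply, norm_single, map_pow]
  rfl

theorem isReallyStronglyNoetherian_gaussAffinoid [Monoid.FG G]
    (hA : IsReallyStronglyNoetherian A.carrier) :
    IsReallyStronglyNoetherian (A.gaussAffinoid w I).carrier :=
  hA.gaussQuotient w I

theorem Hom.continuous {B C : AffinoidBanachRing.{u}} (f : Hom B C) : Continuous f.toRingHom := by
  obtain ⟨c, -, hc⟩ := f.bounded
  exact AddMonoidHomClass.continuous_of_bound f.toRingHom c hc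

theorem gauss_hom_ext {D : AffinoidBanachRing.{u}} {f g : Hom (A.gaussAffinoid w I) D}
    (hA : f.comp (A.toGauss w I) = g.comp (A.toGauss w I))
    (hT : ∀ x, f.toRingHom (A.gaussMap w I (T A.carrier w x)) =
      g.toRingHom (A.gaussMap w I (T A.carrier w x))) : f = g :=
  Hom.ext (GaussQuotient.hom_ext f.continuous g.continuous
    (fun a => congrArg (fun h : Hom A D => h.toRingHom a) hA) hT)

/-- The universal property of `gaussAffinoid`. -/
theorem exists_hom_gaussAffinoid {D : AffinoidBanachRing.{u}} (ψ : Hom A D) (m : G →* D.carrier)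
    {K : ℝ} (hK : 0 ≤ K) (hm : ∀ g, ‖m g‖ ≤ K * (w g : ℝ)) (hm' : ∀ g, m g ∈ D.plus (w g))
    (hI : ∀ p ∈ I, GaussAlgebra.lift ψ.toRingHom m p = 0) :
    ∃ g : Hom (A.gaussAffinoid w I) D, g.comp (A.toGauss w I) = ψ ∧
      ∀ x, g.toRingHom (A.gaussMap w I (T A.carrier w x)) = m x := by
  obtain ⟨c, hc, hψ⟩ := ψ.bounded
  obtain ⟨g, hg, hgb⟩ := GaussQuotient.exists_lift (I := I)
    (GaussAlgebra.lift (w := w) ψ.toRingHom m) (c := c * K) (by positivity)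
    (norm_lift_le ψ.toRingHom m hc.le hK hψ hm) hI
  have hgC : ∀ a, g (GaussQuotient.of I (C A.carrier w a)) = ψ.toRingHom a := fun a => by
    rw [hg, lift_C]
  have hgT : ∀ x, g (GaussQuotient.of I (T A.carrier w x)) = m x := fun x => by
    rw [hg, lift_T]
  have hgb' : ∀ b, ‖g b‖ ≤ (c * K + 1) * ‖b‖ := fun b =>
    (hgb b).trans (mul_le_mul_of_nonneg_right (by linarith) (norm_nonneg _))
  refine ⟨⟨g, ⟨c * K + 1, by positivity, hgb'⟩, fun r b hb => ?_⟩, ?_, hgT⟩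
  · refine mem_plus_of_forall_le fun y => ?_
    have hy := (mem_plus_gaussAffinoid.1 hb).2 (y.1.comap g) ⟨fun s b hb => ?_,
      y.2.isCoinitial.comap g, fun s a ha => ?_, fun x => ?_⟩
    · have h := (Sprv.comap_le g y.1 b 1 r).1 hy
      rwa [map_one] at h
    · rw [Sprv.comap_le, map_one]
      exact y.2.isBounded s _ (hb.map hgb')
    · rw [Sprv.comap_le, map_one, hgC]
      exact y.2.le_of_mem_plus s _ (ψ.map_plus s a ha)
    · rw [Sprv.comap_le, map_one, hgT]
      exact y.2.le_of_mem_plus _ _ (hm' x)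
  · exact Hom.ext (RingHom.ext hgC)

/-! ### Representability of rational subspaces -/

/-- The morphism to the relative algebra with one generator `T` of degree `q` and the relation
`b T = a`. -/
abbrev fractionAffinoid (A : AffinoidBanachRing.{u}) (q : PosReal) (a b : A.carrier) :
    AffinoidBanachRing.{u} :=
  A.gaussAffinoid (powersHom PosReal q) (fractionIdeal q a b)

/-- The structure morphism of `fractionAffinoid`. -/
abbrev toFraction (A : AffinoidBanachRing.{u}) (q : PosReal) (a b : A.carrier) :
    Hom A (A.fractionAffinoid q a b) :=
  A.toGauss (powersHom PosReal q) (fractionIdeal q a b)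

theorem Hom.spra_le {B C : AffinoidBanachRing.{u}} (f : Hom B C) (y : Spra C) (a b : B.carrier)
    (q : PosReal) : (f.spra y).1.Le a q b ↔ y.1.Le (f.toRingHom a) q (f.toRingHom b) :=
  Sprv.comap_le _ _ _ _ _

theorem Hom.spra_eqZero {B C : AffinoidBanachRing.{u}} (f : Hom B C) (y : Spra C) (a : B.carrier) :
    (f.spra y).1.EqZero a ↔ y.1.EqZero (f.toRingHom a) :=
  Sprv.comap_eqZero _ _ _

theorem le_pow {B : Type u} [CommRing B] {x : Sprv B} {t : B} {q : PosReal} (h : x.Le t q 1)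
    (n : ℕ) : x.Le (t ^ n) (q ^ n) 1 := by
  induction n with
  | zero => simpa using x.le_refl 1
  | succ n ih => simpa [pow_succ] using ih.mul h

/-- Morphisms to affinoid Banach rings over which `v(a) ≤ q v(b) ≠ 0` factor through
`fractionAffinoid`. -/
theorem exists_hom_fractionAffinoid {D : AffinoidBanachRing.{u}} (ψ : Hom A D) {a b : A.carrier}
    {q : PosReal} (hle : ∀ y : Spra D, y.1.Le (ψ.toRingHom a) q (ψ.toRingHom b))
    (hne : ∀ y : Spra D, ¬ y.1.EqZero (ψ.toRingHom b)) :
    ∃! g : Hom (A.fractionAffinoid q a b) D, g.comp (A.toFraction q a b) = ψ := by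
  have hu : IsUnit (ψ.toRingHom b) := isUnit_of_forall_ne_zero hne
  obtain ⟨c, hc⟩ := hu.exists_left_inv
  obtain ⟨t, htb⟩ : ∃ t, t * ψ.toRingHom b = ψ.toRingHom a :=
    ⟨ψ.toRingHom a * c, by rw [mul_assoc, hc, mul_one]⟩
  have htle : ∀ y : Spra D, y.1.Le t q 1 := fun y =>
    Sprv.Le.cancel (hne y) (by rw [htb, one_mul]; exact hle y)
  have hpow : ∀ n : ℕ, t ^ n ∈ D.plus (q ^ n) := fun n =>
    mem_plus_of_forall_le fun y => le_pow (htle y) n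
  have ht1 : t ∈ D.plus q := mem_plus_of_forall_le htle
  obtain ⟨K, hK, hKn⟩ := exists_norm_pow_le_of_isPowBounded ht1.1
  obtain ⟨g, hg, hgT⟩ := exists_hom_gaussAffinoid (w := powersHom PosReal q)
    (I := fractionIdeal q a b) ψ (powersHom D.carrier t) hK (fun x => hKn x.toAdd)
    (fun x => hpow x.toAdd) (by
      intro p hp
      obtain ⟨u, rfl⟩ := Ideal.mem_span_singleton'.1 hp
      rw [map_mul, map_sub, map_mul (GaussAlgebra.lift _ _) (C _ _ b), lift_C, lift_C, lift_T]
      have : powersHom D.carrier t (Multiplicative.ofAdd 1) = t := pow_one t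
      rw [this, mul_comm (ψ.toRingHom b), htb, sub_self, mul_zero])
  refine ⟨g, hg, fun g' hg' => ?_⟩
  have key : ∀ g : Hom (A.fractionAffinoid q a b) D, g.comp (A.toFraction q a b) = ψ →
      g.toRingHom (A.gaussMap _ (fractionIdeal q a b) (T A.carrier _ (Multiplicative.ofAdd 1))) =
        t := by
    intro g hg
    have h1 := gaussMap_eq_zero (A := A) (I := fractionIdeal q a b)
      (Ideal.mem_span_singleton_self _)
    have h2 := congrArg g.toRingHom h1
    have h3 : ∀ d, g.toRingHom (A.gaussMap _ (fractionIdeal q a b) (C A.carrier _ d)) =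
        ψ.toRingHom d := fun d => congrArg (fun h : Hom A D => h.toRingHom d) hg
    rw [map_sub, map_mul, map_sub, map_mul, map_zero, h3, h3, sub_eq_zero] at h2
    rw [← hu.mul_right_inj, h2, mul_comm, htb]
  refine gauss_hom_ext (hg'.trans hg.symm) fun x => ?_
  rw [ofAdd_one_pow x, map_pow, map_pow, map_pow, map_pow, key g hg, key g' hg']

end AffinoidBanachRing

namespace AffinoidBanachRing

open GaussAlgebra

variable {A B C : AffinoidBanachRing.{u}}

theorem Hom.spra_comp (g : Hom B C) (f : Hom A B) (y : Spra C) :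
    (g.comp f).spra y = f.spra (g.spra y) := by
  obtain ⟨y, hy⟩ := y
  refine Subtype.ext ?_
  induction y using Quotient.inductionOn
  rfl

theorem gaussMap_fractionIdeal (q : PosReal) (a b : A.carrier) :
    (A.toFraction q a b).toRingHom b *
      A.gaussMap _ (fractionIdeal q a b) (T A.carrier _ (Multiplicative.ofAdd 1)) =
        (A.toFraction q a b).toRingHom a := by
  have h1 := gaussMap_eq_zero (A := A) (I := fractionIdeal q a b)
    (Ideal.mem_span_singleton_self _)
  rw [map_sub, map_mul, sub_eq_zero] at h1
  exact h1

/-- Over `fractionAffinoid` the inequality `v(a) ≤ q v(b)` holds. -/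
theorem le_fractionAffinoid (q : PosReal) (a b : A.carrier) (y : Spra (A.fractionAffinoid q a b)) :
    y.1.Le ((A.toFraction q a b).toRingHom a) q ((A.toFraction q a b).toRingHom b) := by
  have hT : y.1.Le (A.gaussMap _ (fractionIdeal q a b) (T A.carrier _ (Multiplicative.ofAdd 1)))
      (powersHom PosReal q (Multiplicative.ofAdd 1)) 1 :=
    y.2.le_of_mem_plus _ _ (gaussMap_T_mem_plus _)
  have h := (y.1.le_refl ((A.toFraction q a b).toRingHom b)).mul hT
  rw [gaussMap_fractionIdeal, one_mul, mul_one] at h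
  exact h.mono (pow_one q).le

theorem not_eqZero_fractionAffinoid {q : PosReal} {a b : A.carrier} (hab : IsCoprime a b)
    (y : Spra (A.fractionAffinoid q a b)) :
    ¬ y.1.EqZero ((A.toFraction q a b).toRingHom b) := fun hb => by
  have ha := (le_fractionAffinoid q a b y).eqZero hb
  obtain ⟨c, d, hcd⟩ := hab
  refine Sprv.not_eqZero_one (x := y.1) ?_
  rw [← map_one (A.toFraction q a b).toRingHom, ← hcd, map_add, map_mul, map_mul]
  exact Sprv.eqZero_add (Sprv.eqZero_mul_left ha _) (Sprv.eqZero_mul_left hb _)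

/-- If `a` and `b` generate the unit ideal, then `fractionAffinoid` represents the subspace
`v(a) ≤ q v(b)`. -/
theorem represents_toFraction {q : PosReal} {a b : A.carrier} (hab : IsCoprime a b) :
    Represents (A.toFraction q a b) {x | x.1.Le a q b ∧ ¬ x.1.EqZero b} where
  range_subset := by
    rintro _ ⟨y, rfl⟩
    exact ⟨(Hom.spra_le _ _ _ _ _).2 (le_fractionAffinoid q a b y), fun h =>
      not_eqZero_fractionAffinoid hab y ((Hom.spra_eqZero _ _ _).1 h)⟩
  existsUnique D ψ h := exists_hom_fractionAffinoid ψ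
    (fun y => (Hom.spra_le _ _ _ _ _).1 (h ⟨y, rfl⟩).1)
    (fun y hy => (h ⟨y, rfl⟩).2 ((Hom.spra_eqZero _ _ _).2 hy))

theorem isReallyStronglyNoetherian_fractionAffinoid (hA : IsReallyStronglyNoetherian A.carrier)
    (q : PosReal) (a b : A.carrier) :
    IsReallyStronglyNoetherian (A.fractionAffinoid q a b).carrier :=
  isReallyStronglyNoetherian_gaussAffinoid hA

/-- Representability of intersections: first localize to `V`, then to the preimage of `W`. -/
theorem Represents.comp {φ : Hom A B} {V W : Set (Spra A)} (h : Represents φ V) {χ : Hom B C}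
    (h' : Represents χ (φ.spra ⁻¹' W)) : Represents (χ.comp φ) (V ∩ W) where
  range_subset := by
    rintro _ ⟨y, rfl⟩
    rw [Hom.spra_comp]
    exact ⟨h.range_subset ⟨_, rfl⟩, h'.range_subset ⟨y, rfl⟩⟩
  existsUnique D ψ hψ := by
    obtain ⟨g, hg, hg'⟩ := h.existsUnique D ψ (hψ.trans Set.inter_subset_left)
    obtain ⟨k, hk, hk'⟩ := h'.existsUnique D g (by
      rintro _ ⟨y, rfl⟩
      change φ.spra (g.spra y) ∈ W
      rw [← Hom.spra_comp, hg]
      exact (hψ ⟨y, rfl⟩).2)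
    refine ⟨k, ?_, fun k₂ hk₂ => hk' k₂ (hg' (k₂.comp χ) hk₂)⟩
    change (k.comp χ).comp φ = ψ
    rw [hk, hg]

/-- Morphisms representing the same subspace have isomorphic targets. -/
theorem Represents.exists_iso {φ : Hom A B} {φ' : Hom A C} {V : Set (Spra A)}
    (h : Represents φ V) (h' : Represents φ' V) :
    ∃ (g : Hom B C) (g' : Hom C B), g.comp φ = φ' ∧ g'.comp φ' = φ ∧
      ∀ c, g.toRingHom (g'.toRingHom c) = c := by
  obtain ⟨g, hg, -⟩ := h.existsUnique C φ' h'.range_subset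
  obtain ⟨g', hg', -⟩ := h'.existsUnique B φ h.range_subset
  refine ⟨g, g', hg, hg', fun c => ?_⟩
  have e := (h'.existsUnique C φ' h'.range_subset).unique (y₁ := g.comp g') (y₂ := Hom.id C)
    (show g.comp (g'.comp φ') = φ' by rw [hg', hg]) rfl
  exact congrArg (fun k : Hom C C => k.toRingHom c) e

theorem Represents.isReallyStronglyNoetherian {φ : Hom A B} {φ' : Hom A C} {V : Set (Spra A)}
    (h : Represents φ V) (h' : Represents φ' V) (hB : IsReallyStronglyNoetherian B.carrier) :
    IsReallyStronglyNoetherian C.carrier := by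
  obtain ⟨g, g', -, -, hgg⟩ := h.exists_iso h'
  obtain ⟨c, hc, hg⟩ := g.bounded
  obtain ⟨c', hc', hg'⟩ := g'.bounded
  have hK : ∀ p, ‖GaussAlgebra.lift (w := (1 : Multiplicative ℕ →* PosReal)) g.toRingHom 1 p‖ ≤
      c * ‖(1 : C.carrier)‖ * ‖p‖ :=
    norm_lift_le _ _ hc.le (norm_nonneg _) hg fun x => by simp
  refine hB.of_approx (1 : Multiplicative ℕ →* PosReal) _ (by positivity) hK hc'.le
    fun b ε hε => ⟨GaussAlgebra.C B.carrier 1 (g'.toRingHom b), ?_, ?_⟩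
  · rw [norm_C]
    exact hg' b
  · rw [lift_C, hgg, sub_self, norm_zero]
    exact hε.le

/-! ### Gluing on simple Laurent coverings -/

/-- An element of each of the two rings of a simple Laurent covering, with the same image on the
annulus, come from a unique element. -/
theorem exists_laurent_annulus (hA : IsReallyStronglyNoetherian A.carrier) (f : A.carrier)
    (q : PosReal) :
    ∃ (Z : AffinoidBanachRing.{u}) (χ₁ : Hom (A.fractionAffinoid q f 1) Z)
      (χ₂ : Hom (A.fractionAffinoid q⁻¹ 1 f) Z),
      IsReallyStronglyNoetherian Z.carrier ∧
      χ₁.comp (A.toFraction q f 1) = χ₂.comp (A.toFraction q⁻¹ 1 f) ∧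
      ∀ b₁ b₂, χ₁.toRingHom b₁ = χ₂.toRingHom b₂ →
        ∃! a, (A.toFraction q f 1).toRingHom a = b₁ ∧ (A.toFraction q⁻¹ 1 f).toRingHom a = b₂ := by
  set φ := A.toGauss (zpowersHom PosReal q) (annulusIdeal f q) with hφ
  have hT : φ.toRingHom f = A.gaussMap _ (annulusIdeal f q)
      (T A.carrier _ (Multiplicative.ofAdd 1)) := by
    have h := gaussMap_eq_zero (A := A) (I := annulusIdeal f q) (Ideal.mem_span_singleton_self _)
    rw [map_sub, sub_eq_zero] at h
    exact h.symm
  have hle : ∀ y : Spra _, y.1.Le (φ.toRingHom f) q (φ.toRingHom 1) := fun y => by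
    have h := y.2.le_of_mem_plus _ _
      (gaussMap_T_mem_plus (A := A) (I := annulusIdeal f q) (Multiplicative.ofAdd 1))
    rw [hT, map_one φ.toRingHom]
    exact h.mono (zpow_one q).le
  have hle' : ∀ y : Spra _, y.1.Le (φ.toRingHom 1) q⁻¹ (φ.toRingHom f) := fun y => by
    have h := y.2.le_of_mem_plus _ _
      (gaussMap_T_mem_plus (A := A) (I := annulusIdeal f q) (Multiplicative.ofAdd (-1)))
    have h2 := (y.1.le_refl (φ.toRingHom f)).mul h
    rw [hT, mul_one, ← map_mul, T_mul_T_neg,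
      map_one (A.gaussMap _ _), one_mul] at h2
    rw [hT, map_one φ.toRingHom]
    exact h2.mono (zpow_neg_one q).le
  obtain ⟨χ₁, h₁, -⟩ := exists_hom_fractionAffinoid (a := f) (b := 1) φ hle
    (fun y => by rw [map_one]; exact Sprv.not_eqZero_one)
  obtain ⟨χ₂, h₂, -⟩ := exists_hom_fractionAffinoid (a := 1) (b := f) φ hle'
    (fun y => by
      have := hle' y
      rw [map_one] at this
      exact Sprv.not_eqZero_of_one_le this)
  refine ⟨_, χ₁, χ₂, isReallyStronglyNoetherian_gaussAffinoid hA, h₁.trans h₂.symm, fun b₁ b₂ hb => ?_⟩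
  obtain ⟨c₁, hc₁, hχ₁⟩ := χ₁.bounded
  obtain ⟨c₂, hc₂, hχ₂⟩ := χ₂.bounded
  obtain ⟨a, ha⟩ := hA.exists_of_agree (f := f) (q := q) rfl rfl rfl χ₁.toRingHom χ₂.toRingHom
    (c := max c₁ c₂) (hc₁.le.trans (le_max_left _ _))
    (fun b => (hχ₁ b).trans (mul_le_mul_of_nonneg_right (le_max_left _ _) (norm_nonneg _)))
    (fun b => (hχ₂ b).trans (mul_le_mul_of_nonneg_right (le_max_right _ _) (norm_nonneg _)))
    (fun a => congrArg (fun h : Hom A _ => h.toRingHom a) h₁)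
    (fun a => congrArg (fun h : Hom A _ => h.toRingHom a) h₂) hb
  refine ⟨a, ha, fun a' ha' => ?_⟩
  obtain ⟨K, -, hK⟩ := hA.exists_norm_le_max f q
  have h := hK (a' - a)
  have e₁ : GaussQuotient.of (fractionIdeal q f 1) (C A.carrier _ (a' - a)) = 0 := by
    rw [map_sub, map_sub, sub_eq_zero]
    exact ha'.1.trans ha.1.symm
  have e₂ : GaussQuotient.of (fractionIdeal q⁻¹ 1 f) (C A.carrier _ (a' - a)) = 0 := by
    rw [map_sub, map_sub, sub_eq_zero]
    exact ha'.2.trans ha.2.symm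
  rw [e₁, e₂, norm_zero, norm_zero, max_self, mul_zero] at h
  exact sub_eq_zero.1 (norm_le_zero_iff.1 h)

end AffinoidBanachRing

/-! ### Rational subspaces -/

namespace AffinoidBanachRing

variable {A B : AffinoidBanachRing.{u}}

/-- The subspace `{v : v(1) ≤ ρ v(b), v(f) ≤ q v(b) for (f, q) ∈ l}`. All rational subspaces have
this form: the condition `v(b) ≠ 0` is made explicit by the first inequality. -/
def ratSet (l : List (A.carrier × PosReal)) (b : A.carrier) (ρ : PosReal) : Set (Spra A) :=
  {x | x.1.Le 1 ρ b ∧ ∀ p ∈ l, x.1.Le p.1 p.2 b}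

theorem not_eqZero_of_mem_ratSet {l : List (A.carrier × PosReal)} {b : A.carrier} {ρ : PosReal}
    {x : Spra A} (hx : x ∈ ratSet l b ρ) : ¬ x.1.EqZero b :=
  Sprv.not_eqZero_of_one_le hx.1

theorem le_norm_add_one (x : Spra A) (a : A.carrier) :
    x.1.Le a ⟨‖a‖ + 1, by positivity⟩ 1 :=
  x.2.isBounded _ _ (isTopNilpotent_of_norm_lt (lt_add_one ‖a‖))

theorem IsRational.exists_ratSet {V : Set (Spra A)} (hV : IsRational V) :
    ∃ l b ρ, V = ratSet l b ρ := by
  obtain ⟨n, f₀, f, q, hf, rfl⟩ := hV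
  obtain ⟨c, hc⟩ := (Ideal.mem_span_range_iff_exists_fun
    (x := (1 : A.carrier)) (v := f)).1 (hf ▸ Submodule.mem_top)
  let r : Fin n → PosReal := fun i => ⟨‖c i‖ + 1, by positivity⟩
  obtain ⟨ρ, hρ⟩ := (Finset.univ.image fun i => r i * q i).exists_le
  refine ⟨List.ofFn fun i => (f i, q i), f₀, ρ, ?_⟩
  ext x
  constructor
  · intro hx
    refine ⟨?_, fun p hp => ?_⟩
    · rw [← hc]
      refine Sprv.Le.sum fun i _ => ?_
      have h := (le_norm_add_one x (c i)).mul (hx i).1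
      rw [one_mul] at h
      exact h.mono (hρ _ (Finset.mem_image_of_mem _ (Finset.mem_univ i)))
    · obtain ⟨i, rfl⟩ := (List.mem_ofFn' _ _).1 hp
      exact (hx i).1
  · intro hx i
    exact ⟨hx.2 (f i, q i) ((List.mem_ofFn' _ _).2 ⟨i, rfl⟩), not_eqZero_of_mem_ratSet hx⟩

/-- The unit ideal condition holds because the function `1` is among the numerators. -/
theorem isRational_ratSet (l : List (A.carrier × PosReal)) (b : A.carrier) (ρ : PosReal) :
    IsRational (ratSet l b ρ) := by
  refine ⟨((1, ρ) :: l).length, b, fun i => (((1, ρ) :: l).get i).1,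
    fun i => (((1, ρ) :: l).get i).2, ?_, ?_⟩
  · exact (Ideal.eq_top_iff_one _).2 (Ideal.subset_span ⟨⟨0, by simp⟩, rfl⟩)
  · ext x
    constructor
    · intro hx i
      refine ⟨?_, not_eqZero_of_mem_ratSet hx⟩
      rcases List.mem_cons.1 (List.get_mem ((1, ρ) :: l) i) with h | h
      · change x.1.Le (((1, ρ) :: l).get i).1 (((1, ρ) :: l).get i).2 b
        rw [h]
        exact hx.1
      · exact hx.2 _ h
    · intro hx
      refine ⟨(hx ⟨0, by simp⟩).1, fun p hp => ?_⟩
      obtain ⟨i, hi⟩ := List.get_of_mem (List.mem_cons_of_mem (1, ρ) hp)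
      rw [← hi]
      exact (hx i).1

theorem exists_ratSet_inter (l l' : List (A.carrier × PosReal)) (b b' : A.carrier)
    (ρ ρ' : PosReal) : ∃ m c σ, ratSet l b ρ ∩ ratSet l' b' ρ' = ratSet m c σ := by
  refine ⟨((1, ρ) :: l).map (fun p => (p.1 * b', p.2)) ++
    ((1, ρ') :: l').map (fun p => (p.1 * b, p.2)), b * b', ρ * ρ', ?_⟩
  ext x
  constructor
  · rintro ⟨hx, hx'⟩
    refine ⟨by simpa using hx.1.mul hx'.1, fun p hp => ?_⟩
    rcases List.mem_append.1 hp with hp | hp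
    · obtain ⟨s, hs, rfl⟩ := List.mem_map.1 hp
      have h : x.1.Le s.1 s.2 b := by
        rcases List.mem_cons.1 hs with rfl | hs
        exacts [hx.1, hx.2 s hs]
      simpa using h.mul (x.1.le_refl b')
    · obtain ⟨s, hs, rfl⟩ := List.mem_map.1 hp
      have h : x.1.Le s.1 s.2 b' := by
        rcases List.mem_cons.1 hs with rfl | hs
        exacts [hx'.1, hx'.2 s hs]
      simpa [mul_comm b b'] using h.mul (x.1.le_refl b)
  · intro hx
    have hne := not_eqZero_of_mem_ratSet hx
    have hb : ¬ x.1.EqZero b := fun h => hne (by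
      rw [mul_comm]
      exact Sprv.eqZero_mul_left h _)
    have hb' : ¬ x.1.EqZero b' := fun h => hne (Sprv.eqZero_mul_left h _)
    have h1 : ∀ s ∈ (1, ρ) :: l, x.1.Le s.1 s.2 b := fun s hs =>
      Sprv.Le.cancel hb' (hx.2 _ (List.mem_append_left _ (List.mem_map_of_mem hs)))
    have h2 : ∀ s ∈ (1, ρ') :: l', x.1.Le s.1 s.2 b' := fun s hs =>
      Sprv.Le.cancel hb (by
        rw [mul_comm b' b]
        exact hx.2 _ (List.mem_append_right _ (List.mem_map_of_mem hs)))
    exact ⟨⟨h1 _ List.mem_cons_self, fun s hs => h1 s (List.mem_cons_of_mem _ hs)⟩,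
      h2 _ List.mem_cons_self, fun s hs => h2 s (List.mem_cons_of_mem _ hs)⟩

theorem IsRational.inter {V W : Set (Spra A)} (hV : IsRational V) (hW : IsRational W) :
    IsRational (V ∩ W) := by
  obtain ⟨l, b, ρ, rfl⟩ := hV.exists_ratSet
  obtain ⟨l', b', ρ', rfl⟩ := hW.exists_ratSet
  obtain ⟨m, c, σ, h⟩ := exists_ratSet_inter l l' b b' ρ ρ'
  rw [h]
  exact isRational_ratSet m c σ

theorem preimage_ratSet (φ : Hom A B) (l : List (A.carrier × PosReal)) (b : A.carrier)
    (ρ : PosReal) : φ.spra ⁻¹' ratSet l b ρ =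
      ratSet (l.map fun p => (φ.toRingHom p.1, p.2)) (φ.toRingHom b) ρ := by
  ext y
  change (φ.spra y).1.Le 1 ρ b ∧ (∀ p ∈ l, (φ.spra y).1.Le p.1 p.2 b) ↔
    y.1.Le 1 ρ (φ.toRingHom b) ∧ ∀ p ∈ l.map (fun p => (φ.toRingHom p.1, p.2)),
      y.1.Le p.1 p.2 (φ.toRingHom b)
  simp only [Hom.spra_le, map_one, List.forall_mem_map]

theorem isOpen_le (a b : A.carrier) (q : PosReal) :
    IsOpen {x : Spra A | x.1.Le a q b ∧ ¬ x.1.EqZero b} :=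
  (TopologicalSpace.isOpen_generateFrom_of_mem ⟨a, b, q, rfl⟩ :
    IsOpen {x : Sprv A.carrier | x.Le a q b ∧ ¬ x.EqZero b}).preimage continuous_subtype_val

theorem isOpen_ratSet (l : List (A.carrier × PosReal)) (b : A.carrier) (ρ : PosReal) :
    IsOpen (ratSet l b ρ) := by
  have e : ratSet l b ρ = ⋂ p ∈ {p | p ∈ (1, ρ) :: l},
      {x : Spra A | x.1.Le p.1 p.2 b ∧ ¬ x.1.EqZero b} := by
    ext x
    simp only [Set.mem_iInter]
    constructor
    · intro hx p hp
      refine ⟨?_, not_eqZero_of_mem_ratSet hx⟩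
      rcases List.mem_cons.1 hp with rfl | hp
      exacts [hx.1, hx.2 p hp]
    · intro hx
      exact ⟨(hx _ List.mem_cons_self).1, fun p hp => (hx p (List.mem_cons_of_mem _ hp)).1⟩
  rw [e]
  exact (List.finite_toSet _).isOpen_biInter fun p _ => isOpen_le _ _ _

/-- Rational subspaces form a base: here coinitiality bounds `v(b)⁻¹` by a real number. -/
theorem exists_ratSet_subset {U : Set (Spra A)} (hU : IsOpen U) {x : Spra A} (hx : x ∈ U) :
    ∃ l b ρ, x ∈ ratSet l b ρ ∧ ratSet l b ρ ⊆ U := by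
  obtain ⟨V, hV, rfl⟩ := hU
  change x.1 ∈ V at hx
  induction hV with
  | basic s hs =>
    obtain ⟨a, b, q, rfl⟩ := hs
    obtain ⟨ρ, hρ⟩ := x.2.isCoinitial.exists_one_le hx.2
    refine ⟨[(a, q)], b, ρ, ⟨hρ, fun p hp => ?_⟩, fun y hy => ?_⟩
    · rw [List.mem_singleton.1 hp]
      exact hx.1
    · exact ⟨hy.2 _ List.mem_cons_self, not_eqZero_of_mem_ratSet hy⟩
  | univ => exact ⟨[], 1, 1, ⟨x.1.le_refl 1, by simp⟩, fun _ _ => trivial⟩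
  | inter s t _ _ hs ht =>
    obtain ⟨l, b, ρ, h1, h2⟩ := hs hx.1
    obtain ⟨l', b', ρ', h1', h2'⟩ := ht hx.2
    obtain ⟨m, c, σ, h⟩ := exists_ratSet_inter l l' b b' ρ ρ'
    refine ⟨m, c, σ, h ▸ ⟨h1, h1'⟩, ?_⟩
    rw [← h]
    exact fun y hy => ⟨h2 hy.1, h2' hy.2⟩
  | sUnion S _ ih =>
    obtain ⟨s, hs, hxs⟩ := hx
    obtain ⟨l, b, ρ, h1, h2⟩ := ih s hs hxs
    exact ⟨l, b, ρ, h1, fun y hy => ⟨s, hs, h2 hy⟩⟩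

/-- Rational subspaces are represented by really strongly noetherian rings: impose the inequalities
one at a time. The function `b` is invertible after the first step. -/
theorem exists_represents_ratSet (hA : IsReallyStronglyNoetherian A.carrier)
    (l : List (A.carrier × PosReal)) (b : A.carrier) (ρ : PosReal) :
    ∃ (B : AffinoidBanachRing.{u}) (φ : Hom A B), Represents φ (ratSet l b ρ) ∧
      IsReallyStronglyNoetherian B.carrier := by
  induction l with
  | nil =>
    refine ⟨_, A.toFraction ρ 1 b, ?_, isReallyStronglyNoetherian_fractionAffinoid hA _ _ _⟩
    have e : ratSet [] b ρ = {x : Spra A | x.1.Le 1 ρ b ∧ ¬ x.1.EqZero b} := by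
      ext x
      exact ⟨fun hx => ⟨hx.1, not_eqZero_of_mem_ratSet hx⟩, fun hx => ⟨hx.1, by simp⟩⟩
    rw [e]
    exact represents_toFraction isCoprime_one_left
  | cons p l ih =>
    obtain ⟨B, φ, hφ, hB⟩ := ih
    have hu : IsUnit (φ.toRingHom b) := isUnit_of_forall_ne_zero fun y hy =>
      not_eqZero_of_mem_ratSet (hφ.range_subset ⟨y, rfl⟩) ((Hom.spra_eqZero _ _ _).2 hy)
    refine ⟨_, (B.toFraction p.2 (φ.toRingHom p.1) (φ.toRingHom b)).comp φ, ?_,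
      isReallyStronglyNoetherian_fractionAffinoid hB _ _ _⟩
    have e : ratSet (p :: l) b ρ =
        ratSet l b ρ ∩ {x : Spra A | x.1.Le p.1 p.2 b ∧ ¬ x.1.EqZero b} := by
      ext x
      constructor
      · intro hx
        exact ⟨⟨hx.1, fun s hs => hx.2 s (List.mem_cons_of_mem _ hs)⟩, hx.2 p List.mem_cons_self,
          not_eqZero_of_mem_ratSet hx⟩
      · rintro ⟨hx, hp⟩
        refine ⟨hx.1, fun s hs => ?_⟩
        rcases List.mem_cons.1 hs with rfl | hs
        exacts [hp.1, hx.2 s hs]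
    rw [e]
    refine hφ.comp ?_
    have e' : φ.spra ⁻¹' {x : Spra A | x.1.Le p.1 p.2 b ∧ ¬ x.1.EqZero b} =
        {y : Spra B | y.1.Le (φ.toRingHom p.1) p.2 (φ.toRingHom b) ∧
          ¬ y.1.EqZero (φ.toRingHom b)} := by
      ext y
      exact and_congr (Hom.spra_le _ _ _ _ _) (not_congr (Hom.spra_eqZero _ _ _))
    rw [e']
    obtain ⟨c, hc⟩ := hu.exists_left_inv
    exact represents_toFraction ⟨0, c, by rw [zero_mul, zero_add, hc]⟩

theorem RationalLocalization.isReallyStronglyNoetherian (hA : IsReallyStronglyNoetherian A.carrier)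
    {U : Set (Spra A)} (L : RationalLocalization A U) :
    IsReallyStronglyNoetherian L.B.carrier := by
  obtain ⟨V, hV, -, hL⟩ := L.exists_represents
  obtain ⟨l, b, ρ, rfl⟩ := hV.exists_ratSet
  obtain ⟨B, φ, hφ, hB⟩ := exists_represents_ratSet hA l b ρ
  exact hφ.isReallyStronglyNoetherian hL hB

theorem subsingleton_of_isEmpty_spra (h : IsEmpty (Spra A)) : Subsingleton A.carrier :=
  isUnit_zero_iff.1 (isUnit_of_forall_ne_zero fun x => h.elim x) |> subsingleton_of_zero_eq_one

end AffinoidBanachRing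

/-! ### Reduction of coverings to simple Laurent coverings -/

namespace AffinoidBanachRing

variable {A B C : AffinoidBanachRing.{u}}

/-- A property of morphisms out of `A` which holds for `χ : A → C`, with `C` really strongly
noetherian, as soon as it holds over both pieces `v(f) ≤ q` and `v(f) ≥ q` of a simple Laurent
covering of `Spra(C)`. -/
def IsLaurentLocal (P : ∀ {C : AffinoidBanachRing.{u}}, Hom A C → Prop) : Prop :=
  ∀ ⦃C : AffinoidBanachRing.{u}⦄ (χ : Hom A C), IsReallyStronglyNoetherian C.carrier →
    ∀ (f : C.carrier) (q : PosReal), P ((C.toFraction q f 1).comp χ) →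
      P ((C.toFraction q⁻¹ 1 f).comp χ) → P χ

theorem Hom.le_of_forall_le (ψ : Hom B C) {a b : B.carrier} {q : PosReal}
    (h : ∀ y : Spra B, y.1.Le a q b) (y : Spra C) :
    y.1.Le (ψ.toRingHom a) q (ψ.toRingHom b) :=
  (Hom.spra_le ψ y a b q).1 (h _)

theorem le_laurent_left (f : C.carrier) (q : PosReal) (y : Spra (C.fractionAffinoid q f 1)) :
    y.1.Le ((C.toFraction q f 1).toRingHom f) q 1 := by
  have h := le_fractionAffinoid q f 1 y
  rwa [map_one (C.toFraction q f 1).toRingHom] at h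

theorem le_laurent_right (f : C.carrier) (q : PosReal) (y : Spra (C.fractionAffinoid q⁻¹ 1 f)) :
    y.1.Le 1 q⁻¹ ((C.toFraction q⁻¹ 1 f).toRingHom f) := by
  have h := le_fractionAffinoid q⁻¹ 1 f y
  rwa [map_one (C.toFraction q⁻¹ 1 f).toRingHom] at h

/-- The inductive step of `of_forall_maximum` once one of the functions is not small: the list `l`
consists of the functions not yet compared with the largest one found. -/
theorem of_maximum_of_subset
    {P : ∀ {C : AffinoidBanachRing.{u}}, Hom A C → Prop} (hP : IsLaurentLocal P)
    (L : List (A.carrier × PosReal)) (ρ : PosReal)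
    (h₁ : ∀ {C : AffinoidBanachRing.{u}} (χ : Hom A C), IsReallyStronglyNoetherian C.carrier →
      ∀ p₀ ∈ L, (∀ y : Spra C, y.1.Le 1 (ρ * p₀.2)⁻¹ (χ.toRingHom p₀.1)) →
      (∀ p ∈ L, ∀ y : Spra C, y.1.Le (χ.toRingHom p.1) (p.2 / p₀.2) (χ.toRingHom p₀.1)) → P χ)
    (l : List (A.carrier × PosReal)) (hl : ∀ p ∈ l, p ∈ L)
    {C : AffinoidBanachRing.{u}} (χ : Hom A C) (hC : IsReallyStronglyNoetherian C.carrier)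
    {p₀ : A.carrier × PosReal} (hp₀ : p₀ ∈ L)
    (hlow : ∀ y : Spra C, y.1.Le 1 (ρ * p₀.2)⁻¹ (χ.toRingHom p₀.1))
    (hmax : ∀ p ∈ L, p ∈ l ∨
      ∀ y : Spra C, y.1.Le (χ.toRingHom p.1) (p.2 / p₀.2) (χ.toRingHom p₀.1)) : P χ := by
  induction l generalizing C p₀ with
  | nil => exact h₁ χ hC p₀ hp₀ hlow fun p hp => (hmax p hp).resolve_left List.not_mem_nil
  | cons F l ih =>
    have ih := @ih (fun p hp => hl p (List.mem_cons_of_mem _ hp))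
    obtain ⟨c, hc⟩ := (isUnit_of_forall_ne_zero fun y =>
      Sprv.not_eqZero_of_one_le (hlow y)).exists_left_inv
    have hcF : χ.toRingHom F.1 * c * χ.toRingHom p₀.1 = χ.toRingHom F.1 := by
      rw [mul_assoc, hc, mul_one]
    refine hP χ hC (χ.toRingHom F.1 * c) (F.2 / p₀.2) ?_ ?_
    · set ι := C.toFraction (F.2 / p₀.2) (χ.toRingHom F.1 * c) 1
      refine ih (ι.comp χ) (isReallyStronglyNoetherian_fractionAffinoid hC _ _ _) hp₀
        (fun y => ?_) fun p hp => ?_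
      · rw [← map_one ι.toRingHom]
        exact ι.le_of_forall_le hlow y
      · rcases hmax p hp with h | h
        · rcases List.mem_cons.1 h with rfl | h
          · refine Or.inr fun y => ?_
            have h := (le_laurent_left _ _ y).mul (y.1.le_refl (ι.toRingHom (χ.toRingHom p₀.1)))
            rw [← map_mul, hcF, one_mul, mul_one] at h
            exact h
          · exact Or.inl h
        · exact Or.inr fun y => ι.le_of_forall_le h y
    · set ι := C.toFraction (F.2 / p₀.2)⁻¹ 1 (χ.toRingHom F.1 * c)
      have hF : ∀ y : Spra _, y.1.Le (ι.toRingHom (χ.toRingHom p₀.1)) (p₀.2 / F.2)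
          (ι.toRingHom (χ.toRingHom F.1)) := fun y => by
        have h := (le_laurent_right _ _ y).mul (y.1.le_refl (ι.toRingHom (χ.toRingHom p₀.1)))
        rw [← map_mul, hcF, one_mul, mul_one] at h
        exact h.mono (inv_div _ _).le
      refine ih (ι.comp χ) (isReallyStronglyNoetherian_fractionAffinoid hC _ _ _)
        (hl F List.mem_cons_self) (fun y => ?_) fun p hp => ?_
      · have h := (ι.le_of_forall_le hlow y).trans (hF y)
        rw [map_one] at h
        have e : (ρ * p₀.2)⁻¹ * (p₀.2 / F.2) = (ρ * F.2)⁻¹ := by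
          rw [mul_inv, mul_assoc, div_eq_mul_inv, inv_mul_cancel_left, ← mul_inv]
        exact h.mono e.le
      · have key : (∀ y : Spra C, y.1.Le (χ.toRingHom p.1) (p.2 / p₀.2) (χ.toRingHom p₀.1)) →
            ∀ y : Spra (C.fractionAffinoid (F.2 / p₀.2)⁻¹ 1 (χ.toRingHom F.1 * c)),
            y.1.Le ((ι.comp χ).toRingHom p.1) (p.2 / F.2) ((ι.comp χ).toRingHom F.1) := by
          intro h y
          have h := (ι.le_of_forall_le h y).trans (hF y)
          rwa [div_mul_div_cancel] at h
        rcases hmax p hp with h | h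
        · rcases List.mem_cons.1 h with rfl | h
          · refine Or.inr fun y => ?_
            rw [div_self']
            exact y.1.le_refl _
          · exact Or.inl h
        · exact Or.inr (key h)

/-- A Laurent-local property may be checked where either all functions of a list are small or one
of them is everywhere the largest one. -/
theorem of_forall_maximum
    {P : ∀ {C : AffinoidBanachRing.{u}}, Hom A C → Prop} (hP : IsLaurentLocal P)
    (L : List (A.carrier × PosReal)) (ρ : PosReal)
    (h₁ : ∀ {C : AffinoidBanachRing.{u}} (χ : Hom A C), IsReallyStronglyNoetherian C.carrier →
      ∀ p₀ ∈ L, (∀ y : Spra C, y.1.Le 1 (ρ * p₀.2)⁻¹ (χ.toRingHom p₀.1)) →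
      (∀ p ∈ L, ∀ y : Spra C, y.1.Le (χ.toRingHom p.1) (p.2 / p₀.2) (χ.toRingHom p₀.1)) → P χ)
    (hA : IsReallyStronglyNoetherian A.carrier)
    (h₀ : ∀ {C : AffinoidBanachRing.{u}} (χ : Hom A C), IsReallyStronglyNoetherian C.carrier →
      (∀ p ∈ L, ∀ y : Spra C, y.1.Le (χ.toRingHom p.1) (ρ * p.2) 1) → P χ) : P (Hom.id A) := by
  have key : ∀ l : List (A.carrier × PosReal), (∀ p ∈ l, p ∈ L) →
      ∀ {C : AffinoidBanachRing.{u}} (χ : Hom A C), IsReallyStronglyNoetherian C.carrier →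
      (∀ p ∈ L, p ∈ l ∨ ∀ y : Spra C, y.1.Le (χ.toRingHom p.1) (ρ * p.2) 1) → P χ := by
    intro l
    induction l with
    | nil =>
      intro _ C χ hC h
      exact h₀ χ hC fun p hp => (h p hp).resolve_left List.not_mem_nil
    | cons F l ih =>
      intro hl C χ hC hsmall
      refine hP χ hC (χ.toRingHom F.1) (ρ * F.2) ?_ ?_
      · set ι := C.toFraction (ρ * F.2) (χ.toRingHom F.1) 1
        refine ih (fun p hp => hl p (List.mem_cons_of_mem _ hp)) (ι.comp χ)
          (isReallyStronglyNoetherian_fractionAffinoid hC _ _ _) fun p hp => ?_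
        rcases hsmall p hp with h | h
        · rcases List.mem_cons.1 h with rfl | h
          · exact Or.inr fun y => le_laurent_left _ _ y
          · exact Or.inl h
        · refine Or.inr fun y => ?_
          rw [← map_one ι.toRingHom]
          exact ι.le_of_forall_le h y
      · set ι := C.toFraction (ρ * F.2)⁻¹ 1 (χ.toRingHom F.1)
        refine of_maximum_of_subset hP L ρ h₁ l (fun p hp => hl p (List.mem_cons_of_mem _ hp))
          (ι.comp χ) (isReallyStronglyNoetherian_fractionAffinoid hC _ _ _)
          (hl F List.mem_cons_self) (fun y => le_laurent_right _ _ y) fun p hp => ?_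
        rcases hsmall p hp with h | h
        · rcases List.mem_cons.1 h with rfl | h
          · refine Or.inr fun y => ?_
            rw [div_self']
            exact y.1.le_refl _
          · exact Or.inl h
        · refine Or.inr fun y => ?_
          have h := ι.le_of_forall_le h y
          rw [map_one ι.toRingHom] at h
          have h := h.trans (le_laurent_right _ _ y)
          rw [← div_eq_mul_inv, mul_div_mul_left_eq_div] at h
          exact h
  exact key L (fun p hp => hp) (Hom.id A) hA fun p hp => Or.inl hp

/-- The inequalities defining a rational subspace, including the trivial one. -/
def ratList (W : List (A.carrier × PosReal) × A.carrier × PosReal) :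
    List (A.carrier × PosReal) :=
  (W.2.1, 1) :: (1, W.2.2) :: W.1

theorem mem_ratSet_iff {W : List (A.carrier × PosReal) × A.carrier × PosReal} {x : Spra A} :
    x ∈ ratSet W.1 W.2.1 W.2.2 ↔ ∀ p ∈ ratList W, x.1.Le p.1 p.2 W.2.1 := by
  constructor
  · intro hx p hp
    rcases List.mem_cons.1 hp with rfl | hp
    · exact x.1.le_refl _
    rcases List.mem_cons.1 hp with rfl | hp
    exacts [hx.1, hx.2 p hp]
  · intro hx
    exact ⟨hx (1, W.2.2) (List.mem_cons_of_mem _ List.mem_cons_self), fun p hp =>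
      hx p (List.mem_cons_of_mem _ (List.mem_cons_of_mem _ hp))⟩

/-- The inductive form of `IsLaurentLocal.of_cover`. The rational subspaces already treated are
described by single inequalities `v(h) ≥ p`, for `(h, p)` in the list `M`; this is possible since
over the pieces of a suitable iterated Laurent covering the largest of the functions defining a
rational subspace is invertible. -/
theorem IsLaurentLocal.of_cover_aux {P : ∀ {C : AffinoidBanachRing.{u}}, Hom A C → Prop}
    (hP : IsLaurentLocal P)
    (hempty : ∀ {C : AffinoidBanachRing.{u}} (χ : Hom A C), IsEmpty (Spra C) → P χ)
    (R : List (List (A.carrier × PosReal) × A.carrier × PosReal))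
    (hR : ∀ {C : AffinoidBanachRing.{u}} (χ : Hom A C), IsReallyStronglyNoetherian C.carrier →
      ∀ W ∈ R, Set.range χ.spra ⊆ ratSet W.1 W.2.1 W.2.2 → P χ)
    {C : AffinoidBanachRing.{u}} (χ : Hom A C) (hC : IsReallyStronglyNoetherian C.carrier)
    (M : List (C.carrier × PosReal))
    (hM : ∀ {D : AffinoidBanachRing.{u}} (ψ : Hom C D), IsReallyStronglyNoetherian D.carrier →
      ∀ p ∈ M, (∀ y : Spra D, y.1.Le 1 p.2⁻¹ (ψ.toRingHom p.1)) → P (ψ.comp χ))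
    (hcov : ∀ y : Spra C, (∃ p ∈ M, y.1.Le 1 p.2⁻¹ p.1) ∨
      ∃ W ∈ R, χ.spra y ∈ ratSet W.1 W.2.1 W.2.2) : P χ := by
  induction R generalizing C with
  | nil =>
    let ρ : PosReal := ⟨1 / 2, by norm_num⟩
    have hQ : IsLaurentLocal fun {D} (ψ : Hom C D) => P (ψ.comp χ) :=
      fun _ ψ hD f q h₁ h₂ => hP (ψ.comp χ) hD f q h₁ h₂
    have hcov' : ∀ {D : AffinoidBanachRing.{u}} (ψ : Hom C D) (y : Spra D),
        ∃ p ∈ M, y.1.Le 1 p.2⁻¹ (ψ.toRingHom p.1) := by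
      intro D ψ y
      obtain ⟨p, hp, h⟩ := (hcov (ψ.spra y)).resolve_right (by simp)
      refine ⟨p, hp, ?_⟩
      rw [← map_one ψ.toRingHom]
      exact (Hom.spra_le _ _ _ _ _).1 h
    refine of_forall_maximum (P := fun {D} (ψ : Hom C D) => P (ψ.comp χ)) hQ M ρ ?_ hC ?_
    · intro D ψ hD p₀ hp₀ _ hmax
      refine hM ψ hD p₀ hp₀ fun y => ?_
      obtain ⟨p, hp, h⟩ := hcov' ψ y
      have h := h.trans (hmax p hp y)
      rwa [div_eq_mul_inv, inv_mul_cancel_left] at h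
    · intro D ψ hD hsmall
      refine hempty _ ⟨fun y => ?_⟩
      obtain ⟨p, hp, h⟩ := hcov' ψ y
      have h := h.trans (hsmall p hp y)
      rw [mul_comm ρ, inv_mul_cancel_left, Sprv.one_le_one_iff] at h
      have h : (1 : ℝ) ≤ 1 / 2 := h
      norm_num at h
  | cons W R ih =>
    -- with this `ρ` the function `1`, which is the second in the list, is never small
    let ρ : PosReal := ⟨1 / 2, by norm_num⟩ * W.2.2⁻¹
    let L := (ratList W).map fun p => (χ.toRingHom p.1, p.2)
    have hQ : IsLaurentLocal fun {D} (ψ : Hom C D) => P (ψ.comp χ) :=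
      fun _ ψ hD f q h₁ h₂ => hP (ψ.comp χ) hD f q h₁ h₂
    refine of_forall_maximum (P := fun {D} (ψ : Hom C D) => P (ψ.comp χ)) hQ L ρ ?_ hC ?_
    · intro D ψ hD p₀ hp₀ hlow hmax
      obtain ⟨p₀, hp₀', rfl⟩ := List.mem_map.1 hp₀
      have hmax' : ∀ p ∈ ratList W, ∀ y : Spra D, y.1.Le ((ψ.comp χ).toRingHom p.1) (p.2 / p₀.2)
          ((ψ.comp χ).toRingHom p₀.1) := fun p hp => hmax _ (List.mem_map_of_mem hp)
      obtain ⟨c, hc⟩ := (isUnit_of_forall_ne_zero fun y =>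
        Sprv.not_eqZero_of_one_le (hlow y)).exists_left_inv
      have hc : c * (ψ.comp χ).toRingHom p₀.1 = 1 := hc
      -- where `p₀` is the largest function, `W` is the locus `v(p₀) ≤ q₀ v(b)`
      let h := c * (ψ.comp χ).toRingHom W.2.1
      refine ih (fun χ hC W hW => hR χ hC W (List.mem_cons_of_mem _ hW)) (ψ.comp χ) hD
        ((h, p₀.2⁻¹) :: M.map fun p => (ψ.toRingHom p.1, p.2)) ?_ ?_
      · intro E θ hE p hp
        rcases List.mem_cons.1 hp with rfl | hp
        · intro hy
          refine hR _ hE W List.mem_cons_self ?_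
          rintro _ ⟨y, rfl⟩
          rw [mem_ratSet_iff]
          intro p hp
          rw [Hom.spra_le]
          have h1 := (hy y).mul (y.1.le_refl (θ.toRingHom ((ψ.comp χ).toRingHom p₀.1)))
          rw [← map_mul, mul_right_comm, hc, one_mul, one_mul, mul_one, inv_inv] at h1
          have h2 := (θ.le_of_forall_le (hmax' p hp) y).trans h1
          rwa [div_mul_cancel] at h2
        · obtain ⟨s, hs, rfl⟩ := List.mem_map.1 hp
          exact hM (θ.comp ψ) hE s hs
      · intro y
        rcases hcov (ψ.spra y) with ⟨p, hp, h'⟩ | ⟨V, hV, hy⟩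
        · refine Or.inl ⟨_, List.mem_cons_of_mem _ (List.mem_map_of_mem hp), ?_⟩
          rw [← map_one ψ.toRingHom]
          exact (Hom.spra_le _ _ _ _ _).1 h'
        · rw [← Hom.spra_comp] at hy
          rcases List.mem_cons.1 hV with rfl | hV
          · refine Or.inl ⟨_, List.mem_cons_self, ?_⟩
            have h1 := (Hom.spra_le _ _ _ _ _).1 (mem_ratSet_iff.1 hy p₀ hp₀')
            have h2 := (y.1.le_refl c).mul h1
            rw [hc, one_mul] at h2
            rwa [inv_inv]
          · exact Or.inr ⟨V, hV, hy⟩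
    · intro D ψ hD hsmall
      refine hempty _ ⟨fun y => ?_⟩
      have h := hsmall _ (List.mem_map_of_mem (List.mem_cons_of_mem _ List.mem_cons_self)) y
      rw [map_one, map_one, inv_mul_cancel_right, Sprv.one_le_one_iff] at h
      have h : (1 : ℝ) ≤ 1 / 2 := h
      norm_num at h

/-- A Laurent-local property may be checked on a covering of `Spra(A)` by finitely many rational
subspaces. -/
theorem IsLaurentLocal.of_cover {P : ∀ {C : AffinoidBanachRing.{u}}, Hom A C → Prop}
    (hP : IsLaurentLocal P) (hA : IsReallyStronglyNoetherian A.carrier)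
    (hempty : ∀ {C : AffinoidBanachRing.{u}} (χ : Hom A C), IsEmpty (Spra C) → P χ)
    (R : List (List (A.carrier × PosReal) × A.carrier × PosReal))
    (hR : ∀ {C : AffinoidBanachRing.{u}} (χ : Hom A C), IsReallyStronglyNoetherian C.carrier →
      ∀ W ∈ R, Set.range χ.spra ⊆ ratSet W.1 W.2.1 W.2.2 → P χ)
    (hcov : ∀ x : Spra A, ∃ W ∈ R, x ∈ ratSet W.1 W.2.1 W.2.2) : P (Hom.id A) := by
  refine hP.of_cover_aux hempty R hR (Hom.id A) hA [] (by simp) fun y => Or.inr ?_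
  have e : (Hom.id A).spra y = y := Subtype.ext (by
    obtain ⟨y, hy⟩ := y
    induction y using Quotient.inductionOn
    rfl)
  rw [e]
  exact hcov y

end AffinoidBanachRing

/-! ### Gluing of sections -/

namespace AffinoidBanachRing

variable {A B C : AffinoidBanachRing.{u}}

/-- Two rational localizations with morphisms to `C` agreeing on `A` factor through a common
rational localization inside the intersection. -/
theorem RationalLocalization.exists_inter (hA : IsReallyStronglyNoetherian A.carrier)
    {U U' : Set (Spra A)} (L : RationalLocalization A U) (L' : RationalLocalization A U')
    (g : Hom L.B C) (g' : Hom L'.B C) (h : g.comp L.φ = g'.comp L'.φ) :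
    ∃ (M : RationalLocalization A (U ∩ U')) (k : Hom L.B M.B) (k' : Hom L'.B M.B)
      (m : Hom M.B C), k.comp L.φ = M.φ ∧ k'.comp L'.φ = M.φ ∧ m.comp k = g ∧ m.comp k' = g' := by
  obtain ⟨V, hV, hVU, hL⟩ := L.exists_represents
  obtain ⟨V', hV', hVU', hL'⟩ := L'.exists_represents
  have hVV := hV.inter hV'
  obtain ⟨l, b, ρ, hl⟩ := hVV.exists_ratSet
  obtain ⟨D, φ, hφ, -⟩ := exists_represents_ratSet hA l b ρ
  rw [← hl] at hφ
  have hg : Set.range (g.comp L.φ).spra ⊆ V := by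
    rintro _ ⟨y, rfl⟩
    rw [Hom.spra_comp]
    exact hL.range_subset ⟨_, rfl⟩
  have hg' : Set.range (g'.comp L'.φ).spra ⊆ V' := by
    rintro _ ⟨y, rfl⟩
    rw [Hom.spra_comp]
    exact hL'.range_subset ⟨_, rfl⟩
  obtain ⟨k, hk, -⟩ := hL.existsUnique D φ (hφ.range_subset.trans Set.inter_subset_left)
  obtain ⟨k', hk', -⟩ := hL'.existsUnique D φ (hφ.range_subset.trans Set.inter_subset_right)
  obtain ⟨m, hm, -⟩ := hφ.existsUnique C (g.comp L.φ) (Set.subset_inter hg (h ▸ hg'))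
  refine ⟨⟨D, φ, V ∩ V', hVV, Set.inter_subset_inter hVU hVU', hφ⟩, k, k', m, hk, hk', ?_, ?_⟩
  · exact (hL.existsUnique C _ hg).unique (show m.comp (k.comp L.φ) = _ by rw [hk, hm]) rfl
  · exact (hL'.existsUnique C _ hg').unique
      (show m.comp (k'.comp L'.φ) = _ by rw [hk', hm, h]) rfl

section Family

variable {ι : Type*} {U : ι → Set (Spra A)}

/-- The morphism `φ` factors through a rational localization inside some `U i`. -/
def IsSubordinate (U : ι → Set (Spra A)) (φ : Hom A B) : Prop :=
  ∃ (i : ι) (L : RationalLocalization A (U i)) (g : Hom L.B B), g.comp L.φ = φ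

/-- The element `b` is the value which the sections `s i` take along `φ`. -/
def IsValue (s : ∀ i, A.sections (U i)) (φ : Hom A B) (b : B.carrier) : Prop :=
  ∀ (i : ι) (L : RationalLocalization A (U i)) (g : Hom L.B B), g.comp L.φ = φ →
    g.toRingHom ((s i).1 L) = b

/-- The element `b` restricts to the values of the sections `s i` along all morphisms to really
strongly noetherian rings which factor through some `U i`. -/
def IsGluedValue (s : ∀ i, A.sections (U i)) (φ : Hom A B) (b : B.carrier) : Prop :=
  ∀ ⦃C : AffinoidBanachRing.{u}⦄ (χ : Hom B C), IsReallyStronglyNoetherian C.carrier →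
    IsSubordinate U (χ.comp φ) → IsValue s (χ.comp φ) (χ.toRingHom b)

/-- The sections `s i` glue uniquely along all morphisms which factor through `φ`. -/
def GluesOver (s : ∀ i, A.sections (U i)) (φ : Hom A B) : Prop :=
  ∀ ⦃C : AffinoidBanachRing.{u}⦄ (χ : Hom B C), IsReallyStronglyNoetherian C.carrier →
    ∃! c, IsGluedValue s (χ.comp φ) c

variable {s : ∀ i, A.sections (U i)}

theorem IsSubordinate.comp {φ : Hom A B} (h : IsSubordinate U φ) (χ : Hom B C) :
    IsSubordinate U (χ.comp φ) := by
  obtain ⟨i, L, g, rfl⟩ := h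
  exact ⟨i, L, χ.comp g, rfl⟩

theorem IsValue.unique {φ : Hom A B} (h : IsSubordinate U φ) {b b' : B.carrier}
    (hb : IsValue s φ b) (hb' : IsValue s φ b') : b = b' := by
  obtain ⟨i, L, g, hg⟩ := h
  rw [← hb i L g hg, hb' i L g hg]

theorem IsSubordinate.exists_isValue (hA : IsReallyStronglyNoetherian A.carrier)
    (hs : ∀ i j (L : RationalLocalization A (U i ∩ U j)),
      (s i).1 (L.ofSubset Set.inter_subset_left) = (s j).1 (L.ofSubset Set.inter_subset_right))
    {φ : Hom A B} (h : IsSubordinate U φ) : ∃ b, IsValue s φ b := by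
  obtain ⟨i, L, g, hg⟩ := h
  refine ⟨g.toRingHom ((s i).1 L), fun j L' g' hg' => ?_⟩
  obtain ⟨M, k, k', m, hk, hk', rfl, rfl⟩ := L.exists_inter hA L' g g' (hg.trans hg'.symm)
  have h1 := (s i).2 L (M.ofSubset Set.inter_subset_left) k hk
  have h2 := (s j).2 L' (M.ofSubset Set.inter_subset_right) k' hk'
  exact congrArg m.toRingHom (h2.trans ((hs i j M).symm.trans h1.symm))

theorem IsSubordinate.isValue_comp (hA : IsReallyStronglyNoetherian A.carrier)
    (hs : ∀ i j (L : RationalLocalization A (U i ∩ U j)),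
      (s i).1 (L.ofSubset Set.inter_subset_left) = (s j).1 (L.ofSubset Set.inter_subset_right))
    {φ : Hom A B} (h : IsSubordinate U φ) {b : B.carrier} (hb : IsValue s φ b) (χ : Hom B C) :
    IsValue s (χ.comp φ) (χ.toRingHom b) := by
  obtain ⟨c, hc⟩ := (h.comp χ).exists_isValue hA hs
  obtain ⟨i, L, g, rfl⟩ := h
  rw [← hb i L g rfl, show χ.toRingHom (g.toRingHom ((s i).1 L)) = c from hc i L (χ.comp g) rfl]
  exact hc

theorem IsGluedValue.comp {φ : Hom A B} {b : B.carrier} (h : IsGluedValue s φ b) (χ : Hom B C) :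
    IsGluedValue s (χ.comp φ) (χ.toRingHom b) :=
  fun _ θ hD hθ => h (θ.comp χ) hD hθ

theorem GluesOver.comp {φ : Hom A B} (h : GluesOver s φ) (χ : Hom B C) :
    GluesOver s (χ.comp φ) :=
  fun _ θ hD => h (θ.comp χ) hD

theorem IsSubordinate.gluesOver (hA : IsReallyStronglyNoetherian A.carrier)
    (hs : ∀ i j (L : RationalLocalization A (U i ∩ U j)),
      (s i).1 (L.ofSubset Set.inter_subset_left) = (s j).1 (L.ofSubset Set.inter_subset_right))
    {φ : Hom A B} (h : IsSubordinate U φ) : GluesOver s φ := by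
  intro C χ hC
  obtain ⟨c, hc⟩ := (h.comp χ).exists_isValue hA hs
  exact ⟨c, fun _ θ _ _ => (h.comp χ).isValue_comp hA hs hc θ, fun c' hc' =>
    IsValue.unique (h.comp χ) (hc' (Hom.id C) hC (h.comp χ)) hc⟩

/-- Over an empty spectrum there is only the zero ring, and nothing to glue. -/
theorem gluesOver_of_isEmpty (φ : Hom A B) (h : IsEmpty (Spra B)) : GluesOver s φ := by
  have hsub : ∀ {C : AffinoidBanachRing.{u}}, Hom B C → Subsingleton C.carrier := fun χ =>
    subsingleton_of_isEmpty_spra ⟨fun y => h.elim (χ.spra y)⟩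
  intro C χ _
  have := hsub χ
  refine ⟨0, fun _ θ _ _ i L g _ => ?_, fun c _ => Subsingleton.elim _ _⟩
  have := hsub (θ.comp χ)
  exact Subsingleton.elim _ _

/-- The pieces of the Laurent covering of `Spra(C)` defined by the image of `f` map to those of the
Laurent covering of `Spra(B)` defined by `f`. -/
theorem exists_hom_laurent_left (χ : Hom B C) (f : B.carrier) (q : PosReal) :
    ∃ θ : Hom (B.fractionAffinoid q f 1) (C.fractionAffinoid q (χ.toRingHom f) 1),
      θ.comp (B.toFraction q f 1) = (C.toFraction q (χ.toRingHom f) 1).comp χ := by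
  refine (exists_hom_fractionAffinoid _ (fun y => ?_) fun y => ?_).exists
  · rw [map_one]
    exact le_laurent_left _ _ y
  · rw [map_one]
    exact Sprv.not_eqZero_one

theorem exists_hom_laurent_right (χ : Hom B C) (f : B.carrier) (q : PosReal) :
    ∃ θ : Hom (B.fractionAffinoid q⁻¹ 1 f) (C.fractionAffinoid q⁻¹ 1 (χ.toRingHom f)),
      θ.comp (B.toFraction q⁻¹ 1 f) = (C.toFraction q⁻¹ 1 (χ.toRingHom f)).comp χ := by
  refine (exists_hom_fractionAffinoid _ (fun y => ?_) fun y => ?_).exists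
  · rw [map_one]
    exact le_laurent_right _ _ y
  · exact Sprv.not_eqZero_of_one_le (le_laurent_right _ _ y)

/-- Glued values over the two pieces of a simple Laurent covering agree on the annulus, and so come
from a unique element; to see that it is a glued value, base change the covering. -/
theorem existsUnique_isGluedValue_of_laurent (hA : IsReallyStronglyNoetherian A.carrier)
    (hs : ∀ i j (L : RationalLocalization A (U i ∩ U j)),
      (s i).1 (L.ofSubset Set.inter_subset_left) = (s j).1 (L.ofSubset Set.inter_subset_right))
    (φ : Hom A B) (hB : IsReallyStronglyNoetherian B.carrier) (f : B.carrier) (q : PosReal)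
    (h₁ : GluesOver s ((B.toFraction q f 1).comp φ))
    (h₂ : GluesOver s ((B.toFraction q⁻¹ 1 f).comp φ)) : ∃! b, IsGluedValue s φ b := by
  obtain ⟨b₁, hb₁, hb₁'⟩ := h₁ (Hom.id _) (isReallyStronglyNoetherian_fractionAffinoid hB _ _ _)
  obtain ⟨b₂, hb₂, hb₂'⟩ := h₂ (Hom.id _) (isReallyStronglyNoetherian_fractionAffinoid hB _ _ _)
  obtain ⟨Z, χ₁, χ₂, hZ, hχ, hglue⟩ := exists_laurent_annulus hB f q
  have hb : χ₁.toRingHom b₁ = χ₂.toRingHom b₂ := by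
    refine (h₁ χ₁ hZ).unique (IsGluedValue.comp hb₁ χ₁) ?_
    have h : IsGluedValue s ((χ₂.comp (B.toFraction q⁻¹ 1 f)).comp φ) (χ₂.toRingHom b₂) :=
      IsGluedValue.comp hb₂ χ₂
    rw [← hχ] at h
    exact h
  obtain ⟨a, ⟨ha₁, ha₂⟩, ha'⟩ := hglue b₁ b₂ hb
  refine ⟨a, fun C χ hC hχφ => ?_, fun a' h => ?_⟩
  · obtain ⟨c, hc⟩ := hχφ.exists_isValue hA hs
    obtain ⟨θ₁, hθ₁⟩ := exists_hom_laurent_left χ f q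
    obtain ⟨θ₂, hθ₂⟩ := exists_hom_laurent_right χ f q
    obtain ⟨Z', χ₁', χ₂', -, hχ', hglue'⟩ := exists_laurent_annulus hC (χ.toRingHom f) q
    have e₁ : (C.toFraction q (χ.toRingHom f) 1).toRingHom (χ.toRingHom a) =
        (C.toFraction q (χ.toRingHom f) 1).toRingHom c := by
      refine IsValue.unique (hχφ.comp _) ?_ (hχφ.isValue_comp hA hs hc _)
      have h := hb₁ θ₁ (isReallyStronglyNoetherian_fractionAffinoid hC _ _ _) (by
        change IsSubordinate U ((θ₁.comp (B.toFraction q f 1)).comp φ)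
        rw [hθ₁]
        exact hχφ.comp (C.toFraction q (χ.toRingHom f) 1))
      change IsValue s ((θ₁.comp (B.toFraction q f 1)).comp φ) _ at h
      rw [hθ₁, ← ha₁] at h
      change IsValue s _ ((θ₁.comp (B.toFraction q f 1)).toRingHom a) at h
      rw [hθ₁] at h
      exact h
    have e₂ : (C.toFraction q⁻¹ 1 (χ.toRingHom f)).toRingHom (χ.toRingHom a) =
        (C.toFraction q⁻¹ 1 (χ.toRingHom f)).toRingHom c := by
      refine IsValue.unique (hχφ.comp _) ?_ (hχφ.isValue_comp hA hs hc _)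
      have h := hb₂ θ₂ (isReallyStronglyNoetherian_fractionAffinoid hC _ _ _) (by
        change IsSubordinate U ((θ₂.comp (B.toFraction q⁻¹ 1 f)).comp φ)
        rw [hθ₂]
        exact hχφ.comp (C.toFraction q⁻¹ 1 (χ.toRingHom f)))
      change IsValue s ((θ₂.comp (B.toFraction q⁻¹ 1 f)).comp φ) _ at h
      rw [hθ₂, ← ha₂] at h
      change IsValue s _ ((θ₂.comp (B.toFraction q⁻¹ 1 f)).toRingHom a) at h
      rw [hθ₂] at h
      exact h
    have e := (hglue' _ _ (congrArg (fun k : Hom C Z' => k.toRingHom c) hχ')).unique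
      ⟨e₁, e₂⟩ ⟨rfl, rfl⟩
    rw [e]
    exact hc
  · exact ha' a' ⟨hb₁' _ (h.comp (B.toFraction q f 1)),
      hb₂' _ (h.comp (B.toFraction q⁻¹ 1 f))⟩

theorem isLaurentLocal_gluesOver (hA : IsReallyStronglyNoetherian A.carrier)
    (hs : ∀ i j (L : RationalLocalization A (U i ∩ U j)),
      (s i).1 (L.ofSubset Set.inter_subset_left) = (s j).1 (L.ofSubset Set.inter_subset_right))
    (φ : Hom A B) : IsLaurentLocal fun {C} (χ : Hom B C) => GluesOver s (χ.comp φ) := by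
  intro C χ _ f q h₁ h₂ D θ hD
  obtain ⟨θ₁, hθ₁⟩ := exists_hom_laurent_left θ f q
  obtain ⟨θ₂, hθ₂⟩ := exists_hom_laurent_right θ f q
  refine existsUnique_isGluedValue_of_laurent hA hs (θ.comp (χ.comp φ)) hD (θ.toRingHom f) q ?_ ?_
  · have h := GluesOver.comp h₁ θ₁
    change GluesOver s ((θ₁.comp (C.toFraction q f 1)).comp (χ.comp φ)) at h
    rw [hθ₁] at h
    exact h
  · have h := GluesOver.comp h₂ θ₂
    change GluesOver s ((θ₂.comp (C.toFraction q⁻¹ 1 f)).comp (χ.comp φ)) at h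
    rw [hθ₂] at h
    exact h

/-- Sections glue over every rational localization inside the union, by compactness of its spectrum
and `IsLaurentLocal.of_cover`. -/
theorem RationalLocalization.gluesOver (hA : IsReallyStronglyNoetherian A.carrier)
    (hU : ∀ i, IsOpen (U i))
    (hs : ∀ i j (L : RationalLocalization A (U i ∩ U j)),
      (s i).1 (L.ofSubset Set.inter_subset_left) = (s j).1 (L.ofSubset Set.inter_subset_right))
    (L : RationalLocalization A (⋃ i, U i)) : GluesOver s L.φ := by
  have hpt : ∀ y : Spra L.B, ∃ W : List (A.carrier × PosReal) × A.carrier × PosReal,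
      L.φ.spra y ∈ ratSet W.1 W.2.1 W.2.2 ∧ ∃ i, ratSet W.1 W.2.1 W.2.2 ⊆ U i := by
    intro y
    obtain ⟨V, -, hVU, hL⟩ := L.exists_represents
    obtain ⟨i, hi⟩ := Set.mem_iUnion.1 (hVU (hL.range_subset ⟨y, rfl⟩))
    obtain ⟨l, b, ρ, h1, h2⟩ := exists_ratSet_subset (hU i) hi
    exact ⟨(l, b, ρ), h1, i, h2⟩
  choose W hW hWU using hpt
  obtain ⟨t, ht⟩ := isCompact_univ.elim_finite_subcover
    (fun y => L.φ.spra ⁻¹' ratSet (W y).1 (W y).2.1 (W y).2.2)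
    (fun y => by
      rw [preimage_ratSet]
      exact isOpen_ratSet _ _ _)
    (fun y _ => Set.mem_iUnion.2 ⟨y, hW y⟩)
  refine (isLaurentLocal_gluesOver hA hs L.φ).of_cover (L.isReallyStronglyNoetherian hA)
    (fun χ h => gluesOver_of_isEmpty _ h)
    (t.toList.map fun y => ((W y).1.map fun p => (L.φ.toRingHom p.1, p.2),
      L.φ.toRingHom (W y).2.1, (W y).2.2)) ?_ ?_
  · intro C χ hC V hV hχ
    obtain ⟨y, -, rfl⟩ := List.mem_map.1 hV
    refine IsSubordinate.gluesOver hA hs ?_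
    obtain ⟨i, hi⟩ := hWU y
    obtain ⟨D, φ, hφ, -⟩ := exists_represents_ratSet hA (W y).1 (W y).2.1 (W y).2.2
    obtain ⟨g, hg, -⟩ := hφ.existsUnique C (χ.comp L.φ) (by
      rintro _ ⟨z, rfl⟩
      rw [Hom.spra_comp]
      have hz : χ.spra z ∈ ratSet ((W y).1.map fun p => (L.φ.toRingHom p.1, p.2))
        (L.φ.toRingHom (W y).2.1) (W y).2.2 := hχ ⟨z, rfl⟩
      rw [← preimage_ratSet] at hz
      exact hz)
    exact ⟨i, ⟨D, φ, _, isRational_ratSet _ _ _, hi, hφ⟩, g, hg⟩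
  · intro y
    obtain ⟨z, hz, hy⟩ := Set.mem_iUnion₂.1 (ht (Set.mem_univ y))
    refine ⟨_, List.mem_map_of_mem (Finset.mem_toList.2 hz), ?_⟩
    rw [preimage_ratSet] at hy
    exact hy

/-- Compatible sections over the members of an open covering glue uniquely. -/
theorem existsUnique_section (hA : IsReallyStronglyNoetherian A.carrier)
    (hU : ∀ i, IsOpen (U i)) {V : Set (Spra A)} (hV : V = ⋃ i, U i)
    (hs : ∀ i j (L : RationalLocalization A (U i ∩ U j)),
      (s i).1 (L.ofSubset Set.inter_subset_left) = (s j).1 (L.ofSubset Set.inter_subset_right)) :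
    ∃! t : A.sections V, ∀ i, A.restriction (hV ▸ Set.subset_iUnion U i) t = s i := by
  subst hV
  have hglue : ∀ L : RationalLocalization A (⋃ i, U i), ∃! b, IsGluedValue s L.φ b := fun L =>
    L.gluesOver hA hU hs (Hom.id L.B) (L.isReallyStronglyNoetherian hA)
  choose t ht ht' using hglue
  have htsec : t ∈ A.sections (⋃ i, U i) := fun L L' g hg => ht' L' _ (by
    have h := IsGluedValue.comp (ht L) g
    rwa [hg] at h)
  refine ⟨⟨t, htsec⟩, fun i => Subtype.ext (funext fun L => ?_), fun t' h => ?_⟩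
  · have hsub : IsSubordinate U L.φ := ⟨i, L, Hom.id L.B, rfl⟩
    exact (ht (L.ofSubset (Set.subset_iUnion U i)) (Hom.id L.B) (L.isReallyStronglyNoetherian hA)
      hsub i L (Hom.id L.B) rfl).symm
  · refine Subtype.ext (funext fun L => ht' L _ fun C χ _ _ i L' g hg => ?_)
    obtain ⟨M, k, k', m, hk, hk', rfl, rfl⟩ := L.exists_inter hA L' χ g hg.symm
    have h1 := t'.2 L (M.ofSubset Set.inter_subset_left) k hk
    have h2 := (s i).2 L' (M.ofSubset Set.inter_subset_right) k' hk'
    have h3 := congrArg (fun z : A.sections (U i) => z.1 (M.ofSubset Set.inter_subset_right)) (h i)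
    exact congrArg m.toRingHom (h2.trans (h3.symm.trans h1.symm))

end Family

theorem isSheafy_of_isReallyStronglyNoetherian (hA : IsReallyStronglyNoetherian A.carrier) :
    A.IsSheafy := by
  refine (TopCat.Presheaf.isSheaf_iff_isSheafUniqueGluing _).2 fun ι U sf hsf => ?_
  have hV : ((iSup U : TopologicalSpace.Opens (TopCat.of (Spra A))) : Set (Spra A)) =
      ⋃ i, (U i : Set (Spra A)) := TopologicalSpace.Opens.coe_iSup U
  exact existsUnique_section (s := sf) hA (fun i => (U i).2) hV fun i j L =>
    congrArg (fun z : A.sections ((U i : Set (Spra A)) ∩ U j) => z.1 L) (hsf i j)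

end AffinoidBanachRing

end

end Readic

theorem theoremT (A : Readic.AffinoidBanachRing.{u})
    (hA : Readic.IsReallyStronglyNoetherian A.carrier) : A.IsSheafy :=
  A.isSheafy_of_isReallyStronglyNoetherian hA
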